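/- Let $\Sigma$ be a finite alphabet with a fixed total order, and extend this order co-lexicographically to $\Sigma^*$: $\alpha \prec \beta$ if and only if the reverse of $\alpha$ is lexicographically smaller than the reverse of $\beta$. A generalized non-deterministic finite automaton (GNFA) is a tuple $\mathcal{A} = (Q, E, s, F)$ with a finite set $Q$ of states, a finite set $E \subseteq Q \times Q \times \Sigma^*$ of string-labeled edges, an initial state $s \in Q$ and a set $F \subseteq Q$ of final states, such that every state is reachable from $s$ and from every state some final state can be reached. It is a generalized deterministic finite automaton (GDFA) if, for every $u \in Q$, no edge leaving $u$ is labeled with the empty string, distinct edges leaving $u$ have distinct labels, and the set of the labels of the edges leaving $u$ is prefix-free. For $u \in Q$ let $I_u$ be the set of all strings that can be read from $s$ to $u$ by concatenating edge labels, and let $\preceq_{\mathcal{A}}$ be the reflexive relation on $Q$ such that, for $u \neq v$, $u \prec_{\mathcal{A}} v$ holds if and only if $\alpha \prec \beta$ for all $\alpha \in I_u$ and all $\beta \in I_v$. A GDFA $\mathcal{A}$ is called Wheeler if $\preceq_{\mathcal{A}}$ is a total order on $Q$. There is an algorithm that, given a GDFA $\mathcal{A}$ whose edge labels have total length $\mathfrak{e}$,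 decides in $O(\mathfrak{e} \log \mathfrak{e})$ time whether $\mathcal{A}$ is Wheeler and, if so, computes $\preceq_{\mathcal{A}}$, that is, outputs the list of all states in increasing order with respect to $\preceq_{\mathcal{A}}$. More precisely, the algorithm is a single program for a word RAM with unit-cost operations on words of $w$ bits. Its input is the list of numbers consisting of the number of states, the initial state, the number of edges, the final-state bits, and, for each edge in an arbitrary order, its source, its target, the length of its label and the letters of its label; the states are numbered arbitrarily from $0$ and the letters are numbered from $0$ in increasing order. There are constants $c$ and $C$, independent of $\mathcal{A}$ and $\Sigma$, such that for every GDFA $\mathcal{A}$ and every word length $w$ with $2^w \ge (|\Sigma| + \mathfrak{e} + 2)^c$ the program halts with the correct output after at most $C(\mathfrak{e} \log \mathfrak{e} + 1)$ steps (where $0 \log 0 = 0$). -/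

import Mathlib

/-! ### Generalized automata -/

/-- A generalized non-deterministic finite automaton without its trimness requirement:
states `Q`, finitely many edges `(u, v, ρ)` from `u` to `v` labelled by a string `ρ`, an initial
state and final states. -/
structure PreGNFA (α : Type*) (Q : Type*) where
  edges : Finset (Q × Q × List α)
  start : Q
  final : Set Q

namespace PreGNFA

variable {α : Type*} {Q : Type*}

/-- `A.Reads u w v`: some walk along edges from `u` to `v` has labels with concatenation `w`. -/
inductive Reads (A : PreGNFA α Q) : Q → List α → Q → Prop
  | nil (u : Q) : Reads A u [] u
  | cons {u v z : Q} {ρ w : List α} :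
      (u, v, ρ) ∈ A.edges → Reads A v w z → Reads A u (ρ ++ w) z

/-- `I_u`: the strings that can be read from the initial state to `u`. -/
def stringsTo (A : PreGNFA α Q) (u : Q) : Set (List α) := {w | A.Reads A.start w u}

/-- The total length `𝔢` of all edge labels. -/
def totalLabelLength (A : PreGNFA α Q) : ℕ := ∑ x ∈ A.edges, x.2.2.length

end PreGNFA

/-- A generalized non-deterministic finite automaton: every state is reachable from the initial
state, and from every state one can reach a final state. -/
structure GNFA (α : Type*) (Q : Type*) extends PreGNFA α Q where
  finite_states : Finite Q
  reachable : ∀ u, ∃ w, toPreGNFA.Reads start w u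
  coreachable : ∀ u, ∃ w, ∃ f ∈ final, toPreGNFA.Reads u w f

namespace GNFA

variable {α : Type*} {Q : Type*}

/-- The automaton is deterministic (a GDFA): no edge is labelled with the empty string, distinct
edges leaving a state have distinct labels, and the set of labels of the edges leaving a state
is prefix-free (no label is a strict prefix of another one). -/
structure IsGDFA (A : GNFA α Q) : Prop where
  label_ne_nil : ∀ u v ρ, (u, v, ρ) ∈ A.edges → ρ ≠ []
  target_unique : ∀ u v v' ρ, (u, v, ρ) ∈ A.edges → (u, v', ρ) ∈ A.edges → v = v'
  prefix_free : ∀ u v v' ρ ρ', (u, v, ρ) ∈ A.edges → (u, v', ρ') ∈ A.edges →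
    ρ <+: ρ' → ρ = ρ'

end GNFA

/-! ### The co-lexicographic order and Wheeler automata -/

/-- `a ≺ b` co-lexicographically: the reverse of `a` is lexicographically smaller than the
reverse of `b` (a strict prefix being smaller). -/
def ColexLT {α : Type*} [LinearOrder α] (a b : List α) : Prop := a.reverse < b.reverse

namespace GNFA

variable {α : Type*} {Q : Type*} [LinearOrder α]

/-- The relation `⪯_A` on the states. -/
def le (A : GNFA α Q) (u v : Q) : Prop :=
  u = v ∨ ∀ a ∈ A.stringsTo u, ∀ b ∈ A.stringsTo v, ColexLT a b

/-- The automaton is Wheeler: `⪯_A` is a total order. -/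
def IsWheeler (A : GNFA α Q) : Prop :=
  (∀ u, A.le u u) ∧ (∀ u v, A.le u v → A.le v u → u = v) ∧
    (∀ u v z, A.le u v → A.le v z → A.le u z) ∧ ∀ u v, A.le u v ∨ A.le v u

open Classical in
/-- The automaton as a sequence of numbers. States are numbered by `ν`, the letters of the alphabet
are numbered increasingly by `κ`, and `l` lists the edges. The sequence holds the number of
states, the initial state and the number of edges; then one bit for every state, which tells
whether the state is final; then, for every edge, its source, its target, the length of its label
and the letters of its label. -/
noncomputable def encode (A : GNFA α Q) {n σ : ℕ} (ν : Q ≃ Fin n) (κ : α ≃o Fin σ)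
    (l : List (Q × Q × List α)) : List ℕ :=
  [n, (ν A.start : ℕ), l.length] ++
    (List.finRange n).map (fun i => if ν.symm i ∈ A.final then 1 else 0) ++
    l.flatMap (fun x =>
      (ν x.1 : ℕ) :: (ν x.2.1 : ℕ) :: x.2.2.length :: x.2.2.map (fun a => (κ a : ℕ)))

end GNFA

/-! ### A word RAM

Random access machine with words of `w` bits (numbers below `2 ^ w`), a memory addressed by words,
finitely many registers in each program, and structured programs. Evaluating one node of an
expression, executing one assignment or store, and performing one test each cost one step. -/

namespace WordRAM

/-- The binary operations of the machine; comparisons return `1` or `0`. -/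
inductive BinOp
  | add | sub | mul | div | mod | lt | eq

/-- Results are words: sums and products are reduced modulo `2 ^ w`. Subtraction is truncated
at `0`, and division by `0` returns `0`. -/
def BinOp.eval (w : ℕ) : BinOp → ℕ → ℕ → ℕ
  | add, x, y => (x + y) % 2 ^ w
  | sub, x, y => x - y
  | mul, x, y => (x * y) % 2 ^ w
  | div, x, y => x / y
  | mod, x, y => x % y
  | lt, x, y => if x < y then 1 % 2 ^ w else 0
  | eq, x, y => if x = y then 1 % 2 ^ w else 0

/-- A configuration: the contents of the registers and of the memory. -/
structure Config where
  reg : ℕ → ℕ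
  mem : ℕ → ℕ

/-- Expressions: constants, registers, memory look-up at a computed address, operations. -/
inductive Expr
  | lit (k : ℕ)
  | reg (r : ℕ)
  | load (addr : Expr)
  | bin (op : BinOp) (x y : Expr)

/-- The value of an expression. -/
def Expr.eval (w : ℕ) (s : Config) : Expr → ℕ
  | lit k => k % 2 ^ w
  | reg r => s.reg r
  | load a => s.mem (a.eval w s)
  | bin op x y => op.eval w (x.eval w s) (y.eval w s)

/-- The number of steps that it takes to evaluate an expression. -/
def Expr.cost : Expr → ℕ
  | lit _ => 1
  | reg _ => 1
  | load a => a.cost + 1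
  | bin _ x y => x.cost + y.cost + 1

/-- Programs. A test succeeds if the value of the expression is not `0`. -/
inductive Program
  | skip
  | assign (r : ℕ) (x : Expr)
  | store (addr x : Expr)
  | seq (p q : Program)
  | ite (b : Expr) (p q : Program)
  | while (b : Expr) (p : Program)

/-- `Run w p s t s'`: on words of `w` bits, the program `p` started in the configuration `s` halts
after exactly `t` steps in the configuration `s'`. -/
inductive Run (w : ℕ) : Program → Config → ℕ → Config → Prop
  | skip (s : Config) : Run w .skip s 1 s
  | assign (r : ℕ) (x : Expr) (s : Config) :
      Run w (.assign r x) s (x.cost + 1) { s with reg := Function.update s.reg r (x.eval w s) }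
  | store (a x : Expr) (s : Config) :
      Run w (.store a x) s (a.cost + x.cost + 1)
        { s with mem := Function.update s.mem (a.eval w s) (x.eval w s) }
  | seq {p q : Program} {s s₁ s₂ : Config} {t₁ t₂ : ℕ} :
      Run w p s t₁ s₁ → Run w q s₁ t₂ s₂ → Run w (.seq p q) s (t₁ + t₂) s₂
  | ite_true {b : Expr} {p q : Program} {s s₁ : Config} {t : ℕ} :
      b.eval w s ≠ 0 → Run w p s t s₁ → Run w (.ite b p q) s (b.cost + 1 + t) s₁
  | ite_false {b : Expr} {p q : Program} {s s₁ : Config} {t : ℕ} :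
      b.eval w s = 0 → Run w q s t s₁ → Run w (.ite b p q) s (b.cost + 1 + t) s₁
  | while_true {b : Expr} {p : Program} {s s₁ s₂ : Config} {t₁ t₂ : ℕ} :
      b.eval w s ≠ 0 → Run w p s t₁ s₁ → Run w (.while b p) s₁ t₂ s₂ →
        Run w (.while b p) s (b.cost + 1 + t₁ + t₂) s₂
  | while_false {b : Expr} {p : Program} {s : Config} :
      b.eval w s = 0 → Run w (.while b p) s (b.cost + 1) s

/-- The initial configuration: the input is in the memory from address `0` on; all other cells
and all registers hold `0`. -/
def initial (input : List ℕ) : Config where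
  reg := fun _ => 0
  mem := fun i => input.getD i 0

end WordRAM

/-!
Split every edge of the automaton into single letters. This gives a *letter graph* (`recEdges`),
whose nodes are the states and the positions inside labels, and a state `u` is reached in it exactly
by the strings in `I_u` (`jr_iff`). Strings are read from their ends, backwards from `u`, which
turns the co-lexicographic order into the lexicographic one. Let `min u` and `max u` be the infimum
and the supremum of the reversed strings in `I_u`; either may be an infinite word. As a string leads
to only one state (`reads_unique`), the automaton is Wheeler if and only if `max u ≤ min v` holds
for any two consecutive states `u`, `v` of the list of all states by increasing `min`
(`decide_wheeler`, `isWheeler_of_chain`). The words `min` and `max` never occur in the proofs below,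
only the order between them.

Take two copies of every node, one that minimizes and one that maximizes over its in-edges, and
label every copy with the best letter that enters it. Only the in-edges that carry this letter are
*live*. Copies are ordered by label first, and for equal labels by the best source of a live
in-edge. This order is computed by ordered partition refinement in the manner of Paige and Tarjan.
There is a coarse partition of the list of all copies and a finer one, and the fine blocks are
always ordered by label and coarse block of the best source (`RInv`). A round takes a coarse block
that consists of several fine blocks and cuts off its first or its last one, whichever is smaller.
Only copies with live in-edges from the part that is cut off can be affected: the best source of a
minimizing copy is in the front part if it has an edge from there, and in the back part if it has
none from the front part, which is detected by counting edges; maximizing copies are treated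
symmetrically (`Round.rinv`). At the end the two partitions coincide (`RInv.final`), and the order
is the right one in the sense that is needed: `RInv.bef_fine` produces strings that witness a strict
inequality `min u < max v`, `Ranks.le_all` shows `max u ≤ min v` from the order of the copies, and
`Ranks.exists_le` compares two minima.

A block that is cut off has at most half the size of the coarse block that contains it, so that
every node and every edge is scanned at most logarithmically often; this is the potential argument
`Round.pot_le`. The first partition, by label, is found by sorting with a tournament tree
(`sortCmd_spec`), as letters are compared only. The length `b` of the input is at most `5 𝔢 + 4`,
since every label is non-empty and every state but the initial one is the target of an edge
(`length_encode_le`). Altogether this takes `O(b log b)`, hence `O(𝔢 log 𝔢 + 1)` steps.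

The algorithm is written in a small imperative language with unbounded numbers and named arrays. Its
correctness and cost are proved by weakest preconditions (`wp`). As values grow slowly, the
translation to the word RAM simulates it step by step without overflow (`Ev.simulate`), the arrays
being interleaved in the memory above the input.
-/

/-! ### A small imperative language with named arrays -/

namespace Imp

/-- The registers of the programs below. The first two become the registers `0` and `1` of the
machine, which receive the output; `len` holds the length of the input and `dbl` twice that. -/
inductive Reg
  | res | outp | len | dbl | num | ini | cnt | pos | cur | tgt | rem | lab | dst
  | e | x | y | z | f | g | q | s | sp | nf | nc | tl | h | dir | k | i | m | lst
  deriving DecidableEq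

/-- The arrays of the programs below; each one is infinite and initially zero. `ES`, `ED`, `EL` hold
the source, the target and the label of every edge, `LB` the labels of the nodes, `HD` and `NX` the
lists of live edges, `KY` and `TR` the keys and the winners of a tournament, `KK` and `TL` the
result of a scan; the others are the fields of `Refine.Pt`. -/
inductive Arr
  | ES | ED | EL | LB | HD | NX | CN | KY | TR | EM | PS | BK | BL | BR | BC | CL | CR | PC
  | TS | TW | ST | KK | TL
  deriving DecidableEq

/-- A state: registers, the cells that hold the input, and the arrays. -/
structure St where
  reg : Reg → ℕ
  raw : ℕ → ℕ
  arr : Arr → ℕ → ℕ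

/-- Assignment to a register. -/
def St.setR (s : St) (r : Reg) (v : ℕ) : St := { s with reg := Function.update s.reg r v }

/-- Assignment to an array cell. -/
def St.setA (s : St) (a : Arr) (i v : ℕ) : St :=
  { s with arr := Function.update s.arr a (Function.update (s.arr a) i v) }

/-- Assignment to an input cell. -/
def St.setRaw (s : St) (i v : ℕ) : St := { s with raw := Function.update s.raw i v }

section
variable (s : St) (r r' : Reg) (a a' : Arr) (i v : ℕ)
@[simp] theorem St.setR_reg : (s.setR r v).reg r' = if r' = r then v else s.reg r' := by
  simp [St.setR, Function.update_apply]
@[simp] theorem St.setR_raw : (s.setR r v).raw = s.raw := rfl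
@[simp] theorem St.setR_arr : (s.setR r v).arr = s.arr := rfl
@[simp] theorem St.setA_reg : (s.setA a i v).reg = s.reg := rfl
@[simp] theorem St.setA_raw : (s.setA a i v).raw = s.raw := rfl
@[simp] theorem St.setA_arr : (s.setA a i v).arr a' =
    if a' = a then Function.update (s.arr a) i v else s.arr a' := by
  by_cases h : a' = a
  · subst h; simp [St.setA]
  · simp [St.setA, h]
@[simp] theorem St.setRaw_reg : (s.setRaw i v).reg = s.reg := rfl
@[simp] theorem St.setRaw_arr : (s.setRaw i v).arr = s.arr := rfl
@[simp] theorem St.setRaw_raw : (s.setRaw i v).raw = Function.update s.raw i v := rfl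
end

/-- Expressions: `inc` adds a constant, `half` divides by two. There is no general multiplication,
which lets values grow slowly. -/
inductive Ex
  | lit (k : ℕ)
  | reg (r : Reg)
  | raw (i : Ex)
  | ld (a : Arr) (i : Ex)
  | inc (x : Ex) (k : ℕ)
  | add (x y : Ex)
  | sub (x y : Ex)
  | half (x : Ex)
  | lt (x y : Ex)
  | eq (x y : Ex)
  | or (x y : Ex)
  | and (x y : Ex)

/-- Truth value of `x < y`. -/
def ltN (x y : ℕ) : ℕ := if x < y then 1 else 0
/-- Truth value of `x = y`. -/
def eqN (x y : ℕ) : ℕ := if x = y then 1 else 0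
/-- Disjunction of truth values. -/
def orN (x y : ℕ) : ℕ := if x ≠ 0 ∨ y ≠ 0 then 1 else 0
/-- Conjunction of truth values. -/
def andN (x y : ℕ) : ℕ := if x ≠ 0 ∧ y ≠ 0 then 1 else 0

section
variable (x y : ℕ)
@[simp] theorem ltN_eq_zero : ltN x y = 0 ↔ y ≤ x := by simp [ltN]
@[simp] theorem eqN_eq_zero : eqN x y = 0 ↔ x ≠ y := by simp [eqN]
@[simp] theorem orN_eq_zero : orN x y = 0 ↔ x = 0 ∧ y = 0 := by simp [orN]
@[simp] theorem andN_eq_zero : andN x y = 0 ↔ x = 0 ∨ y = 0 := by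
  simp [andN, imp_iff_not_or]
end

/-- The value of an expression, with unbounded natural numbers. -/
@[simp] def Ex.eval (s : St) : Ex → ℕ
  | lit k => k
  | reg r => s.reg r
  | raw i => s.raw (i.eval s)
  | ld a i => s.arr a (i.eval s)
  | inc x k => x.eval s + k
  | add x y => x.eval s + y.eval s
  | sub x y => x.eval s - y.eval s
  | half x => x.eval s / 2
  | lt x y => ltN (x.eval s) (y.eval s)
  | eq x y => eqN (x.eval s) (y.eval s)
  | or x y => orN (x.eval s) (y.eval s)
  | and x y => andN (x.eval s) (y.eval s)

/-- The side conditions of an expression: input cells are addressed within the `b` cells of the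
input, and the sum of two variables does not exceed `W`. -/
@[simp] def Ex.Ok (b W : ℕ) (s : St) : Ex → Prop
  | lit _ => True
  | reg _ => True
  | raw i => i.Ok b W s ∧ i.eval s < b
  | ld _ i => i.Ok b W s
  | inc x _ => x.Ok b W s
  | add x y => x.Ok b W s ∧ y.Ok b W s ∧ x.eval s + y.eval s ≤ W
  | sub x y => x.Ok b W s ∧ y.Ok b W s
  | half x => x.Ok b W s
  | lt x y => x.Ok b W s ∧ y.Ok b W s
  | eq x y => x.Ok b W s ∧ y.Ok b W s
  | or x y => x.Ok b W s ∧ y.Ok b W s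
  | and x y => x.Ok b W s ∧ y.Ok b W s

/-- An upper bound both for the cost of evaluating an expression and for the amount by which its
value can exceed all numbers in the state. -/
@[simp] def Ex.cost : Ex → ℕ
  | lit k => k + 1
  | reg _ => 1
  | raw i => i.cost + 1
  | ld _ i => i.cost + 7
  | inc x k => x.cost + k + 2
  | add x y => x.cost + y.cost + 1
  | sub x y => x.cost + y.cost + 1
  | half x => x.cost + 2
  | lt x y => x.cost + y.cost + 1
  | eq x y => x.cost + y.cost + 1
  | or x y => x.cost + y.cost + 3
  | and x y => x.cost + y.cost + 5

/-- Commands. -/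
inductive Cmd
  | skip
  | set (r : Reg) (x : Ex)
  | st (a : Arr) (i x : Ex)
  | sraw (i x : Ex)
  | seq (p q : Cmd)
  | ite (b : Ex) (p q : Cmd)
  | while (b : Ex) (p : Cmd)

infixr:60 ";;" => Cmd.seq

/-- `Ev b W p s t s'`: the command `p` leads from `s` to `s'` with cost `t`, all side conditions
being met. -/
inductive Ev (b W : ℕ) : Cmd → St → ℕ → St → Prop
  | skip (s : St) : Ev b W .skip s 1 s
  | set (r : Reg) (x : Ex) (s : St) : x.Ok b W s →
      Ev b W (.set r x) s (x.cost + 1) (s.setR r (x.eval s))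
  | st (a : Arr) (i x : Ex) (s : St) : i.Ok b W s → x.Ok b W s →
      Ev b W (.st a i x) s (i.cost + x.cost + 7) (s.setA a (i.eval s) (x.eval s))
  | sraw (i x : Ex) (s : St) : i.Ok b W s → x.Ok b W s → i.eval s < b →
      Ev b W (.sraw i x) s (i.cost + x.cost + 1) (s.setRaw (i.eval s) (x.eval s))
  | seq {p q : Cmd} {s s₁ s₂ : St} {t₁ t₂ : ℕ} :
      Ev b W p s t₁ s₁ → Ev b W q s₁ t₂ s₂ → Ev b W (.seq p q) s (t₁ + t₂) s₂
  | ite_true {c : Ex} {p q : Cmd} {s s₁ : St} {t : ℕ} : c.Ok b W s →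
      c.eval s ≠ 0 → Ev b W p s t s₁ → Ev b W (.ite c p q) s (c.cost + 1 + t) s₁
  | ite_false {c : Ex} {p q : Cmd} {s s₁ : St} {t : ℕ} : c.Ok b W s →
      c.eval s = 0 → Ev b W q s t s₁ → Ev b W (.ite c p q) s (c.cost + 1 + t) s₁
  | while_true {c : Ex} {p : Cmd} {s s₁ s₂ : St} {t₁ t₂ : ℕ} : c.Ok b W s →
      c.eval s ≠ 0 → Ev b W p s t₁ s₁ → Ev b W (.while c p) s₁ t₂ s₂ →
        Ev b W (.while c p) s (c.cost + 1 + t₁ + t₂) s₂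
  | while_false {c : Ex} {p : Cmd} {s : St} : c.Ok b W s →
      c.eval s = 0 → Ev b W (.while c p) s (c.cost + 1) s

/-! ### Compilation to the word RAM -/

open WordRAM

/-- The register that holds the length of the input, above which the arrays are interleaved. -/
abbrev baseReg : ℕ := 64

/-- The address of cell `i` of array `a`: cell `i` of every array lies in the `i`-th group of `32`
addresses above the input. -/
def cellAddr (a : Arr) (i : Expr) : Expr :=
  .bin .add (.bin .add (.reg baseReg) (.lit a.ctorIdx)) (.bin .mul (.lit 32) i)

/-- Translation of expressions. -/
def Ex.compile : Ex → Expr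
  | lit k => .lit k
  | reg r => .reg r.ctorIdx
  | raw i => .load i.compile
  | ld a i => .load (cellAddr a i.compile)
  | inc x k => .bin .add x.compile (.lit k)
  | add x y => .bin .add x.compile y.compile
  | sub x y => .bin .sub x.compile y.compile
  | half x => .bin .div x.compile (.lit 2)
  | lt x y => .bin .lt x.compile y.compile
  | eq x y => .bin .eq x.compile y.compile
  | or x y => .bin .lt (.lit 0) (.bin .add x.compile y.compile)
  | and x y => .bin .mul (.bin .lt (.lit 0) x.compile) (.bin .lt (.lit 0) y.compile)

/-- Translation of commands. -/
def Cmd.compile : Cmd → Program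
  | skip => .skip
  | set r x => .assign r.ctorIdx x.compile
  | st a i x => .store (cellAddr a i.compile) x.compile
  | sraw i x => .store i.compile x.compile
  | seq p q => .seq p.compile q.compile
  | ite b p q => .ite b.compile p.compile q.compile
  | .while b p => .while b.compile p.compile

/-- The configuration `c` represents the state `s`. -/
structure Rep (b : ℕ) (s : St) (c : Config) : Prop where
  base : c.reg baseReg = b
  reg : ∀ r : Reg, c.reg r.ctorIdx = s.reg r
  raw : ∀ i < b, c.mem i = s.raw i
  arr : ∀ (a : Arr) i, c.mem (b + a.ctorIdx + 32 * i) = s.arr a i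

/-- All numbers in the state are at most `B`. -/
structure Bdd (b B : ℕ) (s : St) : Prop where
  reg : ∀ r : Reg, s.reg r ≤ B
  raw : ∀ i < b, s.raw i ≤ B
  arr : ∀ (a : Arr) i, s.arr a i ≤ B

theorem Bdd.mono {b B B' : ℕ} {s : St} (h : Bdd b B s) (hB : B ≤ B') : Bdd b B' s :=
  ⟨fun r => (h.reg r).trans hB, fun i hi => (h.raw i hi).trans hB, fun a i => (h.arr a i).trans hB⟩

theorem Ex.eval_le {b W B : ℕ} {s : St} (hs : Bdd b B s) (hW : W ≤ B) (x : Ex)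
    (hx : x.Ok b W s) : x.eval s ≤ B + x.cost := by
  induction x with
  | lit k => simp; omega
  | reg r => have := hs.reg r; simp; omega
  | raw i ih => have := hs.raw _ hx.2; simp; omega
  | ld a i ih => have := hs.arr a (i.eval s); simp; omega
  | inc x k ih => have := ih hx; simp; omega
  | add x y ihx ihy => have := hx.2.2; simp; omega
  | sub x y ihx ihy => have := ihx hx.1; simp; omega
  | half x ih => have := ih hx; simp; omega
  | lt x y ihx ihy => simp only [Ex.eval, Ex.cost, ltN]; split <;> omega
  | eq x y ihx ihy => simp only [Ex.eval, Ex.cost, eqN]; split <;> omega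
  | or x y ihx ihy => simp only [Ex.eval, Ex.cost, orN]; split <;> omega
  | and x y ihx ihy => simp only [Ex.eval, Ex.cost, andN]; split <;> omega

theorem Arr.ctorIdx_lt (a : Arr) : a.ctorIdx < 32 := by cases a <;> decide

theorem Arr.ctorIdx_inj {a a' : Arr} (h : a.ctorIdx = a'.ctorIdx) : a = a' := by
  rw [← Arr.ofNat_ctorIdx a, h, Arr.ofNat_ctorIdx]

theorem Reg.ctorIdx_lt (r : Reg) : r.ctorIdx < 64 := by cases r <;> decide

theorem Reg.ctorIdx_inj {r r' : Reg} (h : r.ctorIdx = r'.ctorIdx) : r = r' := by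
  rw [← Reg.ofNat_ctorIdx r, h, Reg.ofNat_ctorIdx]

theorem Ex.compile_cost (x : Ex) : x.compile.cost ≤ x.cost := by
  induction x <;> simp [Ex.compile, Expr.cost, cellAddr] <;> omega

section
variable {w b W B : ℕ} {s : St} {c : Config}

theorem cellAddr_eval (hr : Rep b s c) (a : Arr) {i : Expr} {v : ℕ} (hi : i.eval w c = v)
    (hw : b + 32 + 32 * v < 2 ^ w) :
    (cellAddr a i).eval w c = b + a.ctorIdx + 32 * v := by
  have ha := a.ctorIdx_lt
  have hb := hr.base
  simp only [cellAddr, Expr.eval, BinOp.eval, hi, hb]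
  rw [Nat.mod_eq_of_lt (a := a.ctorIdx) (by omega), Nat.mod_eq_of_lt (a := 32) (by omega),
    Nat.mod_eq_of_lt (a := 32 * v) (by omega), Nat.mod_eq_of_lt (a := b + _) (by omega),
    Nat.mod_eq_of_lt (by omega)]

theorem Ex.compile_eval (hr : Rep b s c) (hs : Bdd b B s) (hW : W ≤ B) (x : Ex)
    (hx : x.Ok b W s) (hw : b + 64 * (B + x.cost + 1) < 2 ^ w) :
    x.compile.eval w c = x.eval s := by
  have h1 : (1 : ℕ) % 2 ^ w = 1 := Nat.mod_eq_of_lt (by omega)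
  induction x with
  | lit k => simp at hw ⊢; exact Nat.mod_eq_of_lt (by omega)
  | reg r => exact hr.reg r
  | raw i ih =>
    have := ih hx.1 (by simp at hw; omega)
    simp [Ex.compile, Expr.eval, this, hr.raw _ hx.2]
  | ld a i ih =>
    have h := ih hx (by simp at hw; omega)
    have h' := Ex.eval_le hs hW i hx
    simp only [Ex.compile, Expr.eval]
    rw [cellAddr_eval hr a h (by simp at hw; omega), hr.arr]
    rfl
  | inc x k ih =>
    have h := ih hx (by simp at hw; omega)
    have h' := Ex.eval_le hs hW x hx
    simp only [Ex.compile, Expr.eval, BinOp.eval, h, Ex.eval]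
    simp at hw
    rw [Nat.mod_eq_of_lt (a := k) (by omega), Nat.mod_eq_of_lt (by omega)]
  | add x y ihx ihy =>
    have hX := ihx hx.1 (by simp at hw; omega)
    have hY := ihy hx.2.1 (by simp at hw; omega)
    have := hx.2.2
    simp only [Ex.compile, Expr.eval, BinOp.eval, hX, hY, Ex.eval]
    rw [Nat.mod_eq_of_lt (by omega)]
  | sub x y ihx ihy =>
    have hX := ihx hx.1 (by simp at hw; omega)
    have hY := ihy hx.2 (by simp at hw; omega)
    simp only [Ex.compile, Expr.eval, BinOp.eval, hX, hY, Ex.eval]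
  | half x ih =>
    have h := ih hx (by simp at hw; omega)
    simp only [Ex.compile, Expr.eval, BinOp.eval, h, Ex.eval]
    rw [Nat.mod_eq_of_lt (a := 2) (by omega)]
  | lt x y ihx ihy =>
    have hX := ihx hx.1 (by simp at hw; omega)
    have hY := ihy hx.2 (by simp at hw; omega)
    simp only [ltN, Ex.compile, Expr.eval, BinOp.eval, hX, hY, Ex.eval, h1]
  | eq x y ihx ihy =>
    have hX := ihx hx.1 (by simp at hw; omega)
    have hY := ihy hx.2 (by simp at hw; omega)
    simp only [eqN, Ex.compile, Expr.eval, BinOp.eval, hX, hY, Ex.eval, h1]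
  | or x y ihx ihy =>
    have hX := ihx hx.1 (by simp at hw; omega)
    have hY := ihy hx.2 (by simp at hw; omega)
    have h' := Ex.eval_le hs hW x hx.1
    have h'' := Ex.eval_le hs hW y hx.2
    simp only [orN, Ex.compile, Expr.eval, BinOp.eval, hX, hY, Ex.eval, h1]
    simp at hw
    rw [Nat.mod_eq_of_lt (a := x.eval s + y.eval s) (by omega), Nat.zero_mod]
    congr 1
    apply propext; omega
  | and x y ihx ihy =>
    have hX := ihx hx.1 (by simp at hw; omega)
    have hY := ihy hx.2 (by simp at hw; omega)
    simp only [andN, Ex.compile, Expr.eval, BinOp.eval, hX, hY, Ex.eval, h1, Nat.zero_mod]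
    by_cases h : x.eval s = 0 <;> by_cases h' : y.eval s = 0 <;>
      simp [h, h', Nat.pos_iff_ne_zero, h1]

theorem Rep.setR (hr : Rep b s c) (r : Reg) (v : ℕ) :
    Rep b (s.setR r v) { c with reg := Function.update c.reg r.ctorIdx v } := by
  constructor
  · have := r.ctorIdx_lt
    show Function.update c.reg r.ctorIdx v baseReg = b
    rw [Function.update_of_ne (by unfold baseReg; omega)]; exact hr.base
  · intro r'
    by_cases h : r' = r
    · subst h; simp
    · have : r'.ctorIdx ≠ r.ctorIdx := fun e => h (Reg.ctorIdx_inj e)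
      simp [h, this, hr.reg]
  · exact hr.raw
  · exact hr.arr

theorem Rep.setA (hr : Rep b s c) (a : Arr) (i v : ℕ) :
    Rep b (s.setA a i v) { c with mem := Function.update c.mem (b + a.ctorIdx + 32 * i) v } := by
  constructor
  · exact hr.base
  · exact hr.reg
  · intro j hj
    simp only [St.setA_raw]
    rw [Function.update_of_ne (by omega)]; exact hr.raw j hj
  · intro a' i'
    have h1 := a.ctorIdx_lt
    have h2 := a'.ctorIdx_lt
    by_cases h : a' = a
    · subst h
      by_cases h' : i' = i
      · subst h'; simp
      · simp [h', hr.arr]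
    · have : a'.ctorIdx ≠ a.ctorIdx := fun e => h (Arr.ctorIdx_inj e)
      show Function.update c.mem _ v _ = _
      rw [Function.update_of_ne (by omega)]
      simp [h, hr.arr]

theorem Rep.setRaw (hr : Rep b s c) {i : ℕ} (hi : i < b) (v : ℕ) :
    Rep b (s.setRaw i v) { c with mem := Function.update c.mem i v } := by
  constructor
  · exact hr.base
  · exact hr.reg
  · intro j hj
    by_cases h : j = i
    · subst h; simp
    · simp [h, hr.raw j hj]
  · intro a' i'
    show Function.update c.mem i v _ = _
    rw [Function.update_of_ne (by omega)]
    exact hr.arr a' i'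

theorem Bdd.setR (hs : Bdd b B s) (r : Reg) {v : ℕ} (hv : v ≤ B) : Bdd b B (s.setR r v) := by
  refine ⟨fun r' => ?_, hs.raw, hs.arr⟩
  simp only [St.setR_reg]
  split
  · exact hv
  · exact hs.reg r'

theorem Bdd.setA (hs : Bdd b B s) (a : Arr) (i : ℕ) {v : ℕ} (hv : v ≤ B) :
    Bdd b B (s.setA a i v) := by
  refine ⟨hs.reg, hs.raw, fun a' i' => ?_⟩
  simp only [St.setA_arr]
  split
  · rw [Function.update_apply]
    split
    · exact hv
    · exact hs.arr a i'
  · exact hs.arr a' i'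

theorem Bdd.setRaw (hs : Bdd b B s) (i : ℕ) {v : ℕ} (hv : v ≤ B) :
    Bdd b B (s.setRaw i v) := by
  refine ⟨hs.reg, fun i' hi' => ?_, hs.arr⟩
  simp only [St.setRaw_raw, Function.update_apply]
  split
  · exact hv
  · exact hs.raw i' hi'

/-- A terminating command is simulated by its translation. Numbers grow at most by the elapsed time,
hence stay at most `B + t`, and the address of a cell is less than `b + 64 * (B + t + 1)`; if this is
below `2 ^ w`, then no overflow occurs. -/
theorem Ev.simulate {p : Cmd} {t : ℕ} {s' : St} (h : Ev b W p s t s') :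
    ∀ {c : Config} {B : ℕ}, Rep b s c → Bdd b B s → W ≤ B → b + 64 * (B + t + 1) < 2 ^ w →
      ∃ t' c', Run w p.compile c t' c' ∧ t' ≤ t ∧ Rep b s' c' ∧ Bdd b (B + t) s' := by
  induction h with
  | skip s =>
    intro c B hr hs hW hw
    exact ⟨1, c, .skip c, le_rfl, hr, hs.mono (by omega)⟩
  | set r x s hx =>
    intro c B hr hs hW hw
    refine ⟨_, _, .assign _ _ c, by have := x.compile_cost; omega, ?_, ?_⟩
    · rw [Ex.compile_eval hr hs hW x hx (by omega)]
      exact hr.setR r _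
    · exact (hs.mono (by omega)).setR r ((Ex.eval_le hs hW x hx).trans (by omega))
  | st a i x s hi hx =>
    intro c B hr hs hW hw
    have h1 := x.compile_cost
    have h2 := i.compile_cost
    have h3 := Ex.eval_le hs hW i hi
    refine ⟨_, _, .store _ _ c, by simp [cellAddr, Expr.cost]; omega, ?_, ?_⟩
    · rw [Ex.compile_eval hr hs hW x hx (by omega),
        cellAddr_eval hr a (Ex.compile_eval hr hs hW i hi (by omega)) (by omega)]
      exact hr.setA a _ _
    · exact (hs.mono (by omega)).setA a _ ((Ex.eval_le hs hW x hx).trans (by omega))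
  | sraw i x s hi hx hib =>
    intro c B hr hs hW hw
    have h1 := x.compile_cost
    have h2 := i.compile_cost
    refine ⟨_, _, .store _ _ c, by omega, ?_, ?_⟩
    · rw [Ex.compile_eval hr hs hW x hx (by omega), Ex.compile_eval hr hs hW i hi (by omega)]
      exact hr.setRaw hib _
    · exact (hs.mono (by omega)).setRaw _ ((Ex.eval_le hs hW x hx).trans (by omega))
  | seq _ _ ih₁ ih₂ =>
    intro c B hr hs hW hw
    obtain ⟨t₁', c₁, r₁, l₁, hr₁, hs₁⟩ := ih₁ hr hs hW (by omega)
    obtain ⟨t₂', c₂, r₂, l₂, hr₂, hs₂⟩ := ih₂ hr₁ hs₁ (by omega) (by omega)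
    exact ⟨_, c₂, .seq r₁ r₂, by omega, hr₂, hs₂.mono (by omega)⟩
  | @ite_true e p q s s₁ t hb hb' _ ih =>
    intro c B hr hs hW hw
    obtain ⟨t₁', c₁, r₁, l₁, hr₁, hs₁⟩ := ih hr hs hW (by omega)
    have := e.compile_cost
    refine ⟨_, c₁, .ite_true ?_ r₁, by omega, hr₁, hs₁.mono (by omega)⟩
    rwa [Ex.compile_eval hr hs hW e hb (by omega)]
  | @ite_false e p q s s₁ t hb hb' _ ih =>
    intro c B hr hs hW hw
    obtain ⟨t₁', c₁, r₁, l₁, hr₁, hs₁⟩ := ih hr hs hW (by omega)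
    have := e.compile_cost
    refine ⟨_, c₁, .ite_false ?_ r₁, by omega, hr₁, hs₁.mono (by omega)⟩
    rwa [Ex.compile_eval hr hs hW e hb (by omega)]
  | @while_true e p s s₁ s₂ t₁ t₂ hb hb' _ _ ih₁ ih₂ =>
    intro c B hr hs hW hw
    have := e.compile_cost
    obtain ⟨t₁', c₁, r₁, l₁, hr₁, hs₁⟩ := ih₁ hr hs hW (by omega)
    obtain ⟨t₂', c₂, r₂, l₂, hr₂, hs₂⟩ := ih₂ hr₁ hs₁ (by omega) (by omega)
    refine ⟨_, c₂, .while_true ?_ r₁ r₂, by omega, hr₂, hs₂.mono (by omega)⟩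
    rwa [Ex.compile_eval hr hs hW e hb (by omega)]
  | @while_false e p s hb hb' =>
    intro c B hr hs hW hw
    have := e.compile_cost
    refine ⟨_, c, .while_false ?_, by omega, hr, hs.mono (by omega)⟩
    rwa [Ex.compile_eval hr hs hW e hb (by omega)]
end

/-! ### Weakest preconditions -/

/-- From `s`, the command `p` terminates in a state and with a cost that satisfy `Q`. -/
def wp (b W : ℕ) (p : Cmd) (Q : ℕ → St → Prop) (s : St) : Prop :=
  ∃ t s', Ev b W p s t s' ∧ Q t s'

section
variable {b W : ℕ} {s : St} {Q : ℕ → St → Prop}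

theorem wp.mono {p : Cmd} {Q' : ℕ → St → Prop} (h : wp b W p Q s)
    (hQ : ∀ t s', Q t s' → Q' t s') : wp b W p Q' s := by
  obtain ⟨t, s', h, h'⟩ := h
  exact ⟨t, s', h, hQ _ _ h'⟩

@[simp] theorem wp_skip : wp b W .skip Q s ↔ Q 1 s := by
  constructor
  · rintro ⟨t, s', h, h'⟩; cases h; exact h'
  · exact fun h => ⟨_, _, .skip s, h⟩

@[simp] theorem wp_set {r : Reg} {x : Ex} :
    wp b W (.set r x) Q s ↔ x.Ok b W s ∧ Q (x.cost + 1) (s.setR r (x.eval s)) := by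
  constructor
  · rintro ⟨t, s', h, h'⟩; cases h with | set _ _ _ hx => exact ⟨hx, h'⟩
  · exact fun h => ⟨_, _, .set _ _ s h.1, h.2⟩

@[simp] theorem wp_st {a : Arr} {i x : Ex} :
    wp b W (.st a i x) Q s ↔ i.Ok b W s ∧ x.Ok b W s ∧
      Q (i.cost + x.cost + 7) (s.setA a (i.eval s) (x.eval s)) := by
  constructor
  · rintro ⟨t, s', h, h'⟩; cases h with | st _ _ _ _ hi hx => exact ⟨hi, hx, h'⟩
  · exact fun h => ⟨_, _, .st _ _ _ s h.1 h.2.1, h.2.2⟩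

@[simp] theorem wp_sraw {i x : Ex} :
    wp b W (.sraw i x) Q s ↔ i.Ok b W s ∧ x.Ok b W s ∧ i.eval s < b ∧
      Q (i.cost + x.cost + 1) (s.setRaw (i.eval s) (x.eval s)) := by
  constructor
  · rintro ⟨t, s', h, h'⟩; cases h with | sraw _ _ _ hi hx hb => exact ⟨hi, hx, hb, h'⟩
  · exact fun h => ⟨_, _, .sraw _ _ s h.1 h.2.1 h.2.2.1, h.2.2.2⟩

@[simp] theorem wp_seq {p q : Cmd} :
    wp b W (p ;; q) Q s ↔ wp b W p (fun t s' => wp b W q (fun t' => Q (t + t')) s') s := by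
  constructor
  · rintro ⟨t, s', h, h'⟩
    cases h with | seq h₁ h₂ => exact ⟨_, _, h₁, _, _, h₂, h'⟩
  · rintro ⟨t, s', h₁, t', s'', h₂, h'⟩
    exact ⟨_, _, .seq h₁ h₂, h'⟩

@[simp] theorem wp_ite {c : Ex} {p q : Cmd} :
    wp b W (.ite c p q) Q s ↔ c.Ok b W s ∧
      (c.eval s ≠ 0 → wp b W p (fun t => Q (c.cost + 1 + t)) s) ∧
      (c.eval s = 0 → wp b W q (fun t => Q (c.cost + 1 + t)) s) := by
  constructor
  · rintro ⟨t, s', h, h'⟩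
    cases h with
    | ite_true h₁ h₂ h₃ => exact ⟨h₁, fun _ => ⟨_, _, h₃, h'⟩, fun h => absurd h h₂⟩
    | ite_false h₁ h₂ h₃ => exact ⟨h₁, fun h => absurd h₂ h, fun _ => ⟨_, _, h₃, h'⟩⟩
  · rintro ⟨h, h₁, h₂⟩
    by_cases hc : c.eval s = 0
    · obtain ⟨t, s', he, hQ⟩ := h₂ hc
      exact ⟨_, _, .ite_false h hc he, hQ⟩
    · obtain ⟨t, s', he, hQ⟩ := h₁ hc
      exact ⟨_, _, .ite_true h hc he, hQ⟩

/-- The rule for loops: `I i` is an invariant with a ghost parameter `i`, and `Φ i` bounds the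
remaining cost. -/
theorem wp_while {ι : Sort*} (I : ι → St → Prop) (Φ : ι → ℕ) {c : Ex} {p : Cmd}
    (hok : ∀ i s, I i s → c.Ok b W s ∧ c.cost + 1 ≤ Φ i)
    (hstep : ∀ i s, I i s → c.eval s ≠ 0 →
      wp b W p (fun t s' => ∃ i', I i' s' ∧ c.cost + 1 + t + Φ i' ≤ Φ i) s)
    {i : ι} (hI : I i s) :
    wp b W (.while c p) (fun t s' => t ≤ Φ i ∧ ∃ i', I i' s' ∧ c.eval s' = 0) s := by
  induction hn : Φ i using Nat.strong_induction_on generalizing i s with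
  | _ n ih =>
    obtain ⟨h₁, h₂⟩ := hok i s hI
    by_cases hc : c.eval s = 0
    · exact ⟨_, _, .while_false h₁ hc, by omega, i, hI, hc⟩
    · obtain ⟨t, s', he, i', hI', hle⟩ := hstep i s hI hc
      obtain ⟨t', s'', he', ht', hI''⟩ := ih (Φ i') (by omega) hI' rfl
      exact ⟨_, _, .while_true h₁ hc he he', by omega, hI''⟩

end

end Imp

/-! ### Ordered partition refinement: states and invariants -/

namespace Refine

open Function Classical

/-- The data that partition refinement works on: nodes below `N`, of which those below `L` minimize
and the others maximize over their in-edges; edges below `M`, of which the `live` ones carry the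
best label `lab` of their target. -/
structure Gr where
  N : ℕ
  M : ℕ
  L : ℕ
  src : ℕ → ℕ
  dst : ℕ → ℕ
  lab : ℕ → ℕ
  live : ℕ → Prop

/-- Live edges join nodes of the same kind. None enters a node with label `0`, and at least one enters
every other node. -/
structure Gr.WF (G : Gr) : Prop where
  src_lt : ∀ e < G.M, G.live e → G.src e < G.N
  dst_lt : ∀ e < G.M, G.live e → G.dst e < G.N
  side : ∀ e < G.M, G.live e → (G.src e < G.L ↔ G.dst e < G.L)
  lab_ne : ∀ e < G.M, G.live e → G.lab (G.dst e) ≠ 0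
  ex_live : ∀ x < G.N, G.lab x ≠ 0 → ∃ e < G.M, G.live e ∧ G.dst e = x

/-- A relation that is implied by any difference in the labels of a minimizing and a maximizing
node, and that is inherited along live edges with equal labels. -/
structure Gr.Closed (G : Gr) (Bef : ℕ → ℕ → Prop) : Prop where
  base : ∀ x < G.N, ∀ y < G.N, x < G.L → G.L ≤ y → G.lab x < G.lab y → Bef x y
  step : ∀ e < G.M, ∀ e' < G.M, G.live e → G.live e' → G.dst e < G.L → G.L ≤ G.dst e' →
    G.lab (G.dst e) = G.lab (G.dst e') → Bef (G.src e) (G.src e') → Bef (G.dst e) (G.dst e')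

/-- The state of the refinement. `EM` lists the nodes in the current order and `PS` is its inverse.
`BK x` is the fine block of the node `x`; the fine block `f` occupies the positions from `BL f` to
`BR f` and lies in the coarse block `BC f`; the coarse block `c` occupies the positions from `CL c`
to `CR c`. `PC x` is the coarse block of the best sources of live edges into `x`, and `CN x` is the
number of the live edges into `x` from it. `TS f` is the last round in which `f` was split, and `TW f`
the block that was split off. `ST` is a stack of coarse blocks of height `sp`. There are `nf` fine
and `nc` coarse blocks. -/
structure Pt where
  EM : ℕ → ℕ
  PS : ℕ → ℕ
  BK : ℕ → ℕ
  BL : ℕ → ℕ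
  BR : ℕ → ℕ
  BC : ℕ → ℕ
  CL : ℕ → ℕ
  CR : ℕ → ℕ
  PC : ℕ → ℕ
  CN : ℕ → ℕ
  TS : ℕ → ℕ
  TW : ℕ → ℕ
  ST : ℕ → ℕ
  nf : ℕ
  nc : ℕ
  sp : ℕ

/-- The coarse block of a node. -/
def Pt.co (d : Pt) (x : ℕ) : ℕ := d.BC (d.BK x)

/-- The fine and the coarse blocks are intervals of the current order, each fine block being part
of a coarse one. Fine blocks may be empty, coarse ones may not. -/
structure Pt.Struc (N : ℕ) (d : Pt) : Prop where
  em : ∀ p < N, d.EM p < N ∧ d.PS (d.EM p) = p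
  ps : ∀ x < N, d.PS x < N ∧ d.EM (d.PS x) = x
  bk : ∀ x < N, d.BK x < d.nf
  mem : ∀ x < N, d.BL (d.BK x) ≤ d.PS x ∧ d.PS x < d.BR (d.BK x)
  disj : ∀ f < d.nf, ∀ g < d.nf, ∀ p, d.BL f ≤ p → p < d.BR f → d.BL g ≤ p → p < d.BR g → f = g
  bc : ∀ f < d.nf, d.BC f < d.nc
  le : ∀ f < d.nf, d.BL f ≤ d.BR f
  sub : ∀ f < d.nf, d.BL f < d.BR f → d.CL (d.BC f) ≤ d.BL f ∧ d.BR f ≤ d.CR (d.BC f)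
  cdisj : ∀ c < d.nc, ∀ c' < d.nc, c ≠ c' → d.CR c ≤ d.CL c' ∨ d.CR c' ≤ d.CL c
  cne : ∀ c < d.nc, d.CL c < d.CR c ∧ d.CR c ≤ N

/-- The invariant of the rounds: the fine blocks are ordered by label and best coarse block (`key`,
`same`), the best coarse block of a node is the first or the last one among those of the sources
(`cnpos`, `bmin`, `bmax`), whatever the coarse blocks separate is separated by `Bef` (`bef`), and a
coarse block of several fine blocks is on the stack (`comp`). Time stamps of splits are numbers of
coarse blocks, which grow with every round. -/
structure RInv (G : Gr) (Bef : ℕ → ℕ → Prop) (d : Pt) : Prop extends d.Struc G.N where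
  key : ∀ x < G.N, ∀ y < G.N, d.BL (d.BK x) < d.BL (d.BK y) →
    G.lab x < G.lab y ∨ G.lab x = G.lab y ∧ d.CL (d.PC x) < d.CL (d.PC y)
  same : ∀ x < G.N, ∀ y < G.N, d.BK x = d.BK y → G.lab x = G.lab y ∧ d.PC x = d.PC y
  pc : ∀ x < G.N, d.PC x < d.nc
  pc0 : ∀ x < G.N, G.lab x = 0 → d.PC x = 0
  cn : ∀ x < G.N, d.CN x =
    {e ∈ Finset.range G.M | G.live e ∧ G.dst e = x ∧ d.co (G.src e) = d.PC x}.card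
  cnpos : ∀ x < G.N, G.lab x ≠ 0 → 0 < d.CN x
  bmin : ∀ e < G.M, G.live e → G.dst e < G.L → d.CL (d.PC (G.dst e)) ≤ d.CL (d.co (G.src e))
  bmax : ∀ e < G.M, G.live e → G.L ≤ G.dst e → d.CL (d.co (G.src e)) ≤ d.CL (d.PC (G.dst e))
  bef : ∀ x < G.N, ∀ y < G.N, x < G.L → G.L ≤ y → d.CL (d.co x) < d.CL (d.co y) → Bef x y
  comp : ∀ x < G.N, ∀ y < G.N, d.co x = d.co y → d.BK x ≠ d.BK y → ∃ i < d.sp, d.ST i = d.co x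
  stk : ∀ i < d.sp, d.ST i < d.nc
  ts : ∀ f, d.TS f < d.nc

section
variable {N : ℕ} {d : Pt}

theorem Pt.Struc.bk_em (h : d.Struc N) {f p : ℕ} (hf : f < d.nf) (h1 : d.BL f ≤ p)
    (h2 : p < d.BR f) : p < N ∧ d.BK (d.EM p) = f := by
  have h3 := h.sub f hf (by omega)
  have h4 := h.cne _ (h.bc f hf)
  have hp : p < N := by omega
  obtain ⟨h5, h6⟩ := h.em p hp
  have h7 := h.mem _ h5
  rw [h6] at h7
  exact ⟨hp, h.disj _ (h.bk _ h5) f hf p h7.1 h7.2 h1 h2⟩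

theorem Pt.Struc.co_lt (h : d.Struc N) {x : ℕ} (hx : x < N) : d.co x < d.nc :=
  h.bc _ (h.bk x hx)

theorem Pt.Struc.co_mem (h : d.Struc N) {x : ℕ} (hx : x < N) :
    d.CL (d.co x) ≤ d.PS x ∧ d.PS x < d.CR (d.co x) := by
  have h2 := h.mem x hx
  have h1 := h.sub _ (h.bk x hx) (by omega)
  unfold Pt.co
  omega

theorem Pt.Struc.co_em (h : d.Struc N) {c p : ℕ} (hc : c < d.nc) (h1 : d.CL c ≤ p)
    (h2 : p < d.CR c) : p < N ∧ d.co (d.EM p) = c := by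
  have h4 := h.cne _ hc
  have hp : p < N := by omega
  obtain ⟨h5, h6⟩ := h.em p hp
  have h7 := h.co_mem h5
  rw [h6] at h7
  refine ⟨hp, ?_⟩
  by_contra hne
  have := h.cdisj _ (h.co_lt h5) c hc hne
  omega

/-- Blocks of nodes are ordered like their left ends, strictly if they are distinct. -/
theorem Pt.Struc.bl_ne (h : d.Struc N) {x y : ℕ} (hx : x < N) (hy : y < N)
    (hne : d.BK x ≠ d.BK y) : d.BL (d.BK x) ≠ d.BL (d.BK y) := by
  intro he
  have h1 := h.mem x hx
  have h2 := h.mem y hy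
  exact hne (h.disj _ (h.bk x hx) _ (h.bk y hy) (d.BL (d.BK x)) le_rfl (by omega) (by omega)
    (by omega))

theorem Pt.Struc.br_le (h : d.Struc N) {x y : ℕ} (hx : x < N) (hy : y < N)
    (hlt : d.BL (d.BK x) < d.BL (d.BK y)) : d.BR (d.BK x) ≤ d.BL (d.BK y) := by
  by_contra hc
  have h2 := h.mem y hy
  have := h.disj _ (h.bk x hx) _ (h.bk y hy) (d.BL (d.BK y)) (by omega) (by omega) (by omega)
    (by omega)
  rw [this] at hlt
  omega

theorem Pt.Struc.cl_ne (h : d.Struc N) {c c' : ℕ} (hc : c < d.nc) (hc' : c' < d.nc)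
    (hne : c ≠ c') : d.CL c ≠ d.CL c' := by
  have h1 := h.cne c hc
  have h2 := h.cne c' hc'
  have := h.cdisj c hc c' hc' hne
  omega

/-- Coarse order implies fine order. -/
theorem Pt.Struc.bl_lt_of_cl_lt (h : d.Struc N) {x y : ℕ} (hx : x < N) (hy : y < N)
    (hlt : d.CL (d.co x) < d.CL (d.co y)) : d.BL (d.BK x) < d.BL (d.BK y) := by
  have h3 := h.mem x hx
  have h3' := h.mem y hy
  have h1 := h.sub _ (h.bk x hx) (by omega)
  have h2 := h.sub _ (h.bk y hy) (by omega)
  have h4 := h.cne _ (h.co_lt hx)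
  have h5 := h.cne _ (h.co_lt hy)
  have h6 := h.cdisj _ (h.co_lt hx) _ (h.co_lt hy) (by intro he; rw [he] at hlt; omega)
  unfold Pt.co at *
  omega

end

/-- What the coarse blocks and their labels separate, the relation `Bef` separates. -/
theorem RInv.bef_fine {G : Gr} {Bef : ℕ → ℕ → Prop} {d : Pt} (h : RInv G Bef d) (hG : G.WF)
    (hB : G.Closed Bef) {x y : ℕ} (hx : x < G.N) (hy : y < G.N) (hxL : x < G.L) (hyL : G.L ≤ y)
    (hlt : d.BL (d.BK x) < d.BL (d.BK y)) : Bef x y := by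
  rcases h.key x hx y hy hlt with h1 | ⟨h1, h2⟩
  · exact hB.base x hx y hy hxL hyL h1
  · have h0 : G.lab x ≠ 0 := by
      intro h0
      rw [h.pc0 x hx h0, h.pc0 y hy (h1 ▸ h0)] at h2
      omega
    have hcx := h.cnpos x hx h0
    have hcy := h.cnpos y hy (h1 ▸ h0)
    rw [h.cn x hx, Finset.card_pos] at hcx
    rw [h.cn y hy, Finset.card_pos] at hcy
    obtain ⟨e, he⟩ := hcx
    obtain ⟨e', he'⟩ := hcy
    simp only [Finset.mem_filter, Finset.mem_range] at he he'
    obtain ⟨he, hl, rfl, hc⟩ := he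
    obtain ⟨he', hl', rfl, hc'⟩ := he'
    refine hB.step e he e' he' hl hl' hxL hyL h1 ?_
    refine h.bef _ (hG.src_lt e he hl) _ (hG.src_lt e' he' hl') ((hG.side e he hl).2 hxL) ?_ ?_
    · by_contra hlt
      have := (hG.side e' he' hl').1 (by omega)
      omega
    · rw [hc, hc']; exact h2

/-! ### One round of the refinement -/

/-- The number of live edges into `x` from the fine block `B`. -/
noncomputable def Pt.deg (G : Gr) (d : Pt) (B x : ℕ) : ℕ :=
  {e ∈ Finset.range G.M | G.live e ∧ G.dst e = x ∧ d.BK (G.src e) = B}.card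

/-- Whether `x` prefers the block that is cut off to the rest: minimizing nodes do if it is cut off
at the front (`dir = 0`), maximizing ones if it is cut off at the back. -/
def Gr.wins (G : Gr) (dir x : ℕ) : Prop := x < G.L ↔ dir = 0

/-- When `B` is cut off from the coarse block `S`, the best coarse block of `x` becomes that of
`B`. -/
def Pt.moved (G : Gr) (d : Pt) (S B dir x : ℕ) : Prop :=
  d.PC x = S ∧ 0 < d.deg G B x ∧ (G.wins dir x ∨ d.deg G B x = d.CN x)

/-- The relation between the states `d` and `d'` before and after a round that cuts off the fine
block `B` from the coarse block `S`. -/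
structure Round (G : Gr) (d : Pt) (S B dir : ℕ) (d' : Pt) : Prop where
  struc : d'.Struc G.N
  nc : d'.nc = d.nc + 1
  cl : ∀ c < d.nc, c ≠ S → d'.CL c = d.CL c
  cl_S : d'.CL S = if dir = 0 then d.BR B else d.CL S
  cl_new : d'.CL d.nc = d.BL B
  cr : ∀ c < d.nc, c ≠ S → d'.CR c = d.CR c
  cr_S : d'.CR S = if dir = 0 then d.CR S else d.BL B
  cr_new : d'.CR d.nc = d.BR B
  co : ∀ x < G.N, d'.co x = if d.BK x = B then d.nc else d.co x
  pc : ∀ x < G.N, d'.PC x = if d.moved G S B dir x then d.nc else d.PC x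
  bl : ∀ x < G.N, d.BL (d.BK x) ≤ d'.BL (d'.BK x) ∧ d'.BR (d'.BK x) ≤ d.BR (d.BK x)
  same : ∀ x < G.N, ∀ y < G.N, d'.BK x = d'.BK y ↔
    d.BK x = d.BK y ∧ (d.moved G S B dir x ↔ d.moved G S B dir y)
  ord : ∀ x < G.N, ∀ y < G.N, d.BK x = d.BK y → d.moved G S B dir x → ¬ d.moved G S B dir y →
    if dir = 0 then d'.BL (d'.BK x) < d'.BL (d'.BK y) else d'.BL (d'.BK y) < d'.BL (d'.BK x)
  cn : ∀ x < G.N, d'.CN x = if d.moved G S B dir x then d.deg G B x else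
    if d.PC x = S then d.CN x - d.deg G B x else d.CN x
  sp : d.sp ≤ d'.sp
  st : ∀ i < d.sp, d'.ST i = d.ST i
  st_moved : ∀ x < G.N, d.moved G S B dir x → ∃ i < d'.sp, d'.ST i = d'.co x
  stk : ∀ i < d'.sp, d'.ST i < d.nc + 1
  ts : ∀ f, d'.TS f < d.nc + 1

/-- The block `B` that is cut off from `S` is its first or its last fine block, as told by `dir`,
and it is not the only one. -/
structure CutOff (d : Pt) (S B dir : ℕ) : Prop where
  hS : S < d.nc
  hB : B < d.nf
  hBS : d.BC B = S
  lt : d.BL B < d.BR B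
  first : dir = 0 → d.BL B = d.CL S ∧ d.BR B < d.CR S
  last : dir ≠ 0 → d.BR B = d.CR S ∧ d.CL S < d.BL B

section
variable {G : Gr} {Bef : ℕ → ℕ → Prop} {d d' : Pt} {S B dir : ℕ}

theorem CutOff.cl_lt (hc : CutOff d S B dir) (h : d.Struc G.N) {c : ℕ} (hcn : c < d.nc)
    (hne : c ≠ S) : (d.CL c < d.CL S ∧ d.CL c < d.BL B ∧ d.CL c < d.BR B) ∨
      (d.CR S ≤ d.CL c ∧ d.CL S < d.CL c ∧ d.BL B < d.CL c ∧ d.BR B ≤ d.CL c) := by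
  have h1 := h.cdisj c hcn S hc.hS hne
  have h2 := h.cne c hcn
  have h3 := h.sub B hc.hB hc.lt
  have h4 := hc.lt
  rw [hc.hBS] at h3
  omega

/-- The order of coarse blocks after the round, in terms of the one before. -/
theorem Round.cl_lt_iff (hr : Round G d S B dir d') (hc : CutOff d S B dir) (h : d.Struc G.N)
    {c c' : ℕ} (h1 : c < d.nc) (h2 : c' < d.nc) :
    d'.CL c < d'.CL c' ↔ d.CL c < d.CL c' := by
  have hS := hr.cl_S
  have hlt := hc.lt
  have hf := hc.first
  by_cases e1 : c = S <;> by_cases e2 : c' = S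
  · subst e1; subst e2; simp
  · subst e1
    rw [hr.cl c' h2 e2, hS]
    have := hc.cl_lt h h2 e2
    split <;> omega
  · subst e2
    rw [hr.cl c h1 e1, hS]
    have := hc.cl_lt h h1 e1
    split <;> omega
  · rw [hr.cl c h1 e1, hr.cl c' h2 e2]

/-- The new coarse block is next to `S`. -/
theorem Round.cl_new_lt_iff (hr : Round G d S B dir d') (hc : CutOff d S B dir)
    (h : d.Struc G.N) {c : ℕ} (h1 : c < d.nc) :
    (d'.CL c < d'.CL d.nc ↔ d.CL c < d.CL S ∨ c = S ∧ dir ≠ 0) ∧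
    (d'.CL d.nc < d'.CL c ↔ d.CL S < d.CL c ∨ c = S ∧ dir = 0) := by
  have hS := hr.cl_S
  have hlt := hc.lt
  have hf := hc.first
  have hl := hc.last
  rw [hr.cl_new]
  by_cases e1 : c = S
  · subst e1
    rw [hS]
    by_cases hd : dir = 0
    · simp [hd]; omega
    · simp [hd]; omega
  · have := hc.cl_lt h h1 e1
    rw [hr.cl c h1 e1]
    simp [e1]; omega

theorem Pt.deg_le (hR : RInv G Bef d) (hc : CutOff d S B dir) {x : ℕ} (hx : x < G.N)
    (hS : d.PC x = S) : d.deg G B x ≤ d.CN x := by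
  rw [hR.cn x hx]
  apply Finset.card_le_card
  intro e
  simp only [Finset.mem_filter, Finset.mem_range]
  rintro ⟨h1, h2, h3, h4⟩
  refine ⟨h1, h2, h3, ?_⟩
  rw [hS, Pt.co, h4, hc.hBS]

/-- If all the best live edges into `x` come from `B`, then none comes from another fine block. -/
theorem Pt.bk_of_deg_eq (hR : RInv G Bef d) (hc : CutOff d S B dir) {x : ℕ} (hx : x < G.N)
    (hS : d.PC x = S) (hd : d.deg G B x = d.CN x) {e : ℕ} (he : e < G.M) (hl : G.live e)
    (hex : G.dst e = x) (hco : d.co (G.src e) = S) : d.BK (G.src e) = B := by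
  have hsub : {e ∈ Finset.range G.M | G.live e ∧ G.dst e = x ∧ d.BK (G.src e) = B} ⊆
      {e ∈ Finset.range G.M | G.live e ∧ G.dst e = x ∧ d.co (G.src e) = d.PC x} := by
    intro e
    simp only [Finset.mem_filter, Finset.mem_range]
    rintro ⟨h1, h2, h3, h4⟩
    refine ⟨h1, h2, h3, ?_⟩
    rw [hS, Pt.co, h4, hc.hBS]
  have heq := Finset.eq_of_subset_of_card_le hsub (by rw [← hR.cn x hx, ← hd]; rfl)
  have : e ∈ {e ∈ Finset.range G.M | G.live e ∧ G.dst e = x ∧ d.co (G.src e) = d.PC x} := by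
    simp only [Finset.mem_filter, Finset.mem_range]
    exact ⟨he, hl, hex, hco.trans hS.symm⟩
  rw [← heq] at this
  exact (Finset.mem_filter.1 this).2.2.2

theorem Pt.deg_pos {e : ℕ} (he : e < G.M) (hl : G.live e)
    (hB : d.BK (G.src e) = B) : 0 < d.deg G B (G.dst e) :=
  Finset.card_pos.2 ⟨e, by simp [he, hl, hB]⟩

theorem Round.bl_lt (hr : Round G d S B dir d') (h : d.Struc G.N) {x y : ℕ}
    (hx : x < G.N) (hy : y < G.N) (hlt : d'.BL (d'.BK x) < d'.BL (d'.BK y))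
    (hne : d.BK x ≠ d.BK y) : d.BL (d.BK x) < d.BL (d.BK y) := by
  by_contra hge
  have h1 := h.bl_ne hx hy hne
  have h2 := h.br_le hy hx (by omega)
  have h3 := hr.bl x hx
  have h4 := hr.bl y hy
  have h5 := hr.struc.mem y hy
  omega

/-- A round preserves the invariant. -/
theorem Round.rinv (hr : Round G d S B dir d') (hc : CutOff d S B dir) (hR : RInv G Bef d)
    (hG : G.WF) (hB : G.Closed Bef) : RInv G Bef d' := by
  have hst := hR.toStruc
  have hco : ∀ x < G.N, d.BK x ≠ B → d'.co x = d.co x := fun x hx h => by simp [hr.co x hx, h]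
  have hcoB : ∀ x < G.N, d.BK x = B → d'.co x = d.nc ∧ d.co x = S := fun x hx h => by
    rw [hr.co x hx, if_pos h, Pt.co, h, hc.hBS]; exact ⟨rfl, rfl⟩
  have hmv : ∀ x < G.N, d.moved G S B dir x → d'.PC x = d.nc := fun x hx h => by
    simp [hr.pc x hx, h]
  have hnm : ∀ x < G.N, ¬ d.moved G S B dir x → d'.PC x = d.PC x := fun x hx h => by
    simp [hr.pc x hx, h]
  refine ⟨hr.struc, ?_, ?_, ?_, ?_, ?_, ?_, ?_, ?_, ?_, ?_, ?_, ?_⟩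
  -- Nodes of one block are told apart by whether they have been moved, and the new coarse block is
  -- next to `S`; other nodes are ordered as before.
  · intro x hx y hy hlt
    by_cases hb : d.BK x = d.BK y
    · obtain ⟨hl, hp⟩ := hR.same x hx y hy hb
      refine Or.inr ⟨hl, ?_⟩
      have hne : d'.BK x ≠ d'.BK y := fun e => by rw [e] at hlt; omega
      rw [Ne, hr.same x hx y hy] at hne
      by_cases hmx : d.moved G S B dir x
      · have hmy : ¬ d.moved G S B dir y := fun hmy => hne ⟨hb, by simp [hmx, hmy]⟩
        have ho := hr.ord x hx y hy hb hmx hmy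
        rw [hmv x hx hmx, hnm y hy hmy, ← hp, hmx.1]
        refine ((hr.cl_new_lt_iff hc hst hc.hS).2).2 (Or.inr ⟨rfl, ?_⟩)
        by_contra hd
        simp [hd] at ho; omega
      · have hmy : d.moved G S B dir y := by
          by_contra hmy
          exact hne ⟨hb, by simp [hmx, hmy]⟩
        have ho := hr.ord y hy x hx hb.symm hmy hmx
        rw [hmv y hy hmy, hnm x hx hmx, hp, hmy.1]
        refine ((hr.cl_new_lt_iff hc hst hc.hS).1).2 (Or.inr ⟨rfl, ?_⟩)
        intro hd
        simp [hd] at ho; omega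
    · rcases hR.key x hx y hy (hr.bl_lt hst hx hy hlt hb) with h1 | ⟨h1, h2⟩
      · exact Or.inl h1
      · refine Or.inr ⟨h1, ?_⟩
        by_cases hmx : d.moved G S B dir x <;> by_cases hmy : d.moved G S B dir y
        · rw [hmx.1, hmy.1] at h2; omega
        · rw [hmv x hx hmx, hnm y hy hmy]
          rw [hmx.1] at h2
          exact ((hr.cl_new_lt_iff hc hst (hR.pc y hy)).2).2 (Or.inl h2)
        · rw [hmv y hy hmy, hnm x hx hmx]
          rw [hmy.1] at h2
          exact ((hr.cl_new_lt_iff hc hst (hR.pc x hx)).1).2 (Or.inl h2)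
        · rw [hnm x hx hmx, hnm y hy hmy]
          exact (hr.cl_lt_iff hc hst (hR.pc x hx) (hR.pc y hy)).2 h2
  · intro x hx y hy he
    obtain ⟨h1, h2⟩ := (hr.same x hx y hy).1 he
    obtain ⟨h3, h4⟩ := hR.same x hx y hy h1
    refine ⟨h3, ?_⟩
    rw [hr.pc x hx, hr.pc y hy, h4]
    simp [h2]
  · intro x hx
    rw [hr.nc, hr.pc x hx]
    have := hR.pc x hx
    split <;> omega
  · intro x hx h0
    rw [hnm x hx, hR.pc0 x hx h0]
    rintro ⟨-, hp, -⟩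
    obtain ⟨e, he⟩ := Finset.card_pos.1 hp
    simp only [Finset.mem_filter, Finset.mem_range] at he
    obtain ⟨he, hl, rfl, -⟩ := he
    exact hG.lab_ne e he hl h0
  -- The edges from `S` into a node are those from `B` and those from the rest of `S`.
  · intro x hx
    rw [hr.cn x hx]
    by_cases hm : d.moved G S B dir x
    · rw [if_pos hm, hmv x hx hm, Pt.deg]
      congr 1
      apply Finset.filter_congr
      intro e he
      rw [Finset.mem_range] at he
      refine and_congr_right fun hl => and_congr_right fun _ => ?_
      have hs := hG.src_lt e he hl
      by_cases hb : d.BK (G.src e) = B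
      · simp [hb, (hcoB _ hs hb).1]
      · have := hst.co_lt hs
        simp [hb, hco _ hs hb]; omega
    · rw [if_neg hm, hnm x hx hm]
      by_cases hS : d.PC x = S
      · rw [if_pos hS, hR.cn x hx, Pt.deg, hS]
        rw [Nat.sub_eq_iff_eq_add]
        · rw [← Finset.card_union_of_disjoint]
          · congr 1
            ext e
            simp only [Finset.mem_filter, Finset.mem_range, Finset.mem_union]
            constructor
            · rintro ⟨he, hl, hx', hcS⟩
              by_cases hb : d.BK (G.src e) = B
              · exact Or.inr ⟨he, hl, hx', hb⟩
              · exact Or.inl ⟨he, hl, hx', (hco _ (hG.src_lt e he hl) hb).trans hcS⟩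
            · rintro (⟨he, hl, hx', hcS⟩ | ⟨he, hl, hx', hb⟩)
              · refine ⟨he, hl, hx', ?_⟩
                have hs := hG.src_lt e he hl
                by_cases hb : d.BK (G.src e) = B
                · exact (hcoB _ hs hb).2
                · rwa [← hco _ hs hb]
              · exact ⟨he, hl, hx', (hcoB _ (hG.src_lt e he hl) hb).2⟩
          · rw [Finset.disjoint_left]
            intro e h1 h2
            simp only [Finset.mem_filter, Finset.mem_range] at h1 h2
            obtain ⟨he, hl, -, h3⟩ := h1
            rw [(hcoB _ (hG.src_lt e he hl) h2.2.2.2).1] at h3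
            have := hc.hS
            omega
        · have := Pt.deg_le hR hc hx hS
          rwa [hR.cn x hx, Pt.deg, hS] at this
      · rw [if_neg hS, hR.cn x hx]
        congr 1
        apply Finset.filter_congr
        intro e he
        rw [Finset.mem_range] at he
        refine and_congr_right fun hl => and_congr_right fun _ => ?_
        have hs := hG.src_lt e he hl
        by_cases hb : d.BK (G.src e) = B
        · rw [(hcoB _ hs hb).1, (hcoB _ hs hb).2]
          have := hR.pc x hx
          constructor
          · intro h; exact absurd h.symm hS
          · omega
        · rw [hco _ hs hb]
  -- A node that has edges from `B` only is moved, so that the count of no node becomes `0`.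
  · intro x hx h0
    rw [hr.cn x hx]
    have h1 := hR.cnpos x hx h0
    by_cases hm : d.moved G S B dir x
    · rw [if_pos hm]; exact hm.2.1
    · rw [if_neg hm]
      split
      · next hS =>
        have h2 := Pt.deg_le hR hc hx hS
        have : d.deg G B x ≠ d.CN x := fun h => hm ⟨hS, by omega, Or.inr h⟩
        omega
      · exact h1
  -- A minimizing node is moved if it has an edge from `B` and `B` was the first part of `S`, or if all
  -- its edges from `S` come from `B`.
  · intro e he hl hL
    have hs := hG.src_lt e he hl
    have hx := hG.dst_lt e he hl
    have h1 := hR.bmin e he hl hL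
    rw [← not_lt]
    by_cases hm : d.moved G S B dir (G.dst e)
    · rw [hmv _ hx hm]
      by_cases hb : d.BK (G.src e) = B
      · rw [(hcoB _ hs hb).1]; omega
      · rw [hco _ hs hb, (hr.cl_new_lt_iff hc hst (hst.co_lt hs)).1]
        rw [hm.1] at h1
        rintro (h2 | ⟨h2, h3⟩)
        · omega
        · refine hb (Pt.bk_of_deg_eq hR hc hx hm.1 ?_ he hl rfl h2)
          refine hm.2.2.resolve_left ?_
          simp [Gr.wins, hL, h3]
    · rw [hnm _ hx hm]
      by_cases hb : d.BK (G.src e) = B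
      · rw [(hcoB _ hs hb).1, (hr.cl_new_lt_iff hc hst (hR.pc _ hx)).2]
        rw [(hcoB _ hs hb).2] at h1
        rintro (h2 | ⟨h2, h3⟩)
        · omega
        · exact hm ⟨h2, Pt.deg_pos he hl hb, Or.inl (by simp [Gr.wins, hL, h3])⟩
      · rw [hco _ hs hb, hr.cl_lt_iff hc hst (hst.co_lt hs) (hR.pc _ hx)]
        omega
  -- The same for maximizing nodes, with the last part of `S`.
  · intro e he hl hL
    have hL' : ¬ G.dst e < G.L := by omega
    have hs := hG.src_lt e he hl
    have hx := hG.dst_lt e he hl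
    have h1 := hR.bmax e he hl hL
    rw [← not_lt]
    by_cases hm : d.moved G S B dir (G.dst e)
    · rw [hmv _ hx hm]
      by_cases hb : d.BK (G.src e) = B
      · rw [(hcoB _ hs hb).1]; omega
      · rw [hco _ hs hb, (hr.cl_new_lt_iff hc hst (hst.co_lt hs)).2]
        rw [hm.1] at h1
        rintro (h2 | ⟨h2, h3⟩)
        · omega
        · refine hb (Pt.bk_of_deg_eq hR hc hx hm.1 ?_ he hl rfl h2)
          refine hm.2.2.resolve_left ?_
          simp [Gr.wins, hL', h3]
    · rw [hnm _ hx hm]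
      by_cases hb : d.BK (G.src e) = B
      · rw [(hcoB _ hs hb).1, (hr.cl_new_lt_iff hc hst (hR.pc _ hx)).1]
        rw [(hcoB _ hs hb).2] at h1
        rintro (h2 | ⟨h2, h3⟩)
        · omega
        · exact hm ⟨h2, Pt.deg_pos he hl hb, Or.inl (by simp [Gr.wins, hL', h3])⟩
      · rw [hco _ hs hb, hr.cl_lt_iff hc hst (hR.pc _ hx) (hst.co_lt hs)]
        omega
  -- Nodes in distinct coarse blocks are in distinct fine blocks before the round.
  · intro x hx y hy hxL hyL hlt
    refine hR.bef_fine hG hB hx hy hxL hyL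
      (hr.bl_lt hst hx hy (hr.struc.bl_lt_of_cl_lt hx hy hlt) fun hb => ?_)
    have h1 := hr.co x hx
    have h2 := hr.co y hy
    have h3 : d.co x = d.co y := by rw [Pt.co, hb]; rfl
    rw [hb, h3, ← h2] at h1
    rw [h1] at hlt
    omega
  -- A block that is split puts its coarse block on the stack.
  · intro x hx y hy he hne
    by_cases hb : d.BK x = d.BK y
    · rw [Ne, hr.same x hx y hy] at hne
      by_cases hmx : d.moved G S B dir x
      · exact hr.st_moved x hx hmx
      · have hmy : d.moved G S B dir y := by
          by_contra hmy
          exact hne ⟨hb, by simp [hmx, hmy]⟩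
        rw [he]
        exact hr.st_moved y hy hmy
    · have hcl := hst.co_lt hx
      have hcl' := hst.co_lt hy
      by_cases hxB : d.BK x = B
      · have hyB : d.BK y ≠ B := fun h => hb (hxB.trans h.symm)
        rw [(hcoB x hx hxB).1, hco y hy hyB] at he
        omega
      · by_cases hyB : d.BK y = B
        · rw [(hcoB y hy hyB).1, hco x hx hxB] at he
          omega
        · rw [hco x hx hxB, hco y hy hyB] at he
          rw [hco x hx hxB]
          obtain ⟨i, hi, hi'⟩ := hR.comp x hx y hy he hb
          exact ⟨i, by have := hr.sp; omega, by rw [hr.st i hi, hi']⟩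
  · intro i hi; rw [hr.nc]; exact hr.stk i hi
  · intro f; rw [hr.nc]; exact hr.ts f

end
end Refine

namespace Refine

open Function Classical

/-! ### Splitting the fine blocks in place -/

/-- Cut the fine block `B` off from the coarse block `S`. -/
def Pt.cut (d : Pt) (S B dir : ℕ) : Pt :=
  { d with
    CL := if dir = 0 then update (update d.CL d.nc (d.BL B)) S (d.BR B)
      else update d.CL d.nc (d.BL B)
    CR := if dir = 0 then update d.CR d.nc (d.BR B)
      else update (update d.CR d.nc (d.BR B)) S (d.BL B)
    BC := update d.BC B d.nc
    nc := d.nc + 1 }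

/-- Create the block that is split off from the fine block `F`, at first empty, unless this has
been done before in the round `q`. -/
def Pt.twin (d : Pt) (F q dir : ℕ) : Pt :=
  if d.TS F = q then d else
  { d with
    TS := update d.TS F q
    TW := update d.TW F d.nf
    BL := update d.BL d.nf (if dir = 0 then d.BL F else d.BR F)
    BR := update d.BR d.nf (if dir = 0 then d.BL F else d.BR F)
    BC := update d.BC d.nf (d.BC F)
    ST := update d.ST d.sp (d.BC F)
    nf := d.nf + 1
    sp := d.sp + 1 }

/-- Move the node `x` to the block that is split off from its fine block, exchanging it with the
node `z` at the border between the two. -/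
def Pt.move (d : Pt) (x q dir : ℕ) : Pt :=
  let F := d.BK x
  let g := d.TW F
  let pos := if dir = 0 then d.BL F else d.BR F - 1
  let z := d.EM pos
  { d with
    EM := update (update d.EM (d.PS x) z) pos x
    PS := update (update d.PS z (d.PS x)) x pos
    BK := update d.BK x g
    PC := update d.PC x q
    BL := if dir = 0 then update d.BL F (pos + 1) else update d.BL g pos
    BR := if dir = 0 then update d.BR g (pos + 1) else update d.BR F pos }

/-- The invariant while nodes are moved, `d₀` being the state after `Pt.cut` and `mv` the set of
the nodes moved so far. -/
structure Mid (N : ℕ) (d₀ : Pt) (q dir : ℕ) (mv : ℕ → Prop) (d : Pt) : Prop where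
  em : ∀ p < N, d.EM p < N ∧ d.PS (d.EM p) = p
  ps : ∀ x < N, d.PS x < N ∧ d.EM (d.PS x) = x
  cl : d.CL = d₀.CL
  cr : d.CR = d₀.CR
  nc : d.nc = d₀.nc
  nf : d₀.nf ≤ d.nf
  unm : ∀ x < N, ¬ mv x → d.BK x = d₀.BK x ∧ d.PC x = d₀.PC x
  mvd : ∀ x < N, mv x → d.TS (d₀.BK x) = q ∧ d.BK x = d.TW (d₀.BK x) ∧ d.PC x = q
  mem : ∀ x < N, d.BL (d.BK x) ≤ d.PS x ∧ d.PS x < d.BR (d.BK x)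
  tw : ∀ f < d₀.nf, d.TS f = q → d₀.nf ≤ d.TW f ∧ d.TW f < d.nf ∧ d.BC (d.TW f) = d₀.BC f ∧
    (∃ i < d.sp, d.ST i = d₀.BC f) ∧
    (dir = 0 → d.BL (d.TW f) = d₀.BL f ∧ d.BR (d.TW f) = d.BL f ∧ d.BR f = d₀.BR f) ∧
    (dir ≠ 0 → d.BR (d.TW f) = d₀.BR f ∧ d.BL (d.TW f) = d.BR f ∧ d.BL f = d₀.BL f) ∧
    d₀.BL f ≤ d.BL f ∧ d.BL f ≤ d.BR f ∧ d.BR f ≤ d₀.BR f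
  ntw : ∀ f < d₀.nf, d.TS f ≠ q → d.BL f = d₀.BL f ∧ d.BR f = d₀.BR f
  bc : ∀ f < d₀.nf, d.BC f = d₀.BC f
  inj : ∀ f < d₀.nf, ∀ g < d₀.nf, d.TS f = q → d.TS g = q → d.TW f = d.TW g → f = g
  cover : ∀ g < d.nf, d₀.nf ≤ g → ∃ f < d₀.nf, d.TS f = q ∧ d.TW f = g
  ts : ∀ f, d.TS f ≤ q
  tsn : ∀ f, d₀.nf ≤ f → d.TS f ≠ q
  sp : d₀.sp ≤ d.sp
  st : ∀ i < d₀.sp, d.ST i = d₀.ST i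
  stk : ∀ i < d.sp, d.ST i < d.nc

section
variable {N : ℕ} {d₀ d : Pt} {q dir : ℕ} {mv : ℕ → Prop}

/-- Every fine block lies within one of the blocks at the beginning of the round. -/
theorem Mid.sub (h : Mid N d₀ q dir mv d) (h₀ : d₀.Struc N) {g : ℕ} (hg : g < d.nf) :
    ∃ f < d₀.nf, (g = f ∨ d.TS f = q ∧ d.TW f = g) ∧ d.BC g = d₀.BC f ∧
      d₀.BL f ≤ d.BL g ∧ d.BL g ≤ d.BR g ∧ d.BR g ≤ d₀.BR f := by
  by_cases hgn : g < d₀.nf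
  · refine ⟨g, hgn, Or.inl rfl, h.bc g hgn, ?_⟩
    by_cases ht : d.TS g = q
    · exact (h.tw g hgn ht).2.2.2.2.2.2
    · obtain ⟨h1, h2⟩ := h.ntw g hgn ht
      have := h₀.le g hgn
      omega
  · obtain ⟨f, hf, ht, rfl⟩ := h.cover g hg (by omega)
    refine ⟨f, hf, Or.inr ⟨ht, rfl⟩, (h.tw f hf ht).2.2.1, ?_⟩
    have := h.tw f hf ht
    by_cases hd : dir = 0
    · have h' := this.2.2.2.2.1 hd; omega
    · have h' := this.2.2.2.2.2.1 hd; omega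

theorem Mid.disj (h : Mid N d₀ q dir mv d) (h₀ : d₀.Struc N) {f g p : ℕ} (hf : f < d.nf)
    (hg : g < d.nf) (h1 : d.BL f ≤ p) (h2 : p < d.BR f) (h3 : d.BL g ≤ p) (h4 : p < d.BR g) :
    f = g := by
  obtain ⟨f', hf', hff, -, h5, h6, h7⟩ := h.sub h₀ hf
  obtain ⟨g', hg', hgg, -, h8, h9, h10⟩ := h.sub h₀ hg
  have := h₀.disj f' hf' g' hg' p (by omega) (by omega) (by omega) (by omega)
  subst this
  rcases hff with rfl | ⟨ht, rfl⟩ <;> rcases hgg with rfl | ⟨ht', rfl⟩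
  · rfl
  · have := h.tw f hf' ht'
    by_cases hd : dir = 0
    · have h' := this.2.2.2.2.1 hd; omega
    · have h' := this.2.2.2.2.2.1 hd; omega
  · have := h.tw _ hf' ht
    by_cases hd : dir = 0
    · have h' := this.2.2.2.2.1 hd; omega
    · have h' := this.2.2.2.2.2.1 hd; omega
  · rfl

theorem Mid.bk_lt (h : Mid N d₀ q dir mv d) (h₀ : d₀.Struc N) {x : ℕ} (hx : x < N) :
    d.BK x < d.nf := by
  by_cases hm : mv x
  · obtain ⟨h1, h2, -⟩ := h.mvd x hx hm
    rw [h2]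
    exact (h.tw _ (h₀.bk x hx) h1).2.1
  · rw [(h.unm x hx hm).1]
    have := h₀.bk x hx
    have := h.nf
    omega

theorem Mid.struc (h : Mid N d₀ q dir mv d) (h₀ : d₀.Struc N) : d.Struc N where
  em := h.em
  ps := h.ps
  bk x hx := h.bk_lt h₀ hx
  mem := h.mem
  disj f hf g hg p h1 h2 h3 h4 := h.disj h₀ hf hg h1 h2 h3 h4
  bc f hf := by
    obtain ⟨f', hf', -, h1, -⟩ := h.sub h₀ hf
    rw [h1, h.nc]
    exact h₀.bc f' hf'
  le f hf := by
    obtain ⟨f', hf', -, h1, h2⟩ := h.sub h₀ hf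
    exact h2.2.1
  sub f hf hlt := by
    obtain ⟨f', hf', -, h1, h2⟩ := h.sub h₀ hf
    rw [h1, h.cl, h.cr]
    have := h₀.sub f' hf' (by omega)
    omega
  cdisj := by rw [h.nc, h.cl, h.cr]; exact h₀.cdisj
  cne := by rw [h.nc, h.cl, h.cr]; exact h₀.cne

theorem Mid.init (h₀ : d₀.Struc N) (hts : ∀ f, d₀.TS f < q) (hst : ∀ i < d₀.sp, d₀.ST i < d₀.nc) :
    Mid N d₀ q dir (fun _ => False) d₀ where
  em := h₀.em
  ps := h₀.ps
  cl := rfl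
  cr := rfl
  nc := rfl
  nf := le_rfl
  unm _ _ _ := ⟨rfl, rfl⟩
  mvd _ _ h := h.elim
  mem := h₀.mem
  tw f _ h := absurd h (hts f).ne
  ntw _ _ _ := ⟨rfl, rfl⟩
  bc _ _ := rfl
  inj f _ _ _ h := absurd h (hts f).ne
  cover g h1 h2 := by omega
  ts f := (hts f).le
  tsn f _ := (hts f).ne
  sp := le_rfl
  st _ _ := rfl
  stk := hst

/-- Creating an empty block preserves the invariant. -/
theorem Mid.twin (h : Mid N d₀ q dir mv d) (h₀ : d₀.Struc N) {F : ℕ} (hF : F < d₀.nf) :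
    Mid N d₀ q dir mv (d.twin F q dir) ∧ (d.twin F q dir).TS F = q := by
  unfold Pt.twin
  split
  · next ht => exact ⟨h, ht⟩
  next ht =>
  refine ⟨?_, by simp⟩
  have hnf := h.nf
  have hlt : ∀ f < d₀.nf, f ≠ d.nf := by intro f hf; omega
  have hpos := h.ntw F hF ht
  have hsub := h₀.le F hF
  have htsF : ∀ f, update d.TS F q f = q ↔ f = F ∨ d.TS f = q := by
    intro f
    rw [update_apply]; split <;> simp [*]
  have hbk : ∀ x < N, d.BK x ≠ d.nf := fun x hx => (h.bk_lt h₀ hx).ne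
  constructor <;> dsimp only
  · exact h.em
  · exact h.ps
  · exact h.cl
  · exact h.cr
  · exact h.nc
  · omega
  · exact h.unm
  · intro x hx hm
    obtain ⟨h1, h2, h3⟩ := h.mvd x hx hm
    have hne : d₀.BK x ≠ F := by rintro rfl; exact ht h1
    simp [hne, h1, h2, h3]
  · intro x hx
    rw [update_of_ne (hbk x hx), update_of_ne (hbk x hx)]
    exact h.mem x hx
  · intro f hf hts
    rw [htsF] at hts
    by_cases hfF : f = F
    · subst hfF
      simp only [update_self, update_of_ne (hlt f hf)]
      refine ⟨hnf, by omega, h.bc f hf, ⟨d.sp, by omega, by simp [h.bc f hf]⟩, ?_, ?_, ?_⟩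
      · intro hd; simp [hd]; omega
      · intro hd; simp [hd]; omega
      · omega
    · have hts := hts.resolve_left hfF
      obtain ⟨h1, h2, h3, ⟨i, hi, hi'⟩, h5⟩ := h.tw f hf hts
      simp only [update_of_ne (hlt f hf), update_of_ne hfF, update_of_ne h2.ne]
      exact ⟨h1, by omega, h3, ⟨i, by omega, by rw [update_of_ne hi.ne]; exact hi'⟩, h5⟩
  · intro f hf hts
    rw [Ne, htsF, not_or] at hts
    simp only [update_of_ne (hlt f hf)]
    exact h.ntw f hf hts.2
  · intro f hf
    rw [update_of_ne (hlt f hf)]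
    exact h.bc f hf
  · intro f hf g hg h1 h2 h3
    rw [htsF] at h1 h2
    by_cases hfF : f = F <;> by_cases hgF : g = F
    · rw [hfF, hgF]
    · have := (h.tw g hg (h2.resolve_left hgF)).2.1
      rw [hfF, update_self, update_of_ne hgF] at h3
      omega
    · have := (h.tw f hf (h1.resolve_left hfF)).2.1
      rw [hgF, update_self, update_of_ne hfF] at h3
      omega
    · rw [update_of_ne hfF, update_of_ne hgF] at h3
      exact h.inj f hf g hg (h1.resolve_left hfF) (h2.resolve_left hgF) h3
  · intro g hg hg'
    by_cases hgn : g = d.nf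
    · exact ⟨F, hF, by simp, by simp [hgn]⟩
    · obtain ⟨f, hf, h1, h2⟩ := h.cover g (by omega) hg'
      have hne : f ≠ F := by rintro rfl; exact ht h1
      exact ⟨f, hf, by simp [hne, h1], by simp [hne, h2]⟩
  · intro f
    rw [update_apply]
    have := h.ts f
    split <;> omega
  · intro f hf
    rw [Ne, htsF, not_or]
    exact ⟨by omega, h.tsn f hf⟩
  · have := h.sp; omega
  · intro i hi
    have := h.sp
    rw [update_of_ne (by omega)]
    exact h.st i hi
  · intro i hi
    rw [update_apply]
    split
    · rw [h.bc F hF, h.nc]; exact h₀.bc F hF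
    · exact h.stk i (by omega)

/-- Moving one node across the border preserves the invariant. -/
theorem Mid.move (h : Mid N d₀ q dir mv d) (h₀ : d₀.Struc N) {x : ℕ} (hx : x < N)
    (hxm : ¬ mv x) (ht : d.TS (d₀.BK x) = q) :
    Mid N d₀ q dir (fun y => mv y ∨ y = x) (d.move x q dir) := by
  have hF := h₀.bk x hx
  have hbkx := (h.unm x hx hxm).1
  obtain ⟨t1, t2, t3, t4, t5, t6, t7⟩ := h.tw _ hF ht
  have hmx := h.mem x hx
  have hnf := h.nf
  have hpx := h.ps x hx
  rw [hbkx] at hmx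
  -- `F` is the fine block of `x` and `g` the one split off from it
  set F := d₀.BK x with hFdef
  set g := d.TW F with hgdef
  have hFg : F ≠ g := by omega
  -- the border position
  obtain ⟨pos, hposdef⟩ : ∃ pos, pos = if dir = 0 then d.BL F else d.BR F - 1 := ⟨_, rfl⟩
  have hpos : d.BL F ≤ pos ∧ pos < d.BR F := by
    rw [hposdef]; split <;> omega
  have hposN : pos < N := by
    by_cases hd : dir = 0
    · rw [hposdef, if_pos hd]; omega
    · have h3 := h₀.sub F hF (by omega)
      have h4 := h₀.cne _ (h₀.bc F hF)
      omega
  obtain ⟨hzN, hzp⟩ := h.em pos hposN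
  set z := d.EM pos with hzdef
  have hzF : d.BK z = F := by
    have h3 := h.mem z hzN
    rw [hzp] at h3
    exact h.disj h₀ (h.bk_lt h₀ hzN) (by omega) h3.1 h3.2 hpos.1 hpos.2
  have hgx : ∀ f < d₀.nf, f ≠ g := by intro f hf; omega
  have hEM : (d.move x q dir).EM = update (update d.EM (d.PS x) z) pos x := by
    simp only [Pt.move, hbkx, hzdef, hposdef]
  have hPS : (d.move x q dir).PS = update (update d.PS z (d.PS x)) x pos := by
    simp only [Pt.move, hbkx, hzdef, hposdef]
  have hBK : (d.move x q dir).BK = update d.BK x g := by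
    simp only [Pt.move, hbkx, hgdef]
  have hBL : (d.move x q dir).BL =
      if dir = 0 then update d.BL F (pos + 1) else update d.BL g pos := by
    simp only [Pt.move, hbkx, hposdef, hgdef]
  have hBR : (d.move x q dir).BR =
      if dir = 0 then update d.BR g (pos + 1) else update d.BR F pos := by
    simp only [Pt.move, hbkx, hposdef, hgdef]
  -- what becomes of the borders of the blocks
  have hLF : (d.move x q dir).BL F = if dir = 0 then pos + 1 else d.BL F := by
    rw [hBL]; split <;> simp [hFg]
  have hRF : (d.move x q dir).BR F = if dir = 0 then d.BR F else pos := by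
    rw [hBR]; split <;> simp [hFg]
  have hLg : (d.move x q dir).BL g = if dir = 0 then d.BL g else pos := by
    rw [hBL]; split <;> simp [hFg.symm]
  have hRg : (d.move x q dir).BR g = if dir = 0 then pos + 1 else d.BR g := by
    rw [hBR]; split <;> simp [hFg.symm]
  have hLo : ∀ f, f ≠ F → f ≠ g → (d.move x q dir).BL f = d.BL f := by
    intro f h1 h2
    rw [hBL]; split <;> simp [h1, h2]
  have hRo : ∀ f, f ≠ F → f ≠ g → (d.move x q dir).BR f = d.BR f := by
    intro f h1 h2
    rw [hBR]; split <;> simp [h1, h2]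
  have hxz : z = x ↔ pos = d.PS x := by
    constructor
    · intro e; rw [← hzp, e]
    · intro e; rw [hzdef, e]; exact hpx.2
  constructor
  · intro p hp
    obtain ⟨h1, h2⟩ := h.em p hp
    rw [hEM, hPS]
    by_cases e1 : p = pos
    · subst e1; simp [hx]
    · by_cases e2 : p = d.PS x
      · have : z ≠ x := fun e => e1 (e2.trans (hxz.1 e).symm)
        rw [update_of_ne e1, e2, update_self, update_of_ne this, update_self]
        exact ⟨hzN, rfl⟩
      · have h3 : d.EM p ≠ z := fun e => e1 (by rw [← h2, e, hzp])
        have h4 : d.EM p ≠ x := fun e => e2 (by rw [← h2, e])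
        rw [update_of_ne e1, update_of_ne e2, update_of_ne h4, update_of_ne h3]
        exact ⟨h1, h2⟩
  · intro y hy
    obtain ⟨h1, h2⟩ := h.ps y hy
    rw [hEM, hPS]
    by_cases e1 : y = x
    · subst e1; simp [hposN]
    · by_cases e2 : y = z
      · have : d.PS x ≠ pos := fun e => e1 (e2.trans (hxz.2 e.symm))
        rw [update_of_ne e1, e2, update_self, update_of_ne this, update_self]
        exact ⟨hpx.1, rfl⟩
      · have h3 : d.PS y ≠ pos := fun e => e2 (by rw [← h2, e])
        have h4 : d.PS y ≠ d.PS x := fun e => e1 (by rw [← h2, e, hpx.2])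
        rw [update_of_ne e1, update_of_ne e2, update_of_ne h3, update_of_ne h4]
        exact ⟨h1, h2⟩
  · exact h.cl
  · exact h.cr
  · exact h.nc
  · exact h.nf
  · intro y hy hm
    rw [not_or] at hm
    rw [hBK, update_of_ne hm.2]
    refine ⟨(h.unm y hy hm.1).1, ?_⟩
    simp only [Pt.move]
    rw [update_of_ne hm.2]
    exact (h.unm y hy hm.1).2
  · intro y hy hm
    rw [hBK]
    show d.TS _ = q ∧ _ = d.TW _ ∧ update d.PC x q y = q
    by_cases e1 : y = x
    · subst e1; simp [ht, ← hgdef, ← hFdef]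
    · rw [update_of_ne e1, update_of_ne e1]
      exact h.mvd y hy (hm.resolve_right e1)
  · intro y hy
    have hm := h.mem y hy
    rw [hBK, hPS]
    by_cases e1 : y = x
    · subst e1
      rw [update_self, update_self, hLg, hRg]
      by_cases hd : dir = 0
      · have := t5 hd; simp [hd] at hposdef ⊢; omega
      · have := t6 hd; simp [hd] at hposdef ⊢; omega
    · rw [update_of_ne e1, update_of_ne e1]
      by_cases e2 : y = z
      · have hne : pos ≠ d.PS x := fun e => e1 (e2.trans (hxz.2 e))
        subst e2
        rw [update_self, hzF, hLF, hRF]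
        by_cases hd : dir = 0
        · simp [hd] at hposdef ⊢; omega
        · simp [hd] at hposdef ⊢; omega
      · rw [update_of_ne e2]
        have hne : d.PS y ≠ pos := fun e => e2 (by rw [← (h.ps y hy).2, e])
        by_cases e3 : d.BK y = F
        · rw [e3] at hm ⊢
          rw [hLF, hRF]
          by_cases hd : dir = 0
          · simp [hd] at hposdef ⊢; omega
          · simp [hd] at hposdef ⊢; omega
        · by_cases e4 : d.BK y = g
          · rw [e4] at hm ⊢
            rw [hLg, hRg]
            by_cases hd : dir = 0
            · have := t5 hd; simp [hd] at hposdef ⊢; omega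
            · have := t6 hd; simp [hd] at hposdef ⊢; omega
          · rw [hLo _ e3 e4, hRo _ e3 e4]
            exact hm
  · intro f hf hts
    have h' := h.tw f hf hts
    show d₀.nf ≤ d.TW f ∧ d.TW f < d.nf ∧ d.BC (d.TW f) = d₀.BC f ∧
      (∃ i < d.sp, d.ST i = d₀.BC f) ∧ _
    refine ⟨h'.1, h'.2.1, h'.2.2.1, h'.2.2.2.1, ?_⟩
    show (dir = 0 → (d.move x q dir).BL (d.TW f) = _ ∧ (d.move x q dir).BR (d.TW f) = _ ∧ _) ∧
      (dir ≠ 0 → (d.move x q dir).BR (d.TW f) = _ ∧ (d.move x q dir).BL (d.TW f) = _ ∧ _) ∧ _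
    by_cases e : f = F
    · subst e
      rw [← hgdef, hLF, hRF, hLg, hRg]
      by_cases hd : dir = 0
      · have := t5 hd; simp [hd] at hposdef ⊢; omega
      · have := t6 hd; simp [hd] at hposdef ⊢; omega
    · have e2 : d.TW f ≠ g := fun e' => e (h.inj f hf F hF hts ht e')
      have e3 : d.TW f ≠ F := by omega
      rw [hLo f e (hgx f hf), hRo f e (hgx f hf), hLo _ e3 e2, hRo _ e3 e2]
      exact h'.2.2.2.2
  · intro f hf hts
    have e : f ≠ F := by rintro rfl; exact hts ht
    rw [hLo f e (hgx f hf), hRo f e (hgx f hf)]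
    exact h.ntw f hf hts
  · exact h.bc
  · exact h.inj
  · exact h.cover
  · exact h.ts
  · exact h.tsn
  · exact h.sp
  · exact h.st
  · exact h.stk

end

section
variable {G : Gr} {Bef : ℕ → ℕ → Prop} {d d' : Pt} {S B dir : ℕ}

theorem CutOff.cut_cl (hc : CutOff d S B dir) (c : ℕ) : (d.cut S B dir).CL c =
    if c = d.nc then d.BL B else if c = S ∧ dir = 0 then d.BR B else d.CL c := by
  have h1 := hc.hS
  simp only [Pt.cut]
  by_cases hd : dir = 0
  · simp only [hd, if_true, and_true]
    rw [update_apply, update_apply]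
    split_ifs <;> omega
  · simp only [hd, if_false, and_false]
    rw [update_apply]

theorem CutOff.cut_cr (hc : CutOff d S B dir) (c : ℕ) : (d.cut S B dir).CR c =
    if c = d.nc then d.BR B else if c = S ∧ dir ≠ 0 then d.BL B else d.CR c := by
  have h1 := hc.hS
  simp only [Pt.cut]
  by_cases hd : dir = 0
  · simp only [hd, if_true, ne_eq, not_true_eq_false, and_false, if_false]
    rw [update_apply]
  · simp only [hd, if_false, ne_eq, not_false_eq_true, and_true]
    rw [update_apply, update_apply]
    split_ifs <;> omega

theorem CutOff.cut_struc (hc : CutOff d S B dir) (h : d.Struc G.N) :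
    (d.cut S B dir).Struc G.N := by
  have hsB := h.sub B hc.hB hc.lt
  have hlt := hc.lt
  have hS := hc.hS
  have h1 := hc.first
  have h2 := hc.last
  rw [hc.hBS] at hsB
  refine ⟨h.em, h.ps, h.bk, h.mem, h.disj, ?_, h.le, ?_, ?_, ?_⟩
  · intro f hf
    have := h.bc f hf
    simp only [Pt.cut, update_apply]
    split <;> omega
  · intro f hf (hne : d.BL f < d.BR f)
    rw [hc.cut_cl, hc.cut_cr]
    simp only [Pt.cut, update_apply]
    have h4 := h.sub f hf hne
    have h5 := h.bc f hf
    by_cases hfB : f = B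
    · subst hfB; simp
    · simp only [hfB, if_false, h5.ne]
      by_cases hfS : d.BC f = S
      · rw [hfS] at h4 ⊢
        -- the block `f` is on the other side of the cut, since it is disjoint from `B`
        have h3 : d.BR f ≤ d.BL B ∨ d.BR B ≤ d.BL f := by
          by_contra h6
          exact hfB (h.disj f hf B hc.hB (max (d.BL f) (d.BL B)) (by omega) (by omega) (by omega)
            (by omega))
        by_cases hd : dir = 0 <;> simp [hd] at h1 h2 ⊢ <;> omega
      · simp only [hfS, false_and, if_false]; exact h4
  · intro c hcn c' hcn' hne
    rw [hc.cut_cl, hc.cut_cr, hc.cut_cl, hc.cut_cr]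
    simp only [Pt.cut] at hcn hcn'
    have h3 := h.cne S hS
    by_cases e : c = d.nc <;> by_cases e' : c' = d.nc
    · omega
    · have h4 : c' ≠ S → _ := h.cdisj c' (by omega) S hS
      by_cases e2 : c' = S <;> by_cases hd : dir = 0 <;> simp [e, e', e2, hd, hS.ne] at h1 h2 h4 ⊢ <;> omega
    · have h4 : c ≠ S → _ := h.cdisj c (by omega) S hS
      by_cases e2 : c = S <;> by_cases hd : dir = 0 <;> simp [e, e', e2, hd, hS.ne] at h1 h2 h4 ⊢ <;> omega
    · have h4 := h.cdisj c (by omega) c' (by omega) hne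
      have h5 := h.cne c (by omega)
      have h6 := h.cne c' (by omega)
      by_cases e2 : c = S <;> by_cases e3 : c' = S <;> by_cases hd : dir = 0 <;>
        simp [e, e', e2, e3, hd, hS.ne] at h1 h2 h4 h5 h6 ⊢ <;> omega
  · intro c hcn
    rw [hc.cut_cl, hc.cut_cr]
    simp only [Pt.cut] at hcn
    have h3 := h.cne S hS
    by_cases e : c = d.nc
    · simp [e]; omega
    · have h4 := h.cne c (by omega)
      simp only [e, if_false]
      by_cases e2 : c = S <;> by_cases hd : dir = 0 <;> simp [e2, hd] at h1 h2 h4 ⊢ <;> omega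

/-- The state after all preferring nodes have been moved is the one at the end of a round. -/
theorem Mid.round (hR : RInv G Bef d) (hc : CutOff d S B dir)
    (h : Mid G.N (d.cut S B dir) d.nc dir (d.moved G S B dir) d')
    (hcn : ∀ x < G.N, d'.CN x = if d.moved G S B dir x then d.deg G B x else
      if d.PC x = S then d.CN x - d.deg G B x else d.CN x) : Round G d S B dir d' := by
  have h₀ := hc.cut_struc hR.toStruc
  have hst := h.struc h₀
  have hbk : (d.cut S B dir).BK = d.BK := rfl
  have hBL : (d.cut S B dir).BL = d.BL := rfl
  have hBR : (d.cut S B dir).BR = d.BR := rfl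
  have hnf : (d.cut S B dir).nf = d.nf := rfl
  have hBC : ∀ x < G.N, (d.cut S B dir).BC (d.BK x) = if d.BK x = B then d.nc else d.co x := by
    intro x hx
    simp only [Pt.cut, update_apply, Pt.co]
  have hco : ∀ x < G.N, d'.co x = if d.BK x = B then d.nc else d.co x := by
    intro x hx
    rw [← hBC x hx, Pt.co]
    by_cases hm : d.moved G S B dir x
    · obtain ⟨h1, h2, -⟩ := h.mvd x hx hm
      rw [h2]
      exact (h.tw _ (h₀.bk x hx) h1).2.2.1
    · rw [(h.unm x hx hm).1]
      exact h.bc _ (h₀.bk x hx)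
  refine ⟨hst, h.nc, ?_, ?_, ?_, ?_, ?_, ?_, hco, ?_, ?_, ?_, ?_, hcn, h.sp, h.st, ?_, ?_, ?_⟩
  · intro c h1 h2
    rw [h.cl, hc.cut_cl]
    simp [h2, h1.ne]
  · rw [h.cl, hc.cut_cl]
    simp [hc.hS.ne]
  · rw [h.cl, hc.cut_cl]; simp
  · intro c h1 h2
    rw [h.cr, hc.cut_cr]
    simp [h2, h1.ne]
  · rw [h.cr, hc.cut_cr]
    simp [hc.hS.ne]
  · rw [h.cr, hc.cut_cr]; simp
  · intro x hx
    split
    · next hm => exact (h.mvd x hx hm).2.2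
    · next hm => exact (h.unm x hx hm).2
  · intro x hx
    by_cases hm : d.moved G S B dir x
    · obtain ⟨h1, h2, -⟩ := h.mvd x hx hm
      rw [h2]
      have h3 := h.tw _ (h₀.bk x hx) h1
      rw [hbk, hBL, hBR] at *
      by_cases hd : dir = 0
      · have := h3.2.2.2.2.1 hd; omega
      · have := h3.2.2.2.2.2.1 hd; omega
    · rw [(h.unm x hx hm).1]
      by_cases ht : d'.TS (d.BK x) = d.nc
      · have h3 := h.tw _ (h₀.bk x hx) ht
        rw [hbk, hBL, hBR] at *
        omega
      · have h3 := h.ntw _ (h₀.bk x hx) ht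
        rw [hbk, hBL, hBR] at *
        omega
  · intro x hx y hy
    have hx' := hR.bk x hx
    have hy' := hR.bk y hy
    by_cases hm : d.moved G S B dir x <;> by_cases hm' : d.moved G S B dir y
    · obtain ⟨h1, h2, -⟩ := h.mvd x hx hm
      obtain ⟨h3, h4, -⟩ := h.mvd y hy hm'
      rw [hbk] at *
      simp only [hm, hm', and_true]
      rw [h2, h4]
      exact ⟨h.inj _ hx' _ hy' h1 h3, fun e => by rw [e]⟩
    · obtain ⟨h1, h2, -⟩ := h.mvd x hx hm
      have h3 := (h.unm y hy hm').1
      have h4 := h.tw _ hx' h1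
      rw [hbk, hnf] at *
      have hne : d'.BK x ≠ d'.BK y := by omega
      simp [hne, hm, hm']
    · obtain ⟨h1, h2, -⟩ := h.mvd y hy hm'
      have h3 := (h.unm x hx hm).1
      have h4 := h.tw _ hy' h1
      rw [hbk, hnf] at *
      have hne : d'.BK x ≠ d'.BK y := by omega
      simp [hne, hm, hm']
    · rw [(h.unm x hx hm).1, (h.unm y hy hm').1, hbk]
      simp [hm, hm']
  · intro x hx y hy hb hm hm'
    obtain ⟨h1, h2, -⟩ := h.mvd x hx hm
    have h3 := (h.unm y hy hm').1
    have h4 := h.tw _ (h₀.bk x hx) h1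
    have h5 := h.mem x hx
    have h6 := h.mem y hy
    rw [hbk] at *
    rw [h2] at h5 ⊢
    rw [h3, ← hb] at h6 ⊢
    by_cases hd : dir = 0
    · rw [if_pos hd]
      have := h4.2.2.2.2.1 hd; omega
    · rw [if_neg hd]
      have := h4.2.2.2.2.2.1 hd; omega
  · intro x hx hm
    obtain ⟨h1, -, -⟩ := h.mvd x hx hm
    rw [hco x hx, ← hBC x hx]
    exact (h.tw _ (h₀.bk x hx) h1).2.2.2.1
  · intro i hi
    have := h.stk i hi
    rwa [h.nc] at this
  · intro f
    have := h.ts f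
    omega

/-- When no coarse block on the stack is left, the order of the fine blocks is determined by the
labels and, for equal labels, by the sources of the live edges. -/
theorem RInv.final (hR : RInv G Bef d) (hG : G.WF) (hsp : d.sp = 0) {x y : ℕ} (hx : x < G.N)
    (hy : y < G.N) (hle : d.BL (d.BK x) ≤ d.BL (d.BK y)) :
    G.lab x ≤ G.lab y ∧ (G.lab x = G.lab y →
      (G.L ≤ x → y < G.L → ∀ e < G.M, ∀ e' < G.M, G.live e → G.live e' → G.dst e = x →
        G.dst e' = y → d.BL (d.BK (G.src e)) ≤ d.BL (d.BK (G.src e'))) ∧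
      (x < G.L → y < G.L → G.lab x ≠ 0 → ∃ e < G.M, G.live e ∧ G.dst e = x ∧
        ∀ e' < G.M, G.live e' → G.dst e' = y →
          d.BL (d.BK (G.src e)) ≤ d.BL (d.BK (G.src e')))) := by
  have hst := hR.toStruc
  have hcf : ∀ a < G.N, ∀ b < G.N, d.CL (d.co a) ≤ d.CL (d.co b) →
      d.BL (d.BK a) ≤ d.BL (d.BK b) := by
    -- Every coarse block is a single fine block, as the stack is empty.
    intro a ha b hb hab
    by_cases he : d.co a = d.co b
    · by_contra hlt
      obtain ⟨i, hi, -⟩ := hR.comp a ha b hb he (fun h => by rw [h] at hlt; omega)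
      omega
    · have := hst.cl_ne (hst.co_lt ha) (hst.co_lt hb) he
      exact (hst.bl_lt_of_cl_lt ha hb (by omega)).le
  have hkey : G.lab x < G.lab y ∨ G.lab x = G.lab y ∧ d.CL (d.PC x) ≤ d.CL (d.PC y) := by
    rcases hle.lt_or_eq with h | h
    · have := hR.key x hx y hy h
      omega
    · have he : d.BK x = d.BK y := by
        by_contra hne
        exact hst.bl_ne hx hy hne h
      obtain ⟨h1, h2⟩ := hR.same x hx y hy he
      rw [h2]; omega
  refine ⟨by omega, fun hl => ?_⟩
  have hpc : d.CL (d.PC x) ≤ d.CL (d.PC y) := by omega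
  constructor
  · intro hxL hyL e he e' he' hle hle' hex hey
    have h1 := hR.bmax e he hle (by omega)
    have h2 := hR.bmin e' he' hle' (by omega)
    rw [hex] at h1
    rw [hey] at h2
    exact hcf _ (hG.src_lt e he hle) _ (hG.src_lt e' he' hle') (by omega)
  · intro hxL hyL h0
    have h1 := hR.cnpos x hx h0
    rw [hR.cn x hx, Finset.card_pos] at h1
    obtain ⟨e, he⟩ := h1
    simp only [Finset.mem_filter, Finset.mem_range] at he
    obtain ⟨he, hle, hex, hcx⟩ := he
    refine ⟨e, he, hle, hex, fun e' he' hle' hey => ?_⟩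
    have h2 := hR.bmin e' he' hle' (by omega)
    rw [hey] at h2
    exact hcf _ (hG.src_lt e he hle) _ (hG.src_lt e' he' hle') (by rw [hcx]; omega)

end
end Refine

namespace Refine

open Function Classical Imp

/-! ### The program for the refinement -/

/-- Traverse the list of the live edges that leave one node, and count for every node `x` with best
coarse block `s` the edges that enter it. -/
def scanEdges : Cmd :=
  .while (.reg .e)
    (.set .x (.ld .ED (.sub (.reg .e) (.lit 1))) ;;
    .ite (.eq (.ld .PC (.reg .x)) (.reg .s))
      (.ite (.eq (.ld .KK (.reg .x)) (.lit 0))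
        (.st .TL (.reg .tl) (.reg .x) ;; .set .tl (.inc (.reg .tl) 1)) .skip ;;
      .st .KK (.reg .x) (.inc (.ld .KK (.reg .x)) 1)) .skip ;;
    .set .e (.ld .NX (.sub (.reg .e) (.lit 1))))

/-- Traverse the edges that leave the nodes at the positions from `pos` to `h`. -/
def scanBlock : Cmd :=
  .while (.lt (.reg .pos) (.reg .h))
    (.set .y (.ld .EM (.reg .pos)) ;;
    .set .e (.ld .HD (.reg .y)) ;;
    scanEdges ;;
    .set .pos (.inc (.reg .pos) 1))

/-- The program for `Pt.twin`. -/
def twinCmd : Cmd :=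
  .ite (.eq (.ld .TS (.reg .f)) (.reg .q)) .skip
    (.st .TS (.reg .f) (.reg .q) ;;
    .st .TW (.reg .f) (.reg .nf) ;;
    .ite (.eq (.reg .dir) (.lit 0)) (.set .z (.ld .BL (.reg .f))) (.set .z (.ld .BR (.reg .f))) ;;
    .st .BL (.reg .nf) (.reg .z) ;;
    .st .BR (.reg .nf) (.reg .z) ;;
    .set .z (.ld .BC (.reg .f)) ;;
    .st .BC (.reg .nf) (.reg .z) ;;
    .st .ST (.reg .sp) (.reg .z) ;;
    .set .nf (.inc (.reg .nf) 1) ;;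
    .set .sp (.inc (.reg .sp) 1))

/-- The program for `Pt.move`. -/
def moveCmd : Cmd :=
  .set .g (.ld .TW (.reg .f)) ;;
  .ite (.eq (.reg .dir) (.lit 0)) (.set .pos (.ld .BL (.reg .f)))
    (.set .pos (.sub (.ld .BR (.reg .f)) (.lit 1))) ;;
  .set .z (.ld .EM (.reg .pos)) ;;
  .set .y (.ld .PS (.reg .x)) ;;
  .st .EM (.reg .y) (.reg .z) ;;
  .st .EM (.reg .pos) (.reg .x) ;;
  .st .PS (.reg .z) (.reg .y) ;;
  .st .PS (.reg .x) (.reg .pos) ;;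
  .st .BK (.reg .x) (.reg .g) ;;
  .st .PC (.reg .x) (.reg .q) ;;
  .ite (.eq (.reg .dir) (.lit 0))
    (.st .BL (.reg .f) (.inc (.reg .pos) 1) ;; .st .BR (.reg .g) (.inc (.reg .pos) 1))
    (.st .BL (.reg .g) (.reg .pos) ;; .st .BR (.reg .f) (.reg .pos))

/-- Decide for every touched node whether it is moved, and move it. -/
def moveAll : Cmd :=
  .while (.lt (.reg .i) (.reg .tl))
    (.set .x (.ld .TL (.reg .i)) ;;
    .set .k (.ld .KK (.reg .x)) ;;
    .st .KK (.reg .x) (.lit 0) ;;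
    .ite (.and (.eq (.eq (.lt (.reg .x) (.reg .len)) (.eq (.reg .dir) (.lit 0))) (.lit 0))
        (.lt (.reg .k) (.ld .CN (.reg .x))))
      (.st .CN (.reg .x) (.sub (.ld .CN (.reg .x)) (.reg .k)))
      (.st .CN (.reg .x) (.reg .k) ;; .set .f (.ld .BK (.reg .x)) ;; twinCmd ;; moveCmd) ;;
    .set .i (.inc (.reg .i) 1))

/-- The program for `Pt.cut`. -/
def cutCmd : Cmd :=
  .set .pos (.ld .BL (.reg .g)) ;;
  .set .h (.ld .BR (.reg .g)) ;;
  .set .q (.reg .nc) ;;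
  .st .CL (.reg .q) (.reg .pos) ;;
  .st .CR (.reg .q) (.reg .h) ;;
  .st .BC (.reg .g) (.reg .q) ;;
  .ite (.eq (.reg .dir) (.lit 0)) (.st .CL (.reg .s) (.reg .h)) (.st .CR (.reg .s) (.reg .pos)) ;;
  .set .nc (.inc (.reg .nc) 1)

/-- The refinement: as long as there is a coarse block on the stack, drop it if it is a single fine
block, and otherwise cut off the smaller one of its first and its last fine block. -/
def refineCmd : Cmd :=
  .while (.reg .sp)
    (.set .s (.ld .ST (.sub (.reg .sp) (.lit 1))) ;;
    .set .f (.ld .BK (.ld .EM (.ld .CL (.reg .s)))) ;;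
    .set .g (.ld .BK (.ld .EM (.sub (.ld .CR (.reg .s)) (.lit 1)))) ;;
    .ite (.eq (.reg .f) (.reg .g)) (.set .sp (.sub (.reg .sp) (.lit 1)))
      (.set .dir (.lt (.sub (.ld .BR (.reg .g)) (.ld .BL (.reg .g)))
        (.sub (.ld .BR (.reg .f)) (.ld .BL (.reg .f)))) ;;
      .ite (.eq (.reg .dir) (.lit 0)) (.set .g (.reg .f)) .skip ;;
      cutCmd ;;
      .set .tl (.lit 0) ;;
      scanBlock ;;
      .set .i (.lit 0) ;;
      moveAll))

/-- The refinement data in a program state. -/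
def toPt (s : St) : Pt where
  EM := s.arr .EM
  PS := s.arr .PS
  BK := s.arr .BK
  BL := s.arr .BL
  BR := s.arr .BR
  BC := s.arr .BC
  CL := s.arr .CL
  CR := s.arr .CR
  PC := s.arr .PC
  CN := s.arr .CN
  TS := s.arr .TS
  TW := s.arr .TW
  ST := s.arr .ST
  nf := s.reg .nf
  nc := s.reg .nc
  sp := s.reg .sp

/-- `h` points to the last live edge below `b` that leaves `y`; pointers are edges plus one, and
zero stands for none. -/
def IsTop (G : Gr) (y b h : ℕ) : Prop :=
  (h = 0 ∧ ∀ e < b, G.live e → G.src e ≠ y) ∨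
  ∃ e < b, h = e + 1 ∧ G.live e ∧ G.src e = y ∧ ∀ e' < b, e < e' → G.live e' → G.src e' ≠ y

/-- The state holds the live edges, linked by source. -/
structure Linked (G : Gr) (s : St) : Prop where
  len : s.reg .len = G.L
  ed : ∀ e < G.M, G.live e → s.arr .ED e = G.dst e
  hd : ∀ y < G.N, IsTop G y G.M (s.arr .HD y)
  nx : ∀ e < G.M, G.live e → IsTop G (G.src e) e (s.arr .NX e)

/-- What the refinement does not change. -/
structure Keep (s s' : St) : Prop where
  raw : s'.raw = s.raw
  len : s'.reg .len = s.reg .len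
  dbl : s'.reg .dbl = s.reg .dbl
  num : s'.reg .num = s.reg .num
  ed : s'.arr .ED = s.arr .ED
  hd : s'.arr .HD = s.arr .HD
  nx : s'.arr .NX = s.arr .NX

theorem Keep.refl (s : St) : Keep s s := ⟨rfl, rfl, rfl, rfl, rfl, rfl, rfl⟩

theorem Keep.trans {s s' s'' : St} (h : Keep s s') (h' : Keep s' s'') : Keep s s'' :=
  ⟨h'.raw.trans h.raw, h'.len.trans h.len, h'.dbl.trans h.dbl, h'.num.trans h.num,
    h'.ed.trans h.ed, h'.hd.trans h.hd, h'.nx.trans h.nx⟩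

theorem Keep.linked {G : Gr} {s s' : St} (h : Keep s s') (hl : Linked G s) : Linked G s' :=
  ⟨h.len.trans hl.len, by rw [h.ed]; exact hl.ed, by rw [h.hd]; exact hl.hd,
    by rw [h.nx]; exact hl.nx⟩

/-! ### Scanning the edges that leave a block -/

/-- The number of live edges into `x` with the property `P`. -/
noncomputable def indeg (G : Gr) (P : ℕ → Prop) (x : ℕ) : ℕ :=
  {e ∈ Finset.range G.M | G.live e ∧ G.dst e = x ∧ P e}.card

/-- The number of live edges with the property `P`. -/
noncomputable def nlive (G : Gr) (P : ℕ → Prop) : ℕ :=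
  {e ∈ Finset.range G.M | G.live e ∧ P e}.card

/-- The number of live edges that leave `y`. -/
noncomputable def outdeg (G : Gr) (y : ℕ) : ℕ :=
  {e ∈ Finset.range G.M | G.live e ∧ G.src e = y}.card

/-- `KK` counts the live edges with property `P` into nodes with best coarse block `S`, and
`TL` lists the nodes with positive count. -/
structure Scan (G : Gr) (S : ℕ) (PC : ℕ → ℕ) (P : ℕ → Prop) (KK TL : ℕ → ℕ) (tl : ℕ) : Prop where
  kk : ∀ x, KK x = if PC x = S then indeg G P x else 0
  pos : ∀ i < tl, 0 < KK (TL i)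
  inj : ∀ i < tl, ∀ j < tl, TL i = TL j → i = j
  all : ∀ x, 0 < KK x → ∃ i < tl, TL i = x
  le : tl ≤ nlive G P

section
variable {G : Gr} {S : ℕ} {PC : ℕ → ℕ} {P P' : ℕ → Prop} {KK TL : ℕ → ℕ} {tl : ℕ}

theorem indeg_congr (h : ∀ e < G.M, G.live e → (P e ↔ P' e)) (x : ℕ) :
    indeg G P x = indeg G P' x := by
  unfold indeg
  congr 1
  apply Finset.filter_congr
  intro e he
  rw [Finset.mem_range] at he
  exact and_congr_right fun hl => and_congr_right fun _ => h e he hl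

theorem Scan.congr (hs : Scan G S PC P KK TL tl) (h : ∀ e < G.M, G.live e → (P e ↔ P' e)) :
    Scan G S PC P' KK TL tl := by
  refine ⟨fun x => by rw [hs.kk x, indeg_congr h], hs.pos, hs.inj, hs.all, hs.le.trans ?_⟩
  apply Finset.card_le_card
  intro e
  simp only [Finset.mem_filter, Finset.mem_range]
  rintro ⟨he, hl, hp⟩
  exact ⟨he, hl, (h e he hl).1 hp⟩

theorem indeg_insert {e : ℕ} (he : e < G.M) (hl : G.live e) (hP : ¬ P e) (x : ℕ) :
    indeg G (fun e' => P e' ∨ e' = e) x = indeg G P x + if x = G.dst e then 1 else 0 := by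
  unfold indeg
  split
  · next hx =>
    rw [← Finset.card_insert_of_notMem (a := e)]
    · congr 1
      ext e'
      simp only [Finset.mem_filter, Finset.mem_range, Finset.mem_insert]
      constructor
      · rintro ⟨h1, h2, h3, h4 | h4⟩
        · exact Or.inr ⟨h1, h2, h3, h4⟩
        · exact Or.inl h4
      · rintro (rfl | ⟨h1, h2, h3, h4⟩)
        · exact ⟨he, hl, hx.symm, Or.inr rfl⟩
        · exact ⟨h1, h2, h3, Or.inl h4⟩
    · simp [hP]
  · next hx =>
    rw [add_zero]
    congr 1
    ext e'
    simp only [Finset.mem_filter, Finset.mem_range]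
    refine and_congr_right fun _ => and_congr_right fun _ => and_congr_right fun h => or_iff_left ?_
    rintro rfl
    exact hx h.symm

theorem Scan.skip (hs : Scan G S PC P KK TL tl) {e : ℕ} (he : e < G.M) (hl : G.live e)
    (hP : ¬ P e) (hS : PC (G.dst e) ≠ S) :
    Scan G S PC (fun e' => P e' ∨ e' = e) KK TL tl := by
  refine ⟨fun x => ?_, hs.pos, hs.inj, hs.all, hs.le.trans ?_⟩
  · rw [hs.kk x, indeg_insert he hl hP]
    split
    · next h =>
      have : x ≠ G.dst e := by rintro rfl; exact hS h
      simp [this]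
    · rfl
  · apply Finset.card_le_card
    intro e'
    simp only [Finset.mem_filter, Finset.mem_range]
    rintro ⟨h1, h2, h3⟩
    exact ⟨h1, h2, Or.inl h3⟩

theorem Scan.count (hs : Scan G S PC P KK TL tl) {e : ℕ} (he : e < G.M) (hl : G.live e)
    (hP : ¬ P e) (hS : PC (G.dst e) = S) :
    Scan G S PC (fun e' => P e' ∨ e' = e) (update KK (G.dst e) (KK (G.dst e) + 1))
      (if KK (G.dst e) = 0 then update TL tl (G.dst e) else TL)
      (if KK (G.dst e) = 0 then tl + 1 else tl) := by
  have hcard : nlive G (fun e' => P e' ∨ e' = e) = nlive G P + 1 := by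
    unfold nlive
    rw [← Finset.card_insert_of_notMem (a := e)]
    · congr 1
      ext e'
      simp only [Finset.mem_filter, Finset.mem_range, Finset.mem_insert]
      constructor
      · rintro ⟨h1, h2, h4 | h4⟩
        · exact Or.inr ⟨h1, h2, h4⟩
        · exact Or.inl h4
      · rintro (rfl | ⟨h1, h2, h4⟩)
        · exact ⟨he, hl, Or.inr rfl⟩
        · exact ⟨h1, h2, Or.inl h4⟩
    · simp [hP]
  have hle := hs.le
  refine ⟨fun x => ?_, ?_, ?_, ?_, ?_⟩
  · rw [indeg_insert he hl hP, update_apply]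
    by_cases hx : x = G.dst e
    · subst hx
      have := hs.kk (G.dst e)
      simp [hS] at this ⊢
      exact this
    · simp [hx, hs.kk x]
  · intro i hi
    rw [update_apply]
    split at hi
    · next h0 =>
      rw [if_pos h0]
      by_cases hit : i = tl
      · simp [hit]
      · rw [update_of_ne hit]
        have := hs.pos i (by omega)
        split <;> omega
    · next h0 =>
      rw [if_neg h0]
      have := hs.pos i hi
      split <;> omega
  · intro i hi j hj hij
    split at hi
    · next h0 =>
      rw [if_pos h0] at hij hj
      have hne : ∀ k < tl, TL k ≠ G.dst e := fun k hk h => by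
        have := hs.pos k hk
        rw [h] at this
        omega
      by_cases hit : i = tl <;> by_cases hjt : j = tl
      · omega
      · rw [hit, update_self, update_of_ne hjt] at hij
        exact absurd hij.symm (hne j (by omega))
      · rw [hjt, update_self, update_of_ne hit] at hij
        exact absurd hij (hne i (by omega))
      · rw [update_of_ne hit, update_of_ne hjt] at hij
        exact hs.inj i (by omega) j (by omega) hij
    · next h0 =>
      rw [if_neg h0] at hij hj
      exact hs.inj i hi j hj hij
  · intro x hx
    by_cases h0 : KK (G.dst e) = 0
    · rw [if_pos h0, if_pos h0]
      by_cases hxe : x = G.dst e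
      · exact ⟨tl, by omega, by simp [hxe]⟩
      · rw [update_of_ne hxe] at hx
        obtain ⟨i, hi, h⟩ := hs.all x hx
        exact ⟨i, by omega, by rw [update_of_ne hi.ne]; exact h⟩
    · rw [if_neg h0, if_neg h0]
      apply hs.all x
      by_cases hxe : x = G.dst e
      · rw [hxe]; omega
      · rwa [update_of_ne hxe] at hx
  · rw [hcard]
    split <;> omega

end

/-- The live edges whose sources are at the positions from `lo` to `p`, or at `p` if they are not
below `b`. -/
def seen (G : Gr) (PS : ℕ → ℕ) (lo p b e : ℕ) : Prop :=
  lo ≤ PS (G.src e) ∧ PS (G.src e) < p ∨ PS (G.src e) = p ∧ b ≤ e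

/-- The number of live edges below `b` that leave `y`. -/
noncomputable def todo (G : Gr) (y b : ℕ) : ℕ :=
  {e ∈ Finset.range b | G.live e ∧ G.src e = y}.card

theorem todo_top {G : Gr} {y b e : ℕ} (h : IsTop G y b (e + 1)) : todo G y b = todo G y e + 1 := by
  rcases h with ⟨h, -⟩ | ⟨e', he, hee, hl, hs, hn⟩
  · omega
  obtain rfl : e = e' := by omega
  unfold todo
  rw [← Finset.card_insert_of_notMem (a := e)]
  · congr 1
    ext e'
    simp only [Finset.mem_filter, Finset.mem_range, Finset.mem_insert]
    constructor
    · rintro ⟨h1, h2, h3⟩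
      rcases lt_trichotomy e' e with h | h | h
      · exact Or.inr ⟨h, h2, h3⟩
      · exact Or.inl h
      · exact absurd h3 (hn e' h1 h h2)
    · rintro (rfl | ⟨h1, h2, h3⟩)
      · exact ⟨he, hl, hs⟩
      · exact ⟨by omega, h2, h3⟩
  · simp

/-- The part of the state that the scan does not change. -/
structure ScanKeep (s s' : St) : Prop where
  keep : Keep s s'
  pt : toPt s' = toPt s
  rs : s'.reg .s = s.reg .s
  rq : s'.reg .q = s.reg .q
  rh : s'.reg .h = s.reg .h
  rdir : s'.reg .dir = s.reg .dir

/-- All live edges that leave `y` are counted. -/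
theorem scanEdges_spec {b W : ℕ} {G : Gr} {S lo : ℕ} {s : St} (hl : Linked G s)
    (hst : (toPt s).Struc G.N) (hG : G.WF) (hS : s.reg .s = S) {y : ℕ} (hy : y < G.N)
    (hlo : lo ≤ s.arr .PS y)
    (htop : IsTop G y G.M (s.reg .e))
    (hsc : Scan G S (s.arr .PC) (seen G (s.arr .PS) lo (s.arr .PS y) G.M) (s.arr .KK) (s.arr .TL)
      (s.reg .tl)) :
    wp b W scanEdges (fun t s' => t ≤ 100 * outdeg G y + 10 ∧ ScanKeep s s' ∧
      s'.reg .pos = s.reg .pos ∧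
      Scan G S (s.arr .PC) (seen G (s.arr .PS) lo (s.arr .PS y + 1) G.M) (s'.arr .KK) (s'.arr .TL)
      (s'.reg .tl)) s := by
  have hpsy : ∀ e < G.M, G.live e → (s.arr .PS (G.src e) = s.arr .PS y ↔ G.src e = y) := by
    intro e he hle
    constructor
    · intro h
      rw [← (hst.ps _ (hG.src_lt e he hle)).2, ← (hst.ps y hy).2]
      exact congrArg (s.arr .EM) h
    · intro h; rw [h]
  -- The invariant for `m`: the edges that leave `y` and are not below `m` have been counted.
  have key := wp_while (b := b) (W := W) (c := .reg .e) (s := s) (ι := ℕ)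
    (p := .set .x (.ld .ED (.sub (.reg .e) (.lit 1))) ;;
    .ite (.eq (.ld .PC (.reg .x)) (.reg .s))
      (.ite (.eq (.ld .KK (.reg .x)) (.lit 0))
        (.st .TL (.reg .tl) (.reg .x) ;; .set .tl (.inc (.reg .tl) 1)) .skip ;;
      .st .KK (.reg .x) (.inc (.ld .KK (.reg .x)) 1)) .skip ;;
    .set .e (.ld .NX (.sub (.reg .e) (.lit 1))))
    (fun m s' => m ≤ G.M ∧ IsTop G y m (s'.reg .e) ∧ ScanKeep s s' ∧ s'.reg .pos = s.reg .pos ∧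
      Scan G S (s.arr .PC) (seen G (s.arr .PS) lo (s.arr .PS y) m) (s'.arr .KK) (s'.arr .TL)
        (s'.reg .tl))
    (fun m => 100 * todo G y m + 10) ?_ ?_ (i := G.M) ⟨le_rfl, htop, ⟨Keep.refl s, rfl, rfl, rfl, rfl, rfl⟩, rfl, hsc⟩
  · refine wp.mono key ?_
    rintro t s' ⟨ht, m, ⟨hm, htop', hk, hpos, hsc'⟩, he⟩
    refine ⟨ht, hk, hpos, hsc'.congr fun e he' hle => ?_⟩
    have h0 : ∀ e < m, G.live e → G.src e ≠ y := by
      rcases htop' with ⟨-, h⟩ | ⟨e', -, h, -⟩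
      · exact h
      · simp at he; omega
    have h1 := hpsy e he' hle
    have h2 := h0 e
    unfold seen
    constructor
    · rintro (h3 | h3) <;> left <;> omega
    · rintro (h3 | h3)
      · by_cases h4 : s.arr .PS (G.src e) = s.arr .PS y
        · right
          refine ⟨h4, ?_⟩
          by_contra h5
          exact h2 (by omega) hle (h1.1 h4)
        · left; omega
      · omega
  · intro m s' _
    simp
  · rintro m s' ⟨hm, htop', hk, hpos, hsc'⟩ hne
    simp at hne
    rcases htop' with ⟨h, -⟩ | ⟨e, hem, hee, hle, hse, hno⟩
    · exact absurd h hne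
    have htop'' : IsTop G y m (e + 1) := Or.inr ⟨e, hem, rfl, hle, hse, hno⟩
    have htodo := todo_top htop''
    have hed : s'.arr .ED e = G.dst e := by rw [hk.keep.ed]; exact hl.ed e (by omega) hle
    have hnx : IsTop G y e (s'.arr .NX e) := by
      rw [hk.keep.nx]; have := hl.nx e (by omega) hle; rwa [hse] at this
    have hPC : s'.arr .PC = s.arr .PC := congrArg Pt.PC hk.pt
    have hs' : s'.reg .s = S := hk.rs.trans hS
    have hnot : ¬ seen G (s.arr .PS) lo (s.arr .PS y) m e := by
      rintro (h | h)
      · rw [hse] at h; omega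
      · omega
    have hcong : ∀ e' < G.M, G.live e' →
        (seen G (s.arr .PS) lo (s.arr .PS y) m e' ∨ e' = e ↔
          seen G (s.arr .PS) lo (s.arr .PS y) e e') := by
      intro e' he' hle'
      have h1 := hpsy e' he' hle'
      unfold seen
      constructor
      · rintro ((h2 | h2) | h2)
        · exact Or.inl h2
        · exact Or.inr ⟨h2.1, by omega⟩
        · subst h2; exact Or.inr ⟨h1.2 hse, le_rfl⟩
      · rintro (h2 | h2)
        · exact Or.inl (Or.inl h2)
        · rcases lt_or_ge e' m with h3 | h3
          · right
            by_contra h4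
            exact hno e' h3 (by omega) hle' (h1.1 h2.1)
          · exact Or.inl (Or.inr ⟨h2.1, h3⟩)
    by_cases h1 : s.arr .PC (G.dst e) = S
    · have hc := (hsc'.count (by omega) hle hnot h1).congr hcong
      by_cases h2 : s'.arr .KK (G.dst e) = 0
      · simp [hee, hed, hPC, hs', h1, h2]
        refine ⟨e, ⟨by omega, hnx, ?_, hpos, ?_⟩, by omega⟩
        · obtain ⟨⟨a1, a2, a3, a4, a5, a6, a7⟩, b1, b2, b3, b4, b5⟩ := hk
          constructor
          · constructor <;> simp [*]
          · rw [← b1]; simp [toPt]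
          all_goals simp [*]
        · simpa [h2] using hc
      · simp [hee, hed, hPC, hs', h1, h2]
        refine ⟨e, ⟨by omega, hnx, ?_, hpos, ?_⟩, by omega⟩
        · obtain ⟨⟨a1, a2, a3, a4, a5, a6, a7⟩, b1, b2, b3, b4, b5⟩ := hk
          constructor
          · constructor <;> simp [*]
          · rw [← b1]; simp [toPt]
          all_goals simp [*]
        · simpa [h2] using hc
    · have hc := (hsc'.skip (by omega) hle hnot h1).congr hcong
      simp [hee, hed, hPC, hs', h1]
      refine ⟨e, ⟨by omega, hnx, ?_, hpos, ?_⟩, by omega⟩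
      · obtain ⟨⟨a1, a2, a3, a4, a5, a6, a7⟩, b1, b2, b3, b4, b5⟩ := hk
        constructor
        · constructor <;> simp [*]
        · rw [← b1]; simp [toPt]
        all_goals simp [*]
      · simpa using hc

end Refine

namespace Refine

open Function Classical Imp

/-- The number of nodes in the fine block `B` and of live edges leaving them. -/
noncomputable def Pt.weight (G : Gr) (d : Pt) (B : ℕ) : ℕ :=
  ∑ y ∈ Finset.range G.N with d.BK y = B, (1 + outdeg G y)

theorem Pt.Struc.sum_block {G : Gr} {d : Pt} (h : d.Struc G.N) {B : ℕ} (hB : B < d.nf)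
    (f : ℕ → ℕ) : ∑ p ∈ Finset.Ico (d.BL B) (d.BR B), f (d.EM p) =
      ∑ y ∈ Finset.range G.N with d.BK y = B, f y := by
  refine Finset.sum_nbij' d.EM d.PS ?_ ?_ ?_ ?_ ?_
  · intro p hp
    rw [Finset.mem_Ico] at hp
    obtain ⟨h1, h2⟩ := h.bk_em hB hp.1 hp.2
    simp [h2, (h.em p h1).1]
  · intro y hy
    simp only [Finset.mem_filter, Finset.mem_range] at hy
    have := h.mem y hy.1
    rw [hy.2] at this
    simpa using this
  · intro p hp
    rw [Finset.mem_Ico] at hp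
    exact (h.em p (h.bk_em hB hp.1 hp.2).1).2
  · intro y hy
    simp only [Finset.mem_filter, Finset.mem_range] at hy
    exact (h.ps y hy.1).2
  · intro p _; rfl

section
variable {b W : ℕ} {G : Gr} {s : St}

theorem ScanKeep.trans {s s' s'' : St} (h : ScanKeep s s') (h' : ScanKeep s' s'') :
    ScanKeep s s'' :=
  ⟨h.keep.trans h'.keep, h'.pt.trans h.pt, h'.rs.trans h.rs, h'.rq.trans h.rq, h'.rh.trans h.rh,
    h'.rdir.trans h.rdir⟩

theorem scanBlock_spec {S B : ℕ} (hl : Linked G s)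
    (hst : (toPt s).Struc G.N) (hG : G.WF) (hS : s.reg .s = S) (hB : B < s.reg .nf)
    (hpos : s.reg .pos = s.arr .BL B) (hh : s.reg .h = s.arr .BR B) (htl : s.reg .tl = 0)
    (hkk : ∀ x, s.arr .KK x = 0) :
    wp b W scanBlock (fun t s' => t ≤ 100 * (toPt s).weight G B + 10 ∧ ScanKeep s s' ∧
      Scan G S (s.arr .PC) (fun e => s.arr .BK (G.src e) = B) (s'.arr .KK) (s'.arr .TL)
      (s'.reg .tl)) s := by
  have hle := hst.le B hB
  have hBL : (toPt s).BL B = s.arr .BL B := rfl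
  have hBR : (toPt s).BR B = s.arr .BR B := rfl
  rw [hBL, hBR] at hle
  -- The invariant for `p`: the edges that leave nodes at positions below `p` have been counted.
  have key := wp_while (b := b) (W := W) (c := .lt (.reg .pos) (.reg .h)) (s := s) (ι := ℕ)
    (p := .set .y (.ld .EM (.reg .pos)) ;;
    .set .e (.ld .HD (.reg .y)) ;;
    scanEdges ;;
    .set .pos (.inc (.reg .pos) 1))
    (fun p s' => s.arr .BL B ≤ p ∧ p ≤ s.arr .BR B ∧ s'.reg .pos = p ∧ ScanKeep s s' ∧
      Scan G S (s.arr .PC) (seen G (s.arr .PS) (s.arr .BL B) p G.M) (s'.arr .KK) (s'.arr .TL)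
        (s'.reg .tl))
    (fun p => ∑ p' ∈ Finset.Ico p (s.arr .BR B), 100 * (1 + outdeg G (s.arr .EM p')) + 10) ?_ ?_
    (i := s.arr .BL B)
    ⟨le_rfl, hle, hpos, ⟨Keep.refl s, rfl, rfl, rfl, rfl, rfl⟩, ?_⟩
  · refine wp.mono key ?_
    rintro t s' ⟨ht, p, ⟨h1, h2, h3, h4, h5⟩, h6⟩
    have hrh := h4.rh
    simp at h6
    obtain rfl : p = s.arr .BR B := by omega
    refine ⟨ht.trans ?_, h4, h5.congr fun e he hle => ?_⟩
    · rw [← Finset.mul_sum, Pt.weight, ← hst.sum_block hB]; rfl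
    · have hs := hG.src_lt e he hle
      have hm := hst.mem _ hs
      simp only [seen]
      constructor
      · rintro (h | h)
        · have := (hst.bk_em hB h.1 h.2).2
          rwa [show (toPt s).EM (s.arr .PS (G.src e)) = G.src e from (hst.ps _ hs).2] at this
        · omega
      · intro h
        have h7 : (toPt s).BK (G.src e) = B := h
        rw [h7] at hm
        exact Or.inl hm
  · intro p s' _
    simp
  · rintro p s' ⟨h1, h2, h3, h4, h5⟩ hlt
    have hrh := h4.rh
    have hp : p < s.arr .BR B := by simp at hlt; omega
    obtain ⟨hpN, hbk⟩ := hst.bk_em hB h1 hp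
    have hem := hst.em p hpN
    have hpt := h4.pt
    have hEM : s'.arr .EM = s.arr .EM := congrArg Pt.EM hpt
    have hPS : s'.arr .PS = s.arr .PS := congrArg Pt.PS hpt
    have hPC : s'.arr .PC = s.arr .PC := congrArg Pt.PC hpt
    have hHD : s'.arr .HD = s.arr .HD := h4.keep.hd
    have hyN : s.arr .EM p < G.N := hem.1
    have hyp : s.arr .PS (s.arr .EM p) = p := hem.2
    simp only [wp_seq, wp_set]
    refine ⟨by simp, by simp, ?_⟩
    set s1 := (s'.setR .y ((Ex.ld .EM (.reg .pos)).eval s')).setR .e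
      ((Ex.ld .HD (.reg .y)).eval (s'.setR .y ((Ex.ld .EM (.reg .pos)).eval s'))) with hs1
    have hk1 : ScanKeep s s1 := by
      obtain ⟨⟨a1, a2, a3, a4, a5, a6, a7⟩, b1, b2, b3, b4, b5⟩ := h4
      constructor
      · constructor <;> simp [*]
      · rw [← b1]; simp [toPt, hs1]
      all_goals simp [*]
    have he1 : s1.reg .e = s.arr .HD (s.arr .EM p) := by simp [hs1, h3, hEM, hHD]
    have hpt1 := hk1.pt
    have hsp := scanEdges_spec (b := b) (W := W) (lo := s.arr .BL B) (s := s1)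
      (hk1.keep.linked hl) (by rw [hpt1]; exact hst) hG (hk1.rs.trans hS) hyN
      (by rw [show s1.arr .PS = s.arr .PS from congrArg Pt.PS hpt1, hyp]; exact h1)
      (by rw [he1]; exact hl.hd _ hyN)
      (by
        rw [show s1.arr .PS = s.arr .PS from congrArg Pt.PS hpt1, hyp,
          show s1.arr .PC = s.arr .PC from congrArg Pt.PC hpt1]
        simpa [hs1] using h5)
    refine hsp.mono ?_
    rintro t s2 ⟨ht, hk2, hp2, hsc⟩
    rw [show s1.arr .PS = s.arr .PS from congrArg Pt.PS hpt1, hyp,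
          show s1.arr .PC = s.arr .PC from congrArg Pt.PC hpt1] at hsc
    have hk3 := hk1.trans hk2
    have hpos2 : s2.reg .pos = p := by rw [hp2]; simp [hs1, h3]
    simp only [hpos2, Ex.eval, Ex.Ok, Ex.cost]
    refine ⟨trivial, p + 1, ⟨by omega, by omega, by simp, ?_, ?_⟩, ?_⟩
    · obtain ⟨⟨a1, a2, a3, a4, a5, a6, a7⟩, b1, b2, b3, b4, b5⟩ := hk3
      constructor
      · constructor <;> simp [*]
      · rw [← b1]; simp [toPt]
      all_goals simp [*]
    · exact hsc
    · rw [Finset.sum_eq_sum_Ico_succ_bot hp]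
      omega
  · rw [htl, funext hkk]
    constructor
    · intro x
      split
      · rw [eq_comm, indeg, Finset.card_eq_zero, Finset.filter_eq_empty_iff]
        rintro e he ⟨h1, -, h3⟩
        rw [Finset.mem_range] at he
        unfold seen at h3
        have hs := hG.src_lt e he h1
        omega
      · rfl
    all_goals simp

theorem twinCmd_spec {F q dir : ℕ} (hf : s.reg .f = F) (hq : s.reg .q = q)
    (hd : s.reg .dir = dir) :
    wp b W twinCmd (fun t s' => t ≤ 100 ∧ Keep s s' ∧ toPt s' = (toPt s).twin F q dir ∧
      s'.arr .KK = s.arr .KK ∧ s'.arr .TL = s.arr .TL ∧ ∀ r, r ≠ .z → r ≠ .nf → r ≠ .sp →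
        s'.reg r = s.reg r) s := by
  by_cases h1 : s.arr .TS F = q
  · simp [twinCmd, hf, hq, h1, toPt, Pt.twin]
    exact Keep.refl s
  · by_cases h2 : dir = 0
    · simp [twinCmd, hf, hq, hd, h1, h2, toPt, Pt.twin]
      refine ⟨by constructor <;> simp, by grind⟩
    · simp [twinCmd, hf, hq, hd, h1, h2, toPt, Pt.twin]
      refine ⟨by constructor <;> simp, by grind⟩

theorem moveCmd_spec {x q dir : ℕ} (hx : s.reg .x = x) (hq : s.reg .q = q)
    (hd : s.reg .dir = dir) (hf : s.reg .f = s.arr .BK x) :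
    wp b W moveCmd (fun t s' => t ≤ 150 ∧ Keep s s' ∧ toPt s' = (toPt s).move x q dir ∧
      s'.arr .KK = s.arr .KK ∧ s'.arr .TL = s.arr .TL ∧ ∀ r, r ≠ .z → r ≠ .y → r ≠ .pos → r ≠ .g →
        s'.reg r = s.reg r) s := by
  by_cases h2 : dir = 0
  · simp [moveCmd, hx, hq, hd, hf, h2, toPt, Pt.move]
    refine ⟨by constructor <;> simp, by grind⟩
  · simp [moveCmd, hx, hq, hd, hf, h2, toPt, Pt.move]
    refine ⟨by constructor <;> simp, by grind⟩

end

end Refine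

namespace Refine

open Function Classical Imp

/-! ### Moving the nodes -/

theorem Pt.twin_bk (d : Pt) (F q dir : ℕ) : (d.twin F q dir).BK = d.BK := by
  unfold Pt.twin; split <;> rfl

theorem Pt.twin_cn (d : Pt) (F q dir : ℕ) : (d.twin F q dir).CN = d.CN := by
  unfold Pt.twin; split <;> rfl

theorem Pt.twin_sp (d : Pt) (F q dir : ℕ) : (d.twin F q dir).sp ≤ d.sp + 1 := by
  unfold Pt.twin; split <;> simp

theorem Mid.setCN {N : ℕ} {d₀ d : Pt} {q dir : ℕ} {mv : ℕ → Prop} (h : Mid N d₀ q dir mv d)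
    (c : ℕ → ℕ) : Mid N d₀ q dir mv { d with CN := c } :=
  ⟨h.em, h.ps, h.cl, h.cr, h.nc, h.nf, h.unm, h.mvd, h.mem, h.tw, h.ntw, h.bc, h.inj, h.cover,
    h.ts, h.tsn, h.sp, h.st, h.stk⟩

theorem Mid.congr {N : ℕ} {d₀ d : Pt} {q dir : ℕ} {mv mv' : ℕ → Prop} (h : Mid N d₀ q dir mv d)
    (he : ∀ x, mv x ↔ mv' x) : Mid N d₀ q dir mv' d := by
  rwa [← funext fun x => propext (he x)]

theorem Pt.deg_eq_indeg (G : Gr) (d : Pt) (B x : ℕ) :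
    d.deg G B x = indeg G (fun e => d.BK (G.src e) = B) x := by
  unfold Pt.deg indeg
  congr 1
  ext e
  simp

theorem wins_iff (G : Gr) (dir x : ℕ) : ltN x G.L = eqN dir 0 ↔ G.wins dir x := by
  unfold ltN eqN Gr.wins
  split <;> split <;> simp [*]

theorem indeg_pos {G : Gr} {P : ℕ → Prop} {x : ℕ} (hG : G.WF) (h : 0 < indeg G P x) :
    x < G.N := by
  obtain ⟨e, he⟩ := Finset.card_pos.1 h
  simp only [Finset.mem_filter, Finset.mem_range] at he
  obtain ⟨he, hl, rfl, -⟩ := he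
  exact hG.dst_lt e he hl

section
variable {b W : ℕ} {G : Gr} {Bef : ℕ → ℕ → Prop} {s : St} {d : Pt} {S B dir : ℕ}

/-- After a scan of the edges that leave `B`, the touched nodes are moved or have their counts
reduced, and a round is complete. -/
theorem moveAll_spec (hG : G.WF) (hR : RInv G Bef d) (hc : CutOff d S B dir)
    (hs : toPt s = d.cut S B dir) (hq : s.reg .q = d.nc) (hdir : s.reg .dir = dir)
    (hlen : s.reg .len = G.L) (hi : s.reg .i = 0)
    (hsc : Scan G S d.PC (fun e => d.BK (G.src e) = B) (s.arr .KK) (s.arr .TL) (s.reg .tl)) :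
    wp b W moveAll (fun t s' => t ≤ 500 * s.reg .tl + 10 ∧ Keep s s' ∧
      Round G d S B dir (toPt s') ∧ (∀ x, s'.arr .KK x = 0) ∧ s'.reg .sp ≤ d.sp + s.reg .tl) s := by
  have h₀ := hc.cut_struc hR.toStruc
  have hkk : ∀ x, s.arr .KK x = if d.PC x = S then d.deg G B x else 0 := by
    intro x; rw [hsc.kk x, Pt.deg_eq_indeg]
  have htl : ∀ j < s.reg .tl, d.PC (s.arr .TL j) = S ∧ 0 < d.deg G B (s.arr .TL j) ∧
      s.arr .TL j < G.N := by
    intro j hj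
    have h1 := hsc.pos j hj
    rw [hkk] at h1
    split at h1
    · next h2 => exact ⟨h2, h1, by rw [Pt.deg_eq_indeg] at h1; exact indeg_pos hG h1⟩
    · omega
  have hcn0 : s.arr .CN = d.CN := congrArg Pt.CN hs
  -- After `i` steps, the first `i` touched nodes have been treated: those to be moved are in their new
  -- blocks, and the counts are updated.
  have key := wp_while (b := b) (W := W) (c := .lt (.reg .i) (.reg .tl)) (s := s) (ι := ℕ)
    (p := .set .x (.ld .TL (.reg .i)) ;;
    .set .k (.ld .KK (.reg .x)) ;;
    .st .KK (.reg .x) (.lit 0) ;;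
    .ite (.and (.eq (.eq (.lt (.reg .x) (.reg .len)) (.eq (.reg .dir) (.lit 0))) (.lit 0))
        (.lt (.reg .k) (.ld .CN (.reg .x))))
      (.st .CN (.reg .x) (.sub (.ld .CN (.reg .x)) (.reg .k)))
      (.st .CN (.reg .x) (.reg .k) ;; .set .f (.ld .BK (.reg .x)) ;; twinCmd ;; moveCmd) ;;
    .set .i (.inc (.reg .i) 1))
    (fun i s' => i ≤ s.reg .tl ∧ s'.reg .i = i ∧ s'.reg .tl = s.reg .tl ∧ s'.reg .q = d.nc ∧
      s'.reg .dir = dir ∧ Keep s s' ∧ s'.arr .TL = s.arr .TL ∧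
      Mid G.N (d.cut S B dir) d.nc dir
        (fun x => d.moved G S B dir x ∧ ∃ j < i, s.arr .TL j = x) (toPt s') ∧
      (∀ x, s'.arr .CN x = if ∃ j < i, s.arr .TL j = x then
        (if d.moved G S B dir x then d.deg G B x else d.CN x - d.deg G B x) else d.CN x) ∧
      (∀ x, s'.arr .KK x = if ∃ j < i, s.arr .TL j = x then 0 else s.arr .KK x) ∧
      s'.reg .sp ≤ d.sp + i)
    (fun i => 500 * (s.reg .tl - i) + 10) ?_ ?_ (i := 0) ?_
  · refine wp.mono key ?_
    rintro t s' ⟨ht, i, ⟨h1, h2, h3, h4, h5, h6, h7, h8, h9, h10, h11⟩, h12⟩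
    simp at h12
    obtain rfl : i = s.reg .tl := by omega
    have hall : ∀ x, d.moved G S B dir x → ∃ j < s.reg .tl, s.arr .TL j = x := by
      intro x hx
      apply hsc.all
      rw [hkk, if_pos hx.1]
      exact hx.2.1
    have hm8 := h8.congr (mv' := d.moved G S B dir) fun x => ⟨fun h => h.1, fun h => ⟨h, hall x h⟩⟩
    refine ⟨by omega, h6, Mid.round hR hc hm8 ?_, ?_, h11⟩
    · intro x hx
      rw [show (toPt s').CN x = s'.arr .CN x from rfl, h9 x]
      by_cases hm : d.moved G S B dir x
      · simp only [hm, if_true, hall x hm]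
      · simp only [hm, if_false]
        by_cases hS : d.PC x = S
        · rw [if_pos hS]
          split
          · rfl
          · next hn =>
            have : d.deg G B x = 0 := by
              by_contra h0
              exact hn (hsc.all x (by rw [hkk, if_pos hS]; omega))
            omega
        · rw [if_neg hS, if_neg]
          rintro ⟨j, hj, rfl⟩
          exact hS (htl j hj).1
    · intro x
      rw [h10 x]
      split
      · rfl
      · next hn =>
        by_contra h0
        exact hn (hsc.all x (by omega))
  · intro i s' _
    simp
  · rintro i s' ⟨h1, h2, h3, h4, h5, h6, h7, h8, h9, h10, h11⟩ hlt
    have hi : i < s.reg .tl := by simp at hlt; omega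
    obtain ⟨x, hx⟩ : ∃ x, x = s.arr .TL i := ⟨_, rfl⟩
    obtain ⟨hPC, hdeg, hxN⟩ := htl i hi
    rw [← hx] at hPC hdeg hxN
    have hnew : ¬ ∃ j < i, s.arr .TL j = x := by
      rintro ⟨j, hj, hjx⟩
      have := hsc.inj j (by omega) i hi (by rw [hjx, hx])
      omega
    have hcnx : s'.arr .CN x = d.CN x := by rw [h9 x, if_neg hnew]
    have hkx : s'.arr .KK x = d.deg G B x := by rw [h10 x, if_neg hnew, hkk x, if_pos hPC]
    have hTLi : s'.arr .TL i = x := by rw [h7, hx]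
    have hex : ∀ y, (∃ j < i + 1, s.arr .TL j = y) ↔ (∃ j < i, s.arr .TL j = y) ∨ y = x := by
      intro y
      constructor
      · rintro ⟨j, hj, hjy⟩
        rcases Nat.lt_succ_iff_lt_or_eq.1 hj with h | h
        · exact Or.inl ⟨j, h, hjy⟩
        · right; rw [← hjy, h, hx]
      · rintro (⟨j, hj, hjy⟩ | rfl)
        · exact ⟨j, by omega, hjy⟩
        · exact ⟨i, by omega, hx.symm⟩
    have hKK' : ∀ y, update (s'.arr .KK) x 0 y =
        if ∃ j < i + 1, s.arr .TL j = y then 0 else s.arr .KK y := by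
      intro y
      rw [update_apply, h10 y]
      simp only [hex]
      by_cases hy : y = x <;> simp [hy]
    have hlen' : s'.reg .len = G.L := h6.len.trans hlen
    have hwin := wins_iff G dir x
    have hdle := Pt.deg_le hR hc hxN hPC
    by_cases hm : d.moved G S B dir x
    · -- the node is moved
      have hcond : ltN x G.L = eqN dir 0 ∨ d.CN x ≤ d.deg G B x := by
        rw [hwin]
        rcases hm.2.2 with h | h
        · exact Or.inl h
        · exact Or.inr h.ge
      have hbk : d.BK x = (toPt s').BK x := (h8.unm x hxN (by simp [hnew])).1.symm
      simp only [wp_seq, wp_set, wp_st, wp_ite, Ex.Ok, Ex.eval, Ex.cost, St.setR_reg, St.setR_arr,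
        St.setA_arr, St.setA_reg, h2, hTLi, hkx, reduceCtorEq, if_true, if_false, true_and,
        ne_eq, hlen', h5, hcnx, andN_eq_zero, eqN_eq_zero, ltN_eq_zero, not_not, not_or]
      refine ⟨fun h => ?_, fun _ => ?_⟩
      · exfalso
        rcases hcond with h' | h'
        · exact h.1 h'
        · exact h.2 h'
      · refine (twinCmd_spec (F := d.BK x) (q := d.nc) (dir := dir) (by simp [hbk, toPt])
          (by simp [h4]) (by simp [h5])).mono ?_
        rintro t2 s2 ⟨ht2, hk2, hp2, hkk2, htl2, hr2⟩
        have e1 : s2.reg .x = x := by rw [hr2] <;> simp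
        have e2 : s2.reg .q = d.nc := by rw [hr2] <;> simp [h4]
        have e3 : s2.reg .dir = dir := by rw [hr2] <;> simp [h5]
        have e4 : s2.reg .f = s2.arr .BK x := by
          rw [show s2.arr .BK = (toPt s2).BK from rfl, hp2, Pt.twin_bk, hr2] <;> simp [toPt]
        refine (moveCmd_spec e1 e2 e3 e4).mono ?_
        rintro t3 s3 ⟨ht3, hk3, hp3, hkk3, htl3, hr3⟩
        refine ⟨i + 1, ⟨by omega, ?_, ?_, ?_, ?_, ?_, ?_, ?_, ?_, ?_, ?_⟩, ?_⟩
        · rw [hr3 _ (by simp) (by simp) (by simp) (by simp), hr2 _ (by simp) (by simp) (by simp)]; simp [h2]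
        · rw [hr3 _ (by simp) (by simp) (by simp) (by simp), hr2 _ (by simp) (by simp) (by simp)]; simp [h3]
        · rw [hr3 _ (by simp) (by simp) (by simp) (by simp), e2]
        · rw [hr3 _ (by simp) (by simp) (by simp) (by simp), e3]
        · refine h6.trans (Keep.trans ?_ (hk2.trans (hk3.trans ?_)))
          · constructor <;> simp
          · constructor <;> simp
        · rw [htl3, htl2]; simp [h7]
        · have hA : toPt (s3.setR .i (s3.reg .i + 1)) = toPt s3 := by simp [toPt]
          rw [hA, hp3, hp2]
          have hM := (h8.setCN (update (s'.arr .CN) x (d.deg G B x))).twin h₀ (h₀.bk x hxN)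
          have hM2 := Mid.move hM.1 h₀ hxN (by simp [hnew]) hM.2
          refine Mid.congr (Eq.mp ?_ hM2) ?_ (mv := fun y => (d.moved G S B dir y ∧ ∃ j < i, s.arr .TL j = y) ∨ y = x)
          · congr 2
          · intro y
            rw [hex y]
            constructor
            · rintro (h | rfl)
              · exact ⟨h.1, Or.inl h.2⟩
              · exact ⟨hm, Or.inr rfl⟩
            · rintro ⟨h, h' | h'⟩
              · exact Or.inl ⟨h, h'⟩
              · exact Or.inr h'
        · intro y
          have hCN : s3.arr .CN = update (s'.arr .CN) x (d.deg G B x) := by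
            rw [show s3.arr .CN = (toPt s3).CN from rfl, hp3]
            show (toPt s2).CN = _
            rw [hp2, Pt.twin_cn]
            simp [toPt]
          rw [hCN, update_apply]
          simp only [hex]
          by_cases hy : y = x
          · simp [hy, hm]
          · simp [hy, h9 y]
        · intro y
          rw [hkk3, hkk2, ← hKK' y]
          simp
        · have hsp : s3.reg .sp ≤ s'.reg .sp + 1 := by
            rw [show s3.reg .sp = (toPt s3).sp from rfl, hp3]
            show (toPt s2).sp ≤ _
            rw [hp2]
            refine (Pt.twin_sp _ _ _ _).trans ?_
            simp [toPt]
          omega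
        · omega
    · -- the node stays
      have hnw : ¬ ltN x G.L = eqN dir 0 := by
        rw [hwin]; exact fun h => hm ⟨hPC, hdeg, Or.inl h⟩
      have hlt' : ¬ d.CN x ≤ d.deg G B x := fun h => hm ⟨hPC, hdeg, Or.inr (by omega)⟩
      simp only [wp_seq, wp_set, wp_st, wp_ite, Ex.Ok, Ex.eval, Ex.cost, St.setR_reg, St.setR_arr,
        St.setA_arr, St.setA_reg, h2, hTLi, hkx, reduceCtorEq, if_true, if_false, true_and,
        ne_eq, hlen', h5, hcnx, andN_eq_zero, eqN_eq_zero, ltN_eq_zero, not_not, not_or]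
      refine ⟨fun _ => ?_, fun h => ?_⟩
      rotate_left
      · rcases h with h | h
        · exact absurd h hnw
        · exact absurd h hlt'
      refine ⟨i + 1, ⟨by omega, rfl, h3, h4, ?_, h7, ?_, ?_, hKK', by omega⟩, by omega⟩
      · obtain ⟨a1, a2, a3, a4, a5, a6, a7⟩ := h6
        constructor <;> simp [*]
      · have hM := h8.setCN (update (s'.arr .CN) x (d.CN x - d.deg G B x))
        refine Mid.congr (Eq.mp ?_ hM) ?_ (mv := fun y => d.moved G S B dir y ∧ ∃ j < i, s.arr .TL j = y)
        · congr 1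
        · intro y
          rw [hex y]
          constructor
          · rintro ⟨h, h'⟩
            exact ⟨h, Or.inl h'⟩
          · rintro ⟨h, h' | rfl⟩
            · exact ⟨h, h'⟩
            · exact absurd h hm
      · intro y
        rw [update_apply]
        simp only [hex]
        by_cases hy : y = x
        · simp [hy, hm]
        · simp [hy, h9 y]
  · refine ⟨by omega, hi, rfl, hq, hdir, Keep.refl s, rfl, ?_, ?_, ?_, ?_⟩
    · rw [hs]
      refine (Mid.init h₀ hR.ts ?_).congr (by simp)
      intro i hi
      have := hR.stk i hi
      show d.ST i < d.nc + 1
      omega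
    · intro x; simp [hcn0]
    · intro x; simp
    · rw [show s.reg .sp = (toPt s).sp from rfl, hs]
      exact le_rfl

end
end Refine

namespace Refine

open Function Classical Imp

/-! ### The amortized cost of the refinement -/

/-- The potential: each node and each live edge pays once whenever the size of the coarse block of
its source is halved. -/
noncomputable def Pt.pot (G : Gr) (d : Pt) : ℕ :=
  ∑ y ∈ Finset.range G.N, (1 + outdeg G y) * Nat.log 2 (d.CR (d.co y) - d.CL (d.co y))

section
variable {G : Gr} {Bef : ℕ → ℕ → Prop} {d d' : Pt} {S B dir : ℕ}

/-- Cutting off a block of at most half the size of `S` lowers the potential by the weight of the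
block: the size of the coarse block of each of its nodes is halved. -/
theorem Round.pot_le (hr : Round G d S B dir d') (hc : CutOff d S B dir) (hst : d.Struc G.N)
    (hhalf : 2 * (d.BR B - d.BL B) ≤ d.CR S - d.CL S) :
    d'.pot G + d.weight G B ≤ d.pot G := by
  unfold Pt.pot Pt.weight
  rw [Finset.sum_filter, ← Finset.sum_add_distrib]
  apply Finset.sum_le_sum
  intro y hy
  rw [Finset.mem_range] at hy
  by_cases hB : d.BK y = B
  · rw [if_pos hB, hr.co y hy, if_pos hB, hr.cl_new, hr.cr_new]
    rw [show d.co y = S by rw [Pt.co, hB, hc.hBS]]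
    have hlt := hc.lt
    have h1 : Nat.log 2 (d.BR B - d.BL B) + 1 ≤ Nat.log 2 (d.CR S - d.CL S) := by
      rw [← Nat.log_mul_base (by omega) (by omega)]
      exact Nat.log_mono_right (by omega)
    calc _ = (1 + outdeg G y) * (Nat.log 2 (d.BR B - d.BL B) + 1) := by ring
      _ ≤ _ := Nat.mul_le_mul_left _ h1
  · rw [if_neg hB, add_zero, hr.co y hy, if_neg hB]
    apply Nat.mul_le_mul_left
    apply Nat.log_mono_right
    have hco := hst.co_lt hy
    by_cases hS : d.co y = S
    · have h1 := hc.first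
      have h2 := hc.last
      have hlt := hc.lt
      rw [hS, hr.cl_S, hr.cr_S]
      by_cases hd : dir = 0
      · simp [hd] at h1 ⊢; omega
      · simp [hd] at h2 ⊢; omega
    · rw [hr.cl _ hco hS, hr.cr _ hco hS]

theorem nlive_le_weight (hG : G.WF) :
    nlive G (fun e => d.BK (G.src e) = B) ≤ d.weight G B := by
  unfold nlive Pt.weight outdeg
  rw [Finset.card_eq_sum_card_fiberwise (f := G.src) (t := {y ∈ Finset.range G.N | d.BK y = B})]
  · apply Finset.sum_le_sum
    intro y _
    refine le_trans (Finset.card_le_card ?_) (Nat.le_add_left _ _)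
    intro e
    simp only [Finset.mem_filter, Finset.mem_range]
    rintro ⟨⟨h1, h2, -⟩, h3⟩
    exact ⟨h1, h2, h3⟩
  · intro e he
    simp only [Finset.coe_filter, Finset.mem_range, Set.mem_ofPred_eq] at he ⊢
    exact ⟨hG.src_lt e he.1 he.2.1, he.2.2⟩

theorem CutOff.weight_pos (hc : CutOff d S B dir) (hst : d.Struc G.N) : 0 < d.weight G B := by
  obtain ⟨h1, h2⟩ := hst.bk_em hc.hB le_rfl hc.lt
  refine lt_of_lt_of_le ?_ (Finset.single_le_sum (f := fun y => 1 + outdeg G y) (by simp)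
    (a := d.EM (d.BL B)) ?_)
  · omega
  · simp [h2, (hst.em _ h1).1]

/-- The first and the last fine block of a coarse block. -/
theorem Pt.Struc.first_last (hst : d.Struc G.N) (hS : S < d.nc) :
    let F := d.BK (d.EM (d.CL S)); let F' := d.BK (d.EM (d.CR S - 1))
    F < d.nf ∧ F' < d.nf ∧ d.BC F = S ∧ d.BC F' = S ∧ d.BL F = d.CL S ∧ d.BR F' = d.CR S ∧
      d.BL F < d.BR F ∧ d.BL F' < d.BR F' ∧ (F ≠ F' → d.BR F ≤ d.BL F') := by
  intro F F'
  have h1 := hst.cne S hS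
  obtain ⟨h2, h3⟩ := hst.co_em hS le_rfl h1.1
  obtain ⟨h4, h5⟩ := hst.co_em hS (p := d.CR S - 1) (by omega) (by omega)
  have e1 := hst.em _ h2
  have e2 := hst.em _ h4
  have m1 := hst.mem _ e1.1
  have m2 := hst.mem _ e2.1
  rw [e1.2] at m1
  rw [e2.2] at m2
  have s1 := hst.sub _ (hst.bk _ e1.1) (by omega)
  have s2 := hst.sub _ (hst.bk _ e2.1) (by omega)
  have c1 : d.BC F = S := h3
  have c2 : d.BC F' = S := h5
  rw [show d.BC (d.BK (d.EM (d.CL S))) = S from h3] at s1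
  rw [show d.BC (d.BK (d.EM (d.CR S - 1))) = S from h5] at s2
  have f1 : F < d.nf := hst.bk _ e1.1
  have f2 : F' < d.nf := hst.bk _ e2.1
  have f3 : F ≠ F' → d.BL F ≠ d.BL F' := hst.bl_ne e1.1 e2.1
  have f4 : d.BL F < d.BL F' → d.BR F ≤ d.BL F' := hst.br_le e1.1 e2.1
  change d.BL F ≤ _ ∧ _ < d.BR F at m1
  change d.BL F' ≤ _ ∧ _ < d.BR F' at m2
  change d.CL S ≤ d.BL F ∧ d.BR F ≤ d.CR S at s1
  change d.CL S ≤ d.BL F' ∧ d.BR F' ≤ d.CR S at s2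
  refine ⟨f1, f2, c1, c2, by omega, by omega, by omega, by omega, fun hne => ?_⟩
  have := f3 hne
  exact f4 (by omega)

/-- A coarse block that is a single fine block can be dropped from the stack. -/
theorem RInv.pop (hR : RInv G Bef d) {i : ℕ} (hi : d.sp = i + 1)
    (he : d.BK (d.EM (d.CL (d.ST i))) = d.BK (d.EM (d.CR (d.ST i) - 1))) :
    RInv G Bef { d with sp := i } := by
  have hst := hR.toStruc
  refine ⟨⟨hst.em, hst.ps, hst.bk, hst.mem, hst.disj, hst.bc, hst.le, hst.sub, hst.cdisj, hst.cne⟩,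
    hR.key, hR.same, hR.pc, hR.pc0, hR.cn, hR.cnpos, hR.bmin, hR.bmax, hR.bef, ?_, ?_, hR.ts⟩
  · intro x hx y hy hco hne
    obtain ⟨j, hj, hjc⟩ := hR.comp x hx y hy hco hne
    refine ⟨j, ?_, hjc⟩
    by_contra hji
    obtain rfl : j = i := by dsimp only at hji; omega
    have h0 := hst.first_last (hR.stk j hj)
    rw [← he] at h0
    obtain ⟨h1, -, -, -, h2, h3, -⟩ := h0
    have hall : ∀ z < G.N, d.co z = d.ST j → d.BK z = d.BK (d.EM (d.CL (d.ST j))) := by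
      intro z hz hzc
      have := hst.co_mem hz
      rw [hzc] at this
      have h4 := hst.bk_em h1 (p := d.PS z) (by omega) (by omega)
      rw [(hst.ps z hz).2] at h4
      exact h4.2
    exact hne ((hall x hx hjc.symm).trans (hall y hy (hco.symm.trans hjc.symm)).symm)
  · intro j hj
    exact hR.stk j (by dsimp only at hj; omega)

variable {b W : ℕ} {s : St}

theorem cutCmd_spec (hB : s.reg .g = B) (hS : s.reg .s = S) (hd : s.reg .dir = dir) :
    wp b W cutCmd (fun t s' => t ≤ 120 ∧ toPt s' = (toPt s).cut S B dir ∧ Keep s s' ∧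
      s'.reg .q = s.reg .nc ∧ s'.reg .pos = s.arr .BL B ∧ s'.reg .h = s.arr .BR B ∧
      s'.reg .s = S ∧ s'.reg .dir = dir ∧ s'.arr .KK = s.arr .KK) s := by
  by_cases h2 : dir = 0
  · simp [cutCmd, hB, hS, hd, h2, toPt, Pt.cut]
    constructor <;> simp
  · simp [cutCmd, hB, hS, hd, h2, toPt, Pt.cut]
    constructor <;> simp

/-- The cost of a round is at most a constant times the weight of the block that is cut off, which the
potential pays for; the stack pays for the coarse blocks that are dropped from it. -/
theorem refineCmd_spec (hG : G.WF) (hB : G.Closed Bef) (hl : Linked G s)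
    (hR : RInv G Bef (toPt s)) (hkk : ∀ x, s.arr .KK x = 0) :
    wp b W refineCmd (fun t s' => t ≤ 2000 * (toPt s).pot G + 200 * s.reg .sp + 10 ∧ Keep s s' ∧
      RInv G Bef (toPt s') ∧ s'.reg .sp = 0) s := by
  have key := wp_while (b := b) (W := W) (c := .reg .sp) (s := s) (ι := Pt)
    (p := .set .s (.ld .ST (.sub (.reg .sp) (.lit 1))) ;;
    .set .f (.ld .BK (.ld .EM (.ld .CL (.reg .s)))) ;;
    .set .g (.ld .BK (.ld .EM (.sub (.ld .CR (.reg .s)) (.lit 1)))) ;;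
    .ite (.eq (.reg .f) (.reg .g)) (.set .sp (.sub (.reg .sp) (.lit 1)))
      (.set .dir (.lt (.sub (.ld .BR (.reg .g)) (.ld .BL (.reg .g)))
        (.sub (.ld .BR (.reg .f)) (.ld .BL (.reg .f)))) ;;
      .ite (.eq (.reg .dir) (.lit 0)) (.set .g (.reg .f)) .skip ;;
      cutCmd ;;
      .set .tl (.lit 0) ;;
      scanBlock ;;
      .set .i (.lit 0) ;;
      moveAll))
    (fun d s' => toPt s' = d ∧ RInv G Bef d ∧ Keep s s' ∧ ∀ x, s'.arr .KK x = 0)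
    (fun d => 2000 * d.pot G + 200 * d.sp + 10) ?_ ?_ (i := toPt s) ?_
  · refine wp.mono key ?_
    rintro t s' ⟨ht, d, ⟨rfl, h2, h3, h4⟩, h5⟩
    exact ⟨ht, h3, h2, h5⟩
  · intro d s' _; simp
  · rintro d s' ⟨rfl, h2, h3, h4⟩ hne
    obtain ⟨i, hi⟩ : ∃ i, s'.reg .sp = i + 1 := Nat.exists_eq_succ_of_ne_zero hne
    have hi' : (toPt s').sp = i + 1 := hi
    obtain ⟨S, hS⟩ : ∃ S, S = s'.arr .ST i := ⟨_, rfl⟩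
    have hSnc : S < (toPt s').nc := by rw [hS]; exact h2.stk i (by omega)
    obtain ⟨F, hF⟩ : ∃ F, F = s'.arr .BK (s'.arr .EM (s'.arr .CL S)) := ⟨_, rfl⟩
    obtain ⟨F', hF'⟩ : ∃ F', F' = s'.arr .BK (s'.arr .EM (s'.arr .CR S - 1)) := ⟨_, rfl⟩
    have hfl := h2.toStruc.first_last hSnc
    rw [show (toPt s').BK ((toPt s').EM ((toPt s').CL S)) = F from hF.symm,
      show (toPt s').BK ((toPt s').EM ((toPt s').CR S - 1)) = F' from hF'.symm] at hfl
    obtain ⟨f1, f2, f3, f4, f5, f6, f7, f8, f9⟩ := hfl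
    simp only [wp_seq, wp_set, wp_ite, Ex.Ok, Ex.eval, Ex.cost, St.setR_reg, St.setR_arr,
        hi, Nat.add_sub_cancel, ← hS, ← hF, ← hF', reduceCtorEq, if_true, if_false, true_and, and_true,
        ne_eq, eqN_eq_zero, not_not]
    refine ⟨fun hFF => ?_, fun hFF => ?_⟩
    · refine ⟨_, ⟨rfl, ?_, ?_, by simpa using h4⟩, ?_⟩
      · have := h2.pop hi' (by
          rw [show (toPt s').ST i = S from hS.symm]
          exact hF.symm.trans (hFF.trans hF'))
        convert this using 1
        simp [toPt]
      · refine h3.trans ?_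
        constructor <;> simp
      · rw [hi']
        have : (toPt (((((s'.setR .s S).setR .f F).setR .g F').setR .sp i))).pot G =
          (toPt s').pot G := by
          unfold Pt.pot Pt.co; simp [toPt]
        rw [this]
        have : (toPt (((((s'.setR .s S).setR .f F).setR .g F').setR .sp i))).sp = i := by simp [toPt]
        rw [this]
        omega
    · have f10 := f9 hFF
      obtain ⟨dir, hdir⟩ : ∃ dir, dir = ltN (s'.arr .BR F' - s'.arr .BL F')
        (s'.arr .BR F - s'.arr .BL F) := ⟨_, rfl⟩
      obtain ⟨B, hBd⟩ : ∃ B, B = if dir = 0 then F else F' := ⟨_, rfl⟩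
      have hd0 : dir = 0 ↔ (toPt s').BR F - (toPt s').BL F ≤ (toPt s').BR F' - (toPt s').BL F' := by
        rw [hdir, ltN_eq_zero]; rfl
      have hlast := h2.toStruc.sub F' f2 f8
      rw [f4] at hlast
      have hcut : CutOff (toPt s') S B dir := by
        refine ⟨hSnc, ?_, ?_, ?_, ?_, ?_⟩
        · rw [hBd]; split <;> assumption
        · rw [hBd]; split <;> assumption
        · rw [hBd]; split <;> assumption
        · intro hd; rw [hBd, if_pos hd]; omega
        · intro hd; rw [hBd, if_neg hd]; omega
      -- The smaller one of two disjoint blocks within `S` has at most half the size of `S`.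
      have hhalf : 2 * ((toPt s').BR B - (toPt s').BL B) ≤ (toPt s').CR S - (toPt s').CL S := by
        rw [hBd]
        by_cases hd : dir = 0
        · rw [if_pos hd]
          have := hd0.1 hd; omega
        · rw [if_neg hd]
          have : ¬ _ := fun h => hd (hd0.2 h)
          omega
      -- the state before the cut
      obtain ⟨s1, hs1⟩ : ∃ s1, s1 = if dir = 0 then
        ((((s'.setR .s S).setR .f F).setR .g F').setR .dir dir).setR .g F else
        ((((s'.setR .s S).setR .f F).setR .g F').setR .dir dir) := ⟨_, rfl⟩
      have hpt1 : toPt s1 = toPt s' := by rw [hs1]; split <;> simp [toPt]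
      have hk1 : Keep s' s1 := by
        rw [hs1]
        split
        all_goals constructor <;> simp
      have hs1S : s1.reg .s = S := by rw [hs1]; split <;> simp
      have hs1g : s1.reg .g = B := by rw [hs1, hBd]; split <;> simp
      have hs1d : s1.reg .dir = dir := by rw [hs1]; split <;> simp
      have hs1k : s1.arr .KK = s'.arr .KK := by rw [hs1]; split <;> simp
      have hmain : wp b W (cutCmd ;; .set .tl (.lit 0) ;; scanBlock ;; .set .i (.lit 0) ;; moveAll)
          (fun t s'' => ∃ d', (toPt s'' = d' ∧ RInv G Bef d' ∧ Keep s s'' ∧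
            ∀ x, s''.arr .KK x = 0) ∧
            t + 200 + (2000 * d'.pot G + 200 * d'.sp + 10) ≤
              2000 * (toPt s').pot G + 200 * (toPt s').sp + 10) s1 := by
        rw [wp_seq]
        refine (cutCmd_spec hs1g hs1S hs1d).mono ?_
        rintro t2 s2 ⟨ht2, hp2, hk2, hq2, hpos2, hh2, hS2, hd2, hkk2⟩
        rw [hpt1] at hp2
        simp only [wp_seq, wp_set, Ex.Ok, Ex.eval, Ex.cost, true_and]
        have hpt3 : toPt (s2.setR .tl 0) = toPt s2 := by simp [toPt]
        have hk3 : Keep s2 (s2.setR .tl 0) := by constructor <;> simp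
        have hl3 := (h3.trans (hk1.trans (hk2.trans hk3))).linked hl
        have harr : s2.arr .BL = s'.arr .BL ∧ s2.arr .BR = s'.arr .BR ∧ s2.arr .BK = s'.arr .BK ∧
            s2.arr .PC = s'.arr .PC ∧ s1.arr .BL = s'.arr .BL ∧ s1.arr .BR = s'.arr .BR := by
          refine ⟨?_, ?_, ?_, ?_, congrArg Pt.BL hpt1, congrArg Pt.BR hpt1⟩
          · exact congrArg Pt.BL hp2
          · exact congrArg Pt.BR hp2
          · exact congrArg Pt.BK hp2
          · exact congrArg Pt.PC hp2
        have hw2 : (toPt s2).weight G B = (toPt s').weight G B := by rw [hp2]; rfl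
        have hnf2 : s2.reg .nf = s'.reg .nf := congrArg Pt.nf hp2
        have hscan := scanBlock_spec (b := b) (W := W) (S := S) (B := B) hl3
          (by rw [hpt3, hp2]; exact hcut.cut_struc h2.toStruc) hG (by simp [hS2])
          (by simp [hnf2]; exact hcut.hB)
          (by simp [hpos2, harr.1, harr.2.2.2.2.1]) (by simp [hh2, harr.2.1, harr.2.2.2.2.2])
          (by simp) (by simp [hkk2, hs1k, h4])
        refine hscan.mono ?_
        rintro t3 s3 ⟨ht3, hk4, hsc3⟩
        simp only [St.setR_arr, harr] at hsc3
        rw [hpt3, hw2] at ht3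
        have hq3 : s3.reg .q = (toPt s').nc := by
          rw [hk4.rq]; simp [hq2]; exact congrArg Pt.nc hpt1
        have hd3 : s3.reg .dir = dir := by rw [hk4.rdir]; simp [hd2]
        have hpt4 : toPt (s3.setR .i 0) = (toPt s').cut S B dir := by
          rw [← hp2, ← hpt3, ← hk4.pt]; simp [toPt]
        have hmv := moveAll_spec (b := b) (W := W) (s := s3.setR .i 0) hG h2 hcut hpt4
          (by simp [hq3]) (by simp [hd3]) (by simp; rw [hk4.keep.len, hl3.len]) (by simp)
          (by simp only [St.setR_arr, St.setR_reg, reduceCtorEq, if_false]; exact hsc3)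
        refine hmv.mono ?_
        rintro t4 s4 ⟨ht4, hk5, hr, hkk4, hsp4⟩
        have hpot := hr.pot_le hcut h2.toStruc hhalf
        have hwp := hcut.weight_pos h2.toStruc
        have htl : s3.reg .tl ≤ (toPt s').weight G B := hsc3.le.trans (nlive_le_weight (d := toPt s') hG)
        refine ⟨_, ⟨rfl, hr.rinv hcut h2 hG hB, ?_, hkk4⟩, ?_⟩
        · refine h3.trans (hk1.trans (hk2.trans (hk3.trans (hk4.keep.trans (Keep.trans ?_ hk5)))))
          constructor <;> simp
        · have hsp5 : (toPt s4).sp = s4.reg .sp := rfl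
          simp at ht4 hsp4
          rw [hsp5]
          omega
      have e1 : ltN (s'.arr .BR F' - s'.arr .BL F') (s'.arr .BR F - s'.arr .BL F) = dir := hdir.symm
      simp only [e1]
      refine ⟨fun hd => ?_, fun hd => ?_⟩
      · rw [hs1, if_pos hd] at hmain
        rw [wp_seq] at hmain
        refine hmain.mono ?_
        intro t s2 hw
        simp only [wp_seq, wp_set, Ex.Ok, Ex.eval, Ex.cost, true_and] at hw ⊢
        refine hw.mono ?_
        intro t3 s3 hw3
        refine hw3.mono ?_
        rintro t4 s4 ⟨d', h, hle⟩
        exact ⟨d', h, by omega⟩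
      · rw [hs1, if_neg hd] at hmain
        rw [wp_seq] at hmain
        rw [wp_skip]
        refine hmain.mono ?_
        intro t s2 hw
        simp only [wp_seq, wp_set, Ex.Ok, Ex.eval, Ex.cost, true_and] at hw ⊢
        refine hw.mono ?_
        intro t3 s3 hw3
        refine hw3.mono ?_
        rintro t4 s4 ⟨d', h, hle⟩
        exact ⟨d', h, by omega⟩
  · exact ⟨rfl, hR, Keep.refl s, hkk⟩

end
end Refine

namespace WheelerGraph

/-! ### From automata to letter graphs -/

/-- The edges that read the word `w`, whose letters are stored from address `p` on, from the node
`c` to the node `t`. Inner nodes are named by the address of the preceding letter. -/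
def wordEdges : ℕ → ℕ → ℕ → List ℕ → List (ℕ × ℕ × ℕ)
  | _, _, _, [] => []
  | _, c, t, [a] => [(c, t, a)]
  | p, c, t, a :: b :: w => (c, p, a) :: wordEdges (p + 1) p t (b :: w)

/-- The records in a list, each one with its address; the first one is at `p`. -/
def sites : ℕ → List (ℕ × ℕ × List ℕ) → List (ℕ × ℕ × ℕ × List ℕ)
  | _, [] => []
  | p, r :: l => (p, r) :: sites (p + 3 + r.2.2.length) l

/-- The edges of the letter graph of a list of records (source, target, label) that is stored from
address `p` on. The state `u` is the node `3 + u`, the address of its bit in the input. -/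
def recEdges : ℕ → List (ℕ × ℕ × List ℕ) → List (ℕ × ℕ × ℕ)
  | _, [] => []
  | p, r :: l => wordEdges (p + 3) (3 + r.1) (3 + r.2.1) r.2.2 ++
      recEdges (p + 3 + r.2.2.length) l

theorem mem_wordEdges {w : List ℕ} {p c t s d a : ℕ} (h : (s, d, a) ∈ wordEdges p c t w) :
    ∃ i, ∃ hi : i < w.length, a = w[i] ∧ s = (if i = 0 then c else p + (i - 1)) ∧
      d = if i + 1 = w.length then t else p + i := by
  induction w generalizing p c with
  | nil => simp [wordEdges] at h
  | cons x w ih =>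
    cases w with
    | nil =>
      simp [wordEdges] at h
      exact ⟨0, by simp, by simp [h]⟩
    | cons y w =>
      simp only [wordEdges, List.mem_cons, Prod.mk.injEq] at h
      rcases h with ⟨rfl, rfl, rfl⟩ | h
      · exact ⟨0, by simp, by simp⟩
      · obtain ⟨i, hi, h1, h2, h3⟩ := ih (by simpa using h)
        refine ⟨i + 1, by simp at hi ⊢; omega, by simpa using h1, ?_, ?_⟩
        · rw [h2]
          simp only [Nat.add_eq_zero_iff, one_ne_zero, and_false, if_false]
          split <;> omega
        · rw [h3]
          simp only [List.length_cons, Nat.add_right_cancel_iff]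
          split <;> omega

theorem length_wordEdges {w : List ℕ} {p c t : ℕ} : (wordEdges p c t w).length = w.length := by
  induction w generalizing p c with
  | nil => rfl
  | cons x w ih => cases w with
    | nil => rfl
    | cons y w => simp [wordEdges, ih]

theorem length_recEdges {l : List (ℕ × ℕ × List ℕ)} {p : ℕ} :
    (recEdges p l).length = (l.map fun r => r.2.2.length).sum := by
  induction l generalizing p with
  | nil => rfl
  | cons r l ih => simp [recEdges, ih, length_wordEdges]

theorem mem_sites {l : List (ℕ × ℕ × List ℕ)} {p q : ℕ} {r : ℕ × ℕ × List ℕ}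
    (h : (q, r) ∈ sites p l) :
    r ∈ l ∧ p ≤ q ∧ q + 3 + r.2.2.length ≤ p + (l.map fun r => 3 + r.2.2.length).sum := by
  induction l generalizing p with
  | nil => simp [sites] at h
  | cons r' l ih =>
    simp only [sites, List.mem_cons, Prod.mk.injEq] at h
    rw [List.map_cons, List.sum_cons]
    rcases h with ⟨rfl, rfl⟩ | h
    · exact ⟨by simp, le_rfl, by omega⟩
    · have := ih h
      exact ⟨by simp [this.1], by omega, by omega⟩

theorem exists_site {l : List (ℕ × ℕ × List ℕ)} {p : ℕ} {r : ℕ × ℕ × List ℕ} (h : r ∈ l) :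
    ∃ q, (q, r) ∈ sites p l := by
  induction l generalizing p with
  | nil => simp at h
  | cons r' l ih =>
    rcases List.mem_cons.1 h with rfl | h
    · exact ⟨p, by simp [sites]⟩
    · obtain ⟨q, hq⟩ := ih (p := p + 3 + r'.2.2.length) h
      exact ⟨q, by simp [sites, hq]⟩

/-- Distinct records occupy disjoint ranges of addresses. -/
theorem sites_disjoint {l : List (ℕ × ℕ × List ℕ)} {p q q' a : ℕ} {r r' : ℕ × ℕ × List ℕ}
    (h : (q, r) ∈ sites p l) (h' : (q', r') ∈ sites p l) (h1 : q ≤ a)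
    (h2 : a < q + 3 + r.2.2.length) (h1' : q' ≤ a) (h2' : a < q' + 3 + r'.2.2.length) :
    q = q' ∧ r = r' := by
  induction l generalizing p with
  | nil => simp [sites] at h
  | cons x l ih =>
    simp only [sites, List.mem_cons, Prod.mk.injEq] at h h'
    rcases h with ⟨rfl, rfl⟩ | h <;> rcases h' with ⟨rfl, rfl⟩ | h'
    · exact ⟨rfl, rfl⟩
    · have := (mem_sites h').2.1; omega
    · have := (mem_sites h).2.1; omega
    · exact ih h h'

theorem mem_recEdges {l : List (ℕ × ℕ × List ℕ)} {p : ℕ} {x : ℕ × ℕ × ℕ} :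
    x ∈ recEdges p l ↔
      ∃ q r, (q, r) ∈ sites p l ∧ x ∈ wordEdges (q + 3) (3 + r.1) (3 + r.2.1) r.2.2 := by
  induction l generalizing p with
  | nil => simp [recEdges, sites]
  | cons r l ih =>
    simp only [recEdges, List.mem_append, ih, sites, List.mem_cons, Prod.mk.injEq]
    constructor
    · rintro (h | ⟨q, r', h1, h2⟩)
      · exact ⟨p, r, Or.inl ⟨rfl, rfl⟩, h⟩
      · exact ⟨q, r', Or.inr h1, h2⟩
    · rintro ⟨q, r', ⟨rfl, rfl⟩ | h1, h2⟩
      · exact Or.inl h2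
      · exact Or.inr ⟨q, r', h1, h2⟩

/-- The reversed strings that can be read on the edges `E` from a root to a node; roots are the node
`r₀` and the nodes that no edge enters, among which are addresses that name no node at all. -/
inductive Jr (E : List (ℕ × ℕ × ℕ)) (r₀ : ℕ) : ℕ → List ℕ → Prop
  | root {x : ℕ} : (x = r₀ ∨ ∀ s a, (s, x, a) ∉ E) → Jr E r₀ x []
  | step {s d a : ℕ} {r : List ℕ} : (s, d, a) ∈ E → Jr E r₀ s r → Jr E r₀ d (a :: r)

theorem Jr.word {E : List (ℕ × ℕ × ℕ)} {r₀ p c t : ℕ} {w r : List ℕ}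
    (hE : ∀ x ∈ wordEdges p c t w, x ∈ E) (hw : w ≠ []) (h : Jr E r₀ c r) :
    Jr E r₀ t (w.reverse ++ r) := by
  induction w generalizing p c r with
  | nil => exact absurd rfl hw
  | cons a w ih => cases w with
    | nil => exact .step (hE _ (by simp [wordEdges])) h
    | cons b w =>
      have := ih (p := p + 1) (c := p) (fun x hx => hE x (by simp [wordEdges, hx])) (by simp)
        (Jr.step (hE (c, p, a) (by simp [wordEdges])) h)
      simpa using this

section
variable {α Q : Type*}

theorem reads_snoc {A : PreGNFA α Q} {u v z : Q} {w ρ : List α} (h : A.Reads u w v)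
    (he : (v, z, ρ) ∈ A.edges) : A.Reads u (w ++ ρ) z := by
  induction h with
  | nil u => simpa using PreGNFA.Reads.cons he (.nil z)
  | cons h1 _ ih => rw [List.append_assoc]; exact .cons h1 (ih he)

theorem reads_last {A : PreGNFA α Q} {u v : Q} {w : List α} (h : A.Reads u w v) :
    v = u ∨ ∃ u' ρ, (u', v, ρ) ∈ A.edges := by
  induction h with
  | nil u => exact Or.inl rfl
  | @cons u v z ρ w h1 _ ih =>
    rcases ih with rfl | h
    · exact Or.inr ⟨u, ρ, h1⟩
    · exact Or.inr h

/-- In a deterministic automaton, a string leads to at most one state. -/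
theorem reads_unique {A : GNFA α Q} (hA : A.IsGDFA) {u v v' : Q} {w : List α}
    (h : A.Reads u w v) (h' : A.Reads u w v') : v = v' := by
  induction h generalizing v' with
  | nil u =>
    generalize hw : ([] : List α) = w at h'
    cases h' with
    | nil => rfl
    | cons h1 _ =>
      have := hA.label_ne_nil _ _ _ h1
      simp at hw
      exact absurd hw.1 this
  | @cons u v z ρ w h1 h2 ih =>
    generalize hw : ρ ++ w = w' at h'
    cases h' with
    | nil =>
      simp at hw
      exact absurd hw.1 (hA.label_ne_nil _ _ _ h1)
    | @cons _ v₂ _ ρ₂ w₂ h3 h4 =>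
      have hρ : ρ = ρ₂ := by
        rcases List.prefix_or_prefix_of_prefix (l₃ := ρ ++ w) (List.prefix_append ρ w)
          (hw ▸ List.prefix_append ρ₂ w₂) with h | h
        · exact hA.prefix_free _ _ _ _ _ h1 h3 h
        · exact (hA.prefix_free _ _ _ _ _ h3 h1 h).symm
      subst hρ
      obtain rfl := hA.target_unique _ _ _ _ h1 h3
      obtain rfl := List.append_cancel_left hw
      exact ih h4

/-- The records of the edges of an automaton. -/
def records {n σ : ℕ} [LE α] (ν : Q ≃ Fin n) (κ : α ≃o Fin σ) (l : List (Q × Q × List α)) :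
    List (ℕ × ℕ × List ℕ) :=
  l.map fun x => ((ν x.1 : ℕ), (ν x.2.1 : ℕ), x.2.2.map fun a => (κ a : ℕ))

end

section
variable {α : Type*} [LinearOrder α] {Q : Type*} {A : GNFA α Q} {n σ : ℕ} {ν : Q ≃ Fin n}
  {κ : α ≃o Fin σ} {l : List (Q × Q × List α)}

theorem map_reverse_lt {a b : List α} :
    (a.map fun x => (κ x : ℕ)).reverse < (b.map fun x => (κ x : ℕ)).reverse ↔ ColexLT a b := by
  unfold ColexLT
  rw [← List.map_reverse, ← List.map_reverse]
  have hm : StrictMono fun l : List α => l.map fun x => (κ x : ℕ) := by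
    intro a b hab
    dsimp only
    induction hab with
    | nil => exact List.Lex.nil
    | cons _ ih => exact List.Lex.cons ih
    | rel h => exact List.Lex.rel (Fin.lt_def.1 (κ.lt_iff_lt.2 h))
  exact hm.lt_iff_lt

/-- The strings that lead to a state are read to its node in the letter graph. -/
theorem jr_iff (hA : A.IsGDFA) (hl : ∀ x, x ∈ l ↔ x ∈ A.edges) {u : Q} {r : List ℕ} :
    Jr (recEdges (3 + n) (records ν κ l)) (3 + ν A.start) (3 + ν u) r ↔
      ∃ w, A.Reads A.start w u ∧ r = (w.map fun a => (κ a : ℕ)).reverse := by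
  have hmem : ∀ r, r ∈ records ν κ l → ∃ u v ρ, (u, v, ρ) ∈ A.edges ∧
      r = ((ν u : ℕ), (ν v : ℕ), ρ.map fun a => (κ a : ℕ)) := by
    intro r hr
    obtain ⟨⟨u, v, ρ⟩, h1, rfl⟩ := List.mem_map.1 hr
    exact ⟨u, v, ρ, (hl _).1 h1, rfl⟩
  have hmem' : ∀ u v ρ, (u, v, ρ) ∈ A.edges →
      ((ν u : ℕ), (ν v : ℕ), ρ.map fun a => (κ a : ℕ)) ∈ records ν κ l :=
    fun u v ρ h => List.mem_map.2 ⟨_, (hl _).2 h, rfl⟩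
  have hword : ∀ u v ρ, (u, v, ρ) ∈ A.edges → ∀ r,
      Jr (recEdges (3 + n) (records ν κ l)) (3 + ν A.start) (3 + ν u) r →
      Jr (recEdges (3 + n) (records ν κ l)) (3 + ν A.start) (3 + ν v)
        ((ρ.map fun a => (κ a : ℕ)).reverse ++ r) := by
    intro u v ρ h r hr
    obtain ⟨q, hq⟩ := exists_site (p := 3 + n) (hmem' u v ρ h)
    refine Jr.word (p := q + 3) (fun x hx => mem_recEdges.2 ⟨q, _, hq, hx⟩) ?_ hr
    simpa using hA.label_ne_nil _ _ _ h
  constructor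
  · -- The nodes inside a label are reached by a string to its source and a prefix of the label.
    have good : ∀ x r, Jr (recEdges (3 + n) (records ν κ l)) (3 + ν A.start) x r →
        (∀ u, x = 3 + ν u → ∃ w, A.Reads A.start w u ∧
          r = (w.map fun a => (κ a : ℕ)).reverse) ∧
        ∀ p ρ, (p, ρ) ∈ sites (3 + n) (records ν κ l) → ∀ i, i + 1 < ρ.2.2.length →
          x = p + 3 + i → ∃ u w, ρ.1 = ν u ∧ A.Reads A.start w u ∧
            r = (ρ.2.2.take (i + 1)).reverse ++ (w.map fun a => (κ a : ℕ)).reverse := by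
      intro x r h
      induction h with
      | @root x hx =>
        refine ⟨fun u hu => ⟨[], ?_, rfl⟩, fun p ρ hp i hi hxi => ?_⟩
        · have : u = A.start := by
            rcases hx with h | h
            · apply ν.injective; apply Fin.ext; omega
            · obtain ⟨w, hw⟩ := A.reachable u
              rcases reads_last hw with h1 | ⟨u', ρ, h1⟩
              · exact h1
              · exfalso
                have hne := hA.label_ne_nil _ _ _ h1
                obtain ⟨q, hq⟩ := exists_site (p := 3 + n) (hmem' _ _ _ h1)
                -- The last edge of a word enters its end, which is therefore no root.
                have key : ∀ (w : List ℕ) p c, w ≠ [] → ∃ s a, (s, 3 + (ν u : ℕ), a) ∈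
                    wordEdges p c (3 + ν u) w := by
                  intro w
                  induction w with
                  | nil => intro _ _ h; exact absurd rfl h
                  | cons a w ih =>
                    intro p c _
                    cases w with
                    | nil => exact ⟨c, a, by simp [wordEdges]⟩
                    | cons b w =>
                      obtain ⟨s, a', h⟩ := ih (p + 1) p (by simp)
                      exact ⟨s, a', by simp [wordEdges, h]⟩
                obtain ⟨s, a, hs⟩ := key (ρ.map fun a => (κ a : ℕ)) (q + 3) (3 + ν u')
                  (by simpa using hne)
                exact h s a (hu ▸ mem_recEdges.2 ⟨q, _, hq, hs⟩)
          rw [this]; exact .nil _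
        · exfalso
          have hp3 := (mem_sites hp).2.1
          have hlt := (ν A.start).2
          rcases hx with h | h
          · omega
          · have key : ∀ (w : List ℕ) p c t i, i + 1 < w.length → ∃ s a, (s, p + i, a) ∈
                wordEdges p c t w := by
              intro w
              induction w with
              | nil => intro _ _ _ _ h; simp at h
              | cons a w ih =>
                intro p c t i hi
                cases w with
                | nil => simp at hi
                | cons b w =>
                  cases i with
                  | zero => exact ⟨c, a, by simp [wordEdges]⟩
                  | succ i =>
                    obtain ⟨s, a', h⟩ := ih (p + 1) p t i (by simpa using hi)
                    refine ⟨s, a', ?_⟩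
                    rw [show p + (i + 1) = p + 1 + i by omega]
                    simp [wordEdges, h]
            obtain ⟨s, a, hs⟩ := key ρ.2.2 (p + 3) (3 + ρ.1) (3 + ρ.2.1) i hi
            exact h s a (hxi ▸ mem_recEdges.2 ⟨p, _, hp, hs⟩)
      | @step s d a r he _ ih =>
        obtain ⟨q, ρ, hq, hx⟩ := mem_recEdges.1 he
        obtain ⟨i, hi, ha, hs, hd⟩ := mem_wordEdges hx
        obtain ⟨hρ, hq3, -⟩ := mem_sites hq
        obtain ⟨u₁, v₁, ρ₁, hedge, rfl⟩ := hmem _ hρ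
        -- The string that the new edge completes.
        have main : ∃ w, A.Reads A.start w u₁ ∧
            a :: r = ((ρ₁.map fun a => (κ a : ℕ)).take (i + 1)).reverse ++
              (w.map fun a => (κ a : ℕ)).reverse := by
          rw [List.take_succ_eq_append_getElem hi, List.reverse_append, ← ha]
          by_cases h0 : i = 0
          · rw [if_pos h0] at hs
            obtain ⟨w, hw, hr⟩ := ih.1 u₁ hs
            exact ⟨w, hw, by simp [h0, hr]⟩
          · rw [if_neg h0] at hs
            obtain ⟨u', w, hu', hw, hr⟩ := ih.2 _ _ hq (i - 1) (by omega) hs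
            have : u₁ = u' := ν.injective (Fin.ext hu')
            subst this
            rw [Nat.sub_add_cancel (by omega)] at hr
            exact ⟨w, hw, by simp [hr]⟩
        obtain ⟨w, hw, hr⟩ := main
        refine ⟨fun u hu => ?_, fun p ρ hp j hj hdj => ?_⟩
        · have hlt := (ν u).2
          split at hd
          · next h =>
            have : v₁ = u := ν.injective (Fin.ext (by simp at hd; omega))
            subst this
            refine ⟨_, reads_snoc hw hedge, ?_⟩
            rw [hr, h, List.take_length]
            simp
          · omega
        · have hp3 := (mem_sites hp).2.1
          have hlt := (ν v₁).2
          split at hd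
          · simp at hd; omega
          · next h =>
            have hpq := sites_disjoint (a := d) hp hq (by omega) (by omega) (by omega) (by omega)
            obtain ⟨rfl, rfl⟩ := hpq
            obtain rfl : j = i := by omega
            exact ⟨u₁, w, rfl, hw, hr⟩
    exact fun h => (good _ _ h).1 u rfl
  · rintro ⟨w, hw, rfl⟩
    have : ∀ u v w, A.Reads u w v → ∀ r,
        Jr (recEdges (3 + n) (records ν κ l)) (3 + ν A.start) (3 + ν u) r →
        Jr (recEdges (3 + n) (records ν κ l)) (3 + ν A.start) (3 + ν v)
          ((w.map fun a => (κ a : ℕ)).reverse ++ r) := by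
      intro u v w h
      induction h with
      | nil u => intro r hr; simpa using hr
      | cons h1 _ ih =>
        intro r hr
        have := ih _ (hword _ _ _ h1 r hr)
        simpa using this
    simpa using this _ _ _ hw [] (.root (Or.inl rfl))

end
end WheelerGraph

namespace WheelerGraph

open Refine Function

/-! ### What the refinement tells about reversed strings -/

/-- The graph with two copies of every node: the copies below `L` minimize, the others maximize. An
edge is live if it carries the best label of its target. -/
def twoCopies (L M : ℕ) (src dst el lb : ℕ → ℕ) : Gr where
  N := 2 * L
  M := M
  L := L
  src := src
  dst := dst
  lab := lb
  live e := el e = lb (dst e)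

/-- The arrays `src`, `dst`, `el` list two copies of every edge in `E`, and `el` is the label plus
one. -/
structure Lists (E : List (ℕ × ℕ × ℕ)) (L M : ℕ) (src dst el : ℕ → ℕ) : Prop where
  bound : ∀ s d a, (s, d, a) ∈ E → s < L ∧ d < L
  sound : ∀ e < M, ∃ s d a, (s, d, a) ∈ E ∧ el e = a + 1 ∧
    (src e = s ∧ dst e = d ∨ src e = s + L ∧ dst e = d + L)
  min : ∀ s d a, (s, d, a) ∈ E → ∃ e < M, el e = a + 1 ∧ src e = s ∧ dst e = d
  max : ∀ s d a, (s, d, a) ∈ E → ∃ e < M, el e = a + 1 ∧ src e = s + L ∧ dst e = d + L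

/-- The label of a node is the best label of an edge that enters it, or `0` if there is none; the
empty string makes it `0` for the minimizing copy of the root `r₀`. -/
structure Labels (L M r₀ : ℕ) (dst el lb : ℕ → ℕ) : Prop where
  root : lb r₀ = 0
  none : ∀ x, lb x = 0 → x ≠ r₀ → ∀ e < M, dst e ≠ x
  some : ∀ x, lb x ≠ 0 → ∃ e < M, dst e = x ∧ el e = lb x
  min : ∀ e < M, dst e < L → lb (dst e) ≤ el e
  max : ∀ e < M, L ≤ dst e → el e ≤ lb (dst e)

/-- Some string that leads to `x` precedes some string that leads to the node `y` is a copy of. -/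
def Before (E : List (ℕ × ℕ × ℕ)) (r₀ L x y : ℕ) : Prop :=
  ∃ b, Jr E r₀ x b ∧ ∃ a, Jr E r₀ (y - L) a ∧ b < a

section
variable {E : List (ℕ × ℕ × ℕ)} {L M r₀ : ℕ} {src dst el lb : ℕ → ℕ}

theorem Jr.cases {x : ℕ} {r : List ℕ} (h : Jr E r₀ x r) :
    r = [] ∧ (x = r₀ ∨ ∀ s a, (s, x, a) ∉ E) ∨
      ∃ s a r', (s, x, a) ∈ E ∧ Jr E r₀ s r' ∧ r = a :: r' := by
  cases h with
  | root h => exact Or.inl ⟨rfl, h⟩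
  | step h h' => exact Or.inr ⟨_, _, _, h, h', rfl⟩

theorem twoCopies_wf (hl : Lists E L M src dst el) (hb : Labels L M r₀ dst el lb) :
    (twoCopies L M src dst el lb).WF := by
  refine ⟨?_, ?_, ?_, ?_, ?_⟩
  · intro e he _
    obtain ⟨s, d, a, h1, -, h3⟩ := hl.sound e he
    have := hl.bound s d a h1
    show src e < 2 * L
    omega
  · intro e he _
    obtain ⟨s, d, a, h1, -, h3⟩ := hl.sound e he
    have := hl.bound s d a h1
    show dst e < 2 * L
    omega
  · intro e he _
    obtain ⟨s, d, a, h1, -, h3⟩ := hl.sound e he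
    have := hl.bound s d a h1
    show src e < L ↔ dst e < L
    omega
  · intro e he hlive
    obtain ⟨s, d, a, h1, h2, h3⟩ := hl.sound e he
    have hlive : el e = lb (dst e) := hlive
    show lb (dst e) ≠ 0
    omega
  · intro x _ hx
    obtain ⟨e, he, h1, h2⟩ := hb.some x hx
    exact ⟨e, he, h2.trans (congrArg lb h1.symm), h1⟩

theorem Labels.jr_nil (hl : Lists E L M src dst el) (hb : Labels L M r₀ dst el lb) {x : ℕ}
    (hx : lb x = 0) : Jr E r₀ x [] := by
  refine .root ?_
  by_cases h : x = r₀
  · exact Or.inl h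
  · refine Or.inr fun s a hs => ?_
    obtain ⟨e, he, -, -, h3⟩ := hl.min s x a hs
    exact hb.none x hx h e he h3

/-- The edges of the two copies of the graph, seen as edges of the graph. -/
theorem Lists.edge_min (hl : Lists E L M src dst el) {e : ℕ} (he : e < M) (h : dst e < L) :
    ∃ a, (src e, dst e, a) ∈ E ∧ el e = a + 1 := by
  obtain ⟨s, d, a, h1, h2, h3⟩ := hl.sound e he
  rcases h3 with ⟨rfl, rfl⟩ | h3
  · exact ⟨a, h1, h2⟩
  · omega

theorem Lists.edge_max (hl : Lists E L M src dst el) {e : ℕ} (he : e < M) (h : L ≤ dst e) :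
    L ≤ src e ∧ ∃ a, (src e - L, dst e - L, a) ∈ E ∧ el e = a + 1 := by
  obtain ⟨s, d, a, h1, h2, h3⟩ := hl.sound e he
  have := hl.bound s d a h1
  rcases h3 with ⟨rfl, rfl⟩ | ⟨h3, h4⟩
  · omega
  · exact ⟨by omega, a, by rwa [h3, h4, Nat.add_sub_cancel, Nat.add_sub_cancel], h2⟩

/-- Distinct labels decide the comparison of the best strings. -/
theorem exists_jr (hl : Lists E L M src dst el) (hb : Labels L M r₀ dst el lb)
    (hne : ∀ s d a, (s, d, a) ∈ E → ∃ r, Jr E r₀ s r) {x y : ℕ} (hx : x < L) (hy : L ≤ y)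
    (hlt : lb x < lb y) : Before E r₀ L x y := by
  obtain ⟨e, he, h1, h2⟩ := hb.some y (by omega)
  obtain ⟨-, a, h3, h4⟩ := hl.edge_max he (by omega)
  obtain ⟨r, hr⟩ := hne _ _ _ h3
  rw [h1] at h3
  by_cases hx0 : lb x = 0
  · exact ⟨[], hb.jr_nil hl hx0, _, .step h3 hr, List.nil_lt_cons _ _⟩
  · obtain ⟨e', he', h1', h2'⟩ := hb.some x hx0
    obtain ⟨a', h3', h4'⟩ := hl.edge_min he' (by omega)
    obtain ⟨r', hr'⟩ := hne _ _ _ h3'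
    rw [h1'] at h3'
    exact ⟨_, .step h3' hr', _, .step h3 hr, List.Lex.rel (by omega)⟩

/-- If some string to the source of an edge precedes some string to the source of another one with the
same label, then the same holds for the targets. -/
theorem twoCopies_closed (hl : Lists E L M src dst el) (hb : Labels L M r₀ dst el lb)
    (hne : ∀ s d a, (s, d, a) ∈ E → ∃ r, Jr E r₀ s r) :
    (twoCopies L M src dst el lb).Closed (Before E r₀ L) := by
  refine ⟨fun x _ y _ hx hy hlt => exists_jr hl hb hne hx hy hlt, ?_⟩
  intro e he e' he' hle hle' h h' hlab hbef
  obtain ⟨b, hb1, a, ha1, hba⟩ := hbef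
  have hle : el e = lb (dst e) := hle
  have hle' : el e' = lb (dst e') := hle'
  have hlab : lb (dst e) = lb (dst e') := hlab
  obtain ⟨c, h3, h4⟩ := hl.edge_min he h
  obtain ⟨-, c', h3', h4'⟩ := hl.edge_max he' h'
  obtain rfl : c = c' := by omega
  exact ⟨_, .step h3 hb1, _, .step h3' ha1, List.Lex.cons hba⟩

/-- A numbering of the nodes that respects the labels, and for equal labels the sources of the live
edges. -/
structure Ranks (L M : ℕ) (src dst el lb R : ℕ → ℕ) : Prop where
  lab : ∀ x < 2 * L, ∀ y < 2 * L, R x ≤ R y → lb x ≤ lb y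
  all : ∀ x < 2 * L, ∀ y < L, L ≤ x → R x ≤ R y → lb x = lb y → ∀ e < M, ∀ e' < M,
    el e = lb x → el e' = lb y → dst e = x → dst e' = y → R (src e) ≤ R (src e')
  ex : ∀ x < L, ∀ y < L, R x ≤ R y → lb x = lb y → lb x ≠ 0 → ∃ e < M, el e = lb x ∧ dst e = x ∧
    ∀ e' < M, el e' = lb y → dst e' = y → R (src e) ≤ R (src e')

theorem nil_le_list (b : List ℕ) : [] ≤ b := not_lt.1 (List.not_lt_nil b)

theorem cons_le_list {a b : List ℕ} (c : ℕ) (h : a ≤ b) : c :: a ≤ c :: b := by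
  rw [← not_lt] at h ⊢
  intro h'
  exact h (by simpa using List.cons_lt_cons_iff.1 h')

/-- If the maximizing copy of `x` is not after the minimizing copy of `y`, then no string to `x` exceeds
a string to `y`. By induction on the string to `x`: its first letter is at most the label of `x`,
which is at most the label of `y`, which is at most the first letter of the string to `y`; in case of
equality the edges are live. -/
theorem Ranks.le_all {R : ℕ → ℕ} (hR : Ranks L M src dst el lb R)
    (hl : Lists E L M src dst el) (hb : Labels L M r₀ dst el lb) {x y : ℕ} (hx : x < L) (hy : y < L)
    (h : R (x + L) ≤ R y) {a b : List ℕ} (ha : Jr E r₀ x a) (hb' : Jr E r₀ y b) : a ≤ b := by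
  induction a generalizing x y b with
  | nil => exact nil_le_list b
  | cons c a ih =>
    rcases ha.cases with ⟨h0, -⟩ | ⟨s, c', r', h1, h2, h3⟩
    · simp at h0
    obtain ⟨rfl, rfl⟩ := List.cons.inj h3
    have hlab := hR.lab (x + L) (by omega) y (by omega) h
    obtain ⟨e, he, e1, e2, e3⟩ := hl.max _ _ _ h1
    have hle : el e ≤ lb (x + L) := e3 ▸ hb.max e he (by omega)
    rcases hb'.cases with ⟨rfl, h0⟩ | ⟨s', d, b', g1, g2, rfl⟩
    · exfalso
      obtain ⟨e', he', f1, f2⟩ := hb.some y (by omega)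
      obtain ⟨a', h3', h4'⟩ := hl.edge_min he' (by omega)
      rcases h0 with rfl | h0
      · have := hb.root; omega
      · rw [f1] at h3'; exact h0 _ _ h3'
    · obtain ⟨e', he', f1, f2, f3⟩ := hl.min _ _ _ g1
      have hge : lb y ≤ el e' := f3 ▸ hb.min e' he' (by omega)
      rcases lt_or_ge c d with hcd | hcd
      · exact (show c :: a < d :: b' from List.Lex.rel hcd).le
      · obtain rfl : c = d := by omega
        refine cons_le_list c ?_
        have := hR.all (x + L) (by omega) y hy (by omega) h (by omega) e he e' he' (by omega)
          (by omega) e3 f3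
        rw [e2, f2] at this
        exact ih (hl.bound _ _ _ h1).1 (hl.bound _ _ _ g1).1 this h2 g2

/-- If the minimizing copy of `x` is not after that of `y`, then below every string to `y` there is a
string to `x`. By induction on the string to `y`, following the best live edge into `x`. -/
theorem Ranks.exists_le {R : ℕ → ℕ} (hR : Ranks L M src dst el lb R)
    (hl : Lists E L M src dst el) (hb : Labels L M r₀ dst el lb)
    (hne : ∀ s d a, (s, d, a) ∈ E → ∃ r, Jr E r₀ s r) {x y : ℕ} (hx : x < L) (hy : y < L)
    (h : R x ≤ R y) {b : List ℕ} (hb' : Jr E r₀ y b) : ∃ a, Jr E r₀ x a ∧ a ≤ b := by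
  induction b generalizing x y with
  | nil =>
    have hlab := hR.lab x (by omega) y (by omega) h
    refine ⟨[], hb.jr_nil hl ?_, le_rfl⟩
    by_contra h0
    rcases hb'.cases with ⟨-, h1⟩ | ⟨_, _, _, -, -, h1⟩
    · obtain ⟨e', he', f1, f2⟩ := hb.some y (by omega)
      obtain ⟨a', h3', h4'⟩ := hl.edge_min he' (by omega)
      rcases h1 with rfl | h1
      · have := hb.root; omega
      · rw [f1] at h3'; exact h1 _ _ h3'
    · simp at h1
  | cons d b ih =>
    have hlab := hR.lab x (by omega) y (by omega) h
    by_cases h0 : lb x = 0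
    · exact ⟨[], hb.jr_nil hl h0, nil_le_list _⟩
    rcases hb'.cases with ⟨h1, -⟩ | ⟨s', d', b', g1, g2, h3⟩
    · simp at h1
    obtain ⟨rfl, rfl⟩ := List.cons.inj h3
    obtain ⟨e', he', f1, f2, f3⟩ := hl.min _ _ _ g1
    have hge : lb y ≤ el e' := f3 ▸ hb.min e' he' (by omega)
    rcases lt_or_ge (lb x) (d + 1) with hlt | hlt
    · obtain ⟨e, he, h1, h2⟩ := hb.some x h0
      obtain ⟨a, h3, h4⟩ := hl.edge_min he (by omega)
      obtain ⟨r, hr⟩ := hne _ _ _ h3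
      rw [h1] at h3
      exact ⟨_, .step h3 hr, (show a :: r < d :: b from List.Lex.rel (by omega)).le⟩
    · obtain ⟨e, he, h1, h2, h3⟩ := hR.ex x hx y hy h (by omega) h0
      have h4 := h3 e' he' (by omega) f3
      rw [f2] at h4
      obtain ⟨a, h5, h6⟩ := hl.edge_min he (by omega)
      obtain ⟨r, hr, hrb⟩ := ih (hl.bound _ _ _ h5).1 (hl.bound _ _ _ g1).1 h4 g2
      obtain rfl : a = d := by omega
      rw [h2] at h5
      exact ⟨_, .step h5 hr, cons_le_list _ hrb⟩

/-- The order of the fine blocks at the end of the refinement. -/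
theorem RInv.ranks {Bef : ℕ → ℕ → Prop} {d : Pt} (hl : Lists E L M src dst el)
    (hb : Labels L M r₀ dst el lb) (hR : RInv (twoCopies L M src dst el lb) Bef d) (hsp : d.sp = 0) :
    Ranks L M src dst el lb fun x => d.BL (d.BK x) := by
  have hG := twoCopies_wf hl hb
  refine ⟨?_, ?_, ?_⟩
  · intro x hx y hy h
    exact (RInv.final hR hG hsp hx hy h).1
  · intro x hx y hy hLx h hlab e he e' he' h1 h2 h3 h4
    subst h3 h4
    exact ((RInv.final hR hG hsp hx (show dst e' < 2 * L by omega) h).2 hlab).1 hLx hy e he e' he' h1 h2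
      rfl rfl
  · intro x hx y hy h hlab h0
    obtain ⟨e, he, h1, h2, h3⟩ := ((RInv.final hR hG hsp (show x < 2 * L by omega)
      (show y < 2 * L by omega) h).2 hlab).2 hx hy h0
    have h1 : el e = lb (dst e) := h1
    have h2 : dst e = x := h2
    exact ⟨e, he, by rw [h1, h2], h2, fun e' he' g1 g2 => h3 e' he' (g1.trans (congrArg lb g2.symm)) g2⟩

end

/-! ### The Wheeler order -/

section
variable {α : Type*} [LinearOrder α] {Q : Type*} {A : GNFA α Q} {n : ℕ}

/-- Consecutive comparisons along a list of all states decide whether the automaton is Wheeler. -/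
theorem isWheeler_of_chain (q : Fin n ≃ Q)
    (h : ∀ i (hi : i + 1 < n), A.le (q ⟨i, by omega⟩) (q ⟨i + 1, hi⟩)) :
    A.IsWheeler ∧ ∀ i j, A.le (q i) (q j) ↔ i ≤ j := by
  have hlt : ∀ {i j : Fin n}, i < j → ∀ a ∈ A.stringsTo (q i), ∀ b ∈ A.stringsTo (q j),
      ColexLT a b := by
    have : ∀ (k i : ℕ) (hk : i + k + 1 < n), ∀ a ∈ A.stringsTo (q ⟨i, by omega⟩),
        ∀ b ∈ A.stringsTo (q ⟨i + k + 1, hk⟩), ColexLT a b := by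
      intro k
      induction k with
      | zero =>
        intro i hi
        rcases h i hi with h | h
        · have := q.injective h; simp at this
        · exact h
      | succ k ih =>
        intro i hi a ha b hb
        obtain ⟨c, hc⟩ := A.reachable (q ⟨i + k + 1, by omega⟩)
        rcases h (i + k + 1) hi with h | h
        · have := q.injective h; simp at this
        · exact lt_trans (ih i (by omega) a ha c hc) (h c hc b hb)
    intro i j hij
    have hij' : (i : ℕ) < j := hij
    obtain ⟨k, hk⟩ : ∃ k, (j : ℕ) = i + k + 1 := ⟨j - i - 1, by omega⟩
    have := this k i (by omega)
    simpa only [← hk] using this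
  have hle : ∀ i j, A.le (q i) (q j) ↔ i ≤ j := by
    intro i j
    constructor
    · intro hij
      by_contra hc
      push Not at hc
      rcases hij with h | h
      · exact hc.ne (q.injective h).symm
      · obtain ⟨a, ha⟩ := A.reachable (q i)
        obtain ⟨b, hb⟩ := A.reachable (q j)
        exact lt_asymm (h a ha b hb) (hlt hc b hb a ha)
    · intro hij
      rcases hij.eq_or_lt with rfl | h
      · exact Or.inl rfl
      · exact Or.inr (hlt h)
  have hle' : ∀ u v, A.le u v ↔ q.symm u ≤ q.symm v := by
    intro u v
    rw [← hle]; simp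
  refine ⟨⟨fun u => Or.inl rfl, fun u v h h' => ?_, fun u v z h h' => ?_, fun u v => ?_⟩, hle⟩
  · rw [hle'] at h h'
    exact q.symm.injective (le_antisymm h h')
  · rw [hle'] at *
    exact h.trans h'
  · rw [hle', hle']
    exact le_total _ _

variable {σ : ℕ} {ν : Q ≃ Fin n} {κ : α ≃o Fin σ} {l : List (Q × Q × List α)} {L M : ℕ}
  {src dst el lb R : ℕ → ℕ}

/-- If the states are listed by the ranks of their minimizing copies, then the automaton is Wheeler
if and only if the maximizing copy of no state exceeds the minimizing copy of the next one. -/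
theorem decide_wheeler (hA : A.IsGDFA) (hmem : ∀ x, x ∈ l ↔ x ∈ A.edges)
    (hl : Lists (recEdges (3 + n) (records ν κ l)) L M src dst el)
    (hb : Labels L M (3 + ν A.start) dst el lb) (hR : Ranks L M src dst el lb R)
    (hbef : ∀ x < L, ∀ y < L, R x < R (y + L) →
      Before (recEdges (3 + n) (records ν κ l)) (3 + ν A.start) L x (y + L))
    (hne : ∀ s d a, (s, d, a) ∈ recEdges (3 + n) (records ν κ l) →
      ∃ r, Jr (recEdges (3 + n) (records ν κ l)) (3 + ν A.start) s r)
    (hL : 3 + n ≤ L) (q : Fin n ≃ Q)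
    (hq : ∀ i (hi : i + 1 < n), R (3 + ν (q ⟨i, by omega⟩)) ≤ R (3 + ν (q ⟨i + 1, hi⟩))) :
    ((∀ i (hi : i + 1 < n), R (3 + ν (q ⟨i, by omega⟩) + L) ≤ R (3 + ν (q ⟨i + 1, hi⟩))) →
      A.IsWheeler ∧ ∀ i j, A.le (q i) (q j) ↔ i ≤ j) ∧
    (A.IsWheeler → ∀ i (hi : i + 1 < n),
      R (3 + ν (q ⟨i, by omega⟩) + L) ≤ R (3 + ν (q ⟨i + 1, hi⟩))) := by
  have hν : ∀ u, 3 + (ν u : ℕ) < L := fun u => by have := (ν u).2; omega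
  constructor
  · intro h
    refine isWheeler_of_chain q fun i hi => Or.inr fun a ha b hb' => ?_
    have hle := hR.le_all hl hb (hν _) (hν _) (h i hi) ((jr_iff hA hmem).2 ⟨a, ha, rfl⟩)
      ((jr_iff hA hmem).2 ⟨b, hb', rfl⟩)
    rw [← map_reverse_lt (κ := κ)]
    -- Equal strings would lead to the same state.
    refine lt_of_le_of_ne hle fun he => ?_
    have hab : a = b := by
      apply List.map_injective_iff.2 (Fin.val_injective.comp κ.injective)
      exact List.reverse_injective he
    subst hab
    have := q.injective (reads_unique hA ha hb')
    simp at this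
  -- Otherwise some string to the next state `v` precedes some string to `u`, while there is also a
  -- string to `u` that does not exceed it; so `u` and `v` are incomparable.
  · intro hW i hi
    by_contra hlt
    obtain ⟨b, hb1, a, ha1, hba⟩ := hbef _ (hν _) _ (hν _) (not_le.1 hlt)
    rw [Nat.add_sub_cancel] at ha1
    obtain ⟨a', ha2, ha3⟩ := hR.exists_le hl hb hne (hν _) (hν _) (hq i hi) hb1
    obtain ⟨v, hv, rfl⟩ := (jr_iff hA hmem).1 hb1
    obtain ⟨u, hu, rfl⟩ := (jr_iff hA hmem).1 ha1
    obtain ⟨u', hu', rfl⟩ := (jr_iff hA hmem).1 ha2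
    rw [map_reverse_lt] at hba
    rw [← not_lt, map_reverse_lt] at ha3
    have hne : q ⟨i, by omega⟩ ≠ q ⟨i + 1, hi⟩ := fun h => by
      have := q.injective h; simp at this
    rcases hW.2.2.2 (q ⟨i, by omega⟩) (q ⟨i + 1, hi⟩) with h | h
    · rcases h with h | h
      · exact hne h
      · exact lt_asymm (h u hu v hv) hba
    · rcases h with h | h
      · exact hne h.symm
      · exact ha3 (h v hv u' hu')

end
end WheelerGraph

namespace WheelerGraph

open Refine Function

/-! ### The size of the input -/

/-- The numbers in a record. -/
def recNums (r : ℕ × ℕ × List ℕ) : List ℕ := r.1 :: r.2.1 :: r.2.2.length :: r.2.2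

theorem length_flatMap_recNums (l : List (ℕ × ℕ × List ℕ)) :
    (l.flatMap recNums).length = (l.map fun r => 3 + r.2.2.length).sum := by
  induction l with
  | nil => rfl
  | cons r l ih => simp only [List.flatMap_cons, List.length_append, ih, List.map_cons, List.sum_cons,
      recNums, List.length_cons]; omega

theorem recEdges_bound {l : List (ℕ × ℕ × List ℕ)} {n p s d a : ℕ} (hp : 3 + n ≤ p)
    (hl : ∀ r ∈ l, r.1 < n ∧ r.2.1 < n) (h : (s, d, a) ∈ recEdges p l) :
    s < p + (l.flatMap recNums).length ∧ d < p + (l.flatMap recNums).length := by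
  obtain ⟨q, r, hq, hx⟩ := mem_recEdges.1 h
  obtain ⟨i, hi, -, h1, h2⟩ := mem_wordEdges hx
  obtain ⟨hr, h3, h4⟩ := mem_sites hq
  have := hl r hr
  rw [← length_flatMap_recNums] at h4
  constructor
  · split at h1 <;> omega
  · split at h2 <;> omega

theorem exists_jr_word {E : List (ℕ × ℕ × ℕ)} {r₀ p c t : ℕ} {w r : List ℕ}
    (hE : ∀ x ∈ wordEdges p c t w, x ∈ E) (h : Jr E r₀ c r) {s d a : ℕ}
    (hs : (s, d, a) ∈ wordEdges p c t w) : ∃ r, Jr E r₀ s r := by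
  induction w generalizing p c r with
  | nil => simp [wordEdges] at hs
  | cons x w ih => cases w with
    | nil =>
      simp [wordEdges] at hs
      exact ⟨r, hs.1 ▸ h⟩
    | cons y w =>
      simp only [wordEdges, List.mem_cons, Prod.mk.injEq] at hs
      rcases hs with ⟨rfl, rfl, rfl⟩ | hs
      · exact ⟨r, h⟩
      · exact ih (p := p + 1) (c := p) (fun z hz => hE z (by simp [wordEdges, hz]))
          (Jr.step (hE (c, p, x) (by simp [wordEdges])) h) (by simpa using hs)

section
variable {α : Type*} [LinearOrder α] {Q : Type*} {A : GNFA α Q} {n σ : ℕ} {ν : Q ≃ Fin n}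
  {κ : α ≃o Fin σ} {l : List (Q × Q × List α)}

/-- Every source of an edge of the letter graph is reached from a root. -/
theorem exists_jr_source (hA : A.IsGDFA) (hmem : ∀ x, x ∈ l ↔ x ∈ A.edges) {s d a : ℕ}
    (h : (s, d, a) ∈ recEdges (3 + n) (records ν κ l)) :
    ∃ r, Jr (recEdges (3 + n) (records ν κ l)) (3 + ν A.start) s r := by
  obtain ⟨q, r, hq, hx⟩ := mem_recEdges.1 h
  obtain ⟨⟨u, v, ρ⟩, h1, rfl⟩ := List.mem_map.1 (mem_sites hq).1
  obtain ⟨w, hw⟩ := A.reachable u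
  exact exists_jr_word (fun x hx => mem_recEdges.2 ⟨q, _, hq, hx⟩)
    ((jr_iff hA hmem).2 ⟨w, hw, rfl⟩) hx

theorem encode_eq : A.encode ν κ l =
    n :: (ν A.start : ℕ) :: (records ν κ l).length ::
      ((List.finRange n).map (fun i => by classical exact if ν.symm i ∈ A.final then 1 else 0) ++
        (records ν κ l).flatMap recNums) := by
  simp [GNFA.encode, records, List.flatMap_map, recNums]

theorem records_bound : ∀ r ∈ records ν κ l, r.1 < n ∧ r.2.1 < n ∧ ∀ a ∈ r.2.2, a < σ := by
  intro r hr
  obtain ⟨⟨u, v, ρ⟩, -, rfl⟩ := List.mem_map.1 hr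
  refine ⟨(ν u).2, (ν v).2, fun a ha => ?_⟩
  obtain ⟨b, -, rfl⟩ := List.mem_map.1 ha
  exact (κ b).2

theorem sum_records (hl : l.Nodup) (hmem : ∀ x, x ∈ l ↔ x ∈ A.edges) :
    ((records ν κ l).map fun r => r.2.2.length).sum = A.totalLabelLength := by
  classical
  have : A.edges = l.toFinset := by ext x; simp [hmem]
  unfold PreGNFA.totalLabelLength
  rw [this, List.sum_toFinset _ hl, records, List.map_map]
  congr 1
  apply List.map_congr_left
  intro x _
  simp

theorem length_records_le (hA : A.IsGDFA) (hl : l.Nodup) (hmem : ∀ x, x ∈ l ↔ x ∈ A.edges) :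
    (records ν κ l).length ≤ A.totalLabelLength := by
  rw [← sum_records (ν := ν) (κ := κ) hl hmem]
  have : ∀ r ∈ records ν κ l, 1 ≤ r.2.2.length := by
    intro r hr
    obtain ⟨⟨u, v, ρ⟩, h1, rfl⟩ := List.mem_map.1 hr
    have := hA.label_ne_nil _ _ _ ((hmem _).1 h1)
    simpa [Nat.one_le_iff_ne_zero] using this
  generalize records ν κ l = L at this
  induction L with
  | nil => simp
  | cons r L ih =>
    have h1 := this r (by simp)
    have h2 := ih fun r hr => this r (by simp [hr])
    simp; omega

/-- Every state but the initial one is the target of an edge. -/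
theorem states_le (ν : Q ≃ Fin n) (hl : l.Nodup) (hmem : ∀ x, x ∈ l ↔ x ∈ A.edges) :
    n ≤ l.length + 1 := by
  classical
  have hsub : (Finset.univ : Finset (Fin n)) ⊆
      insert (ν A.start) (l.toFinset.image fun x => ν x.2.1) := by
    intro i _
    obtain ⟨w, hw⟩ := A.reachable (ν.symm i)
    rcases reads_last hw with h | ⟨u, ρ, h⟩
    · simp [← h]
    · refine Finset.mem_insert_of_mem (Finset.mem_image.2 ⟨_, List.mem_toFinset.2 ((hmem _).2 h), ?_⟩)
      simp
  have h1 := Finset.card_le_card hsub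
  rw [Finset.card_univ, Fintype.card_fin] at h1
  have h2 := Finset.card_insert_le (ν A.start) (l.toFinset.image fun x => ν x.2.1)
  have h3 := Finset.card_image_le (s := l.toFinset) (f := fun x => ν x.2.1)
  rw [List.toFinset_card_of_nodup hl] at h3
  omega

end
end WheelerGraph

namespace WheelerGraph

open Refine Function Imp

/-! ### Reading the input -/

/-- Append the two copies of the edge from `cur` to `dst` with label `lab`. -/
def pushCmd : Cmd :=
  .st .ES (.reg .m) (.reg .cur) ;;
  .st .ED (.reg .m) (.reg .dst) ;;
  .st .EL (.reg .m) (.reg .lab) ;;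
  .st .ES (.inc (.reg .m) 1) (.add (.reg .cur) (.reg .len)) ;;
  .st .ED (.inc (.reg .m) 1) (.add (.reg .dst) (.reg .len)) ;;
  .st .EL (.inc (.reg .m) 1) (.reg .lab) ;;
  .set .m (.inc (.reg .m) 2)

/-- Read the `rem` letters from `pos` on, on the way from `cur` to `tgt`. -/
def parseWord : Cmd :=
  .while (.reg .rem)
    (.set .lab (.inc (.raw (.reg .pos)) 1) ;;
    .ite (.eq (.reg .rem) (.lit 1)) (.set .dst (.reg .tgt)) (.set .dst (.reg .pos)) ;;
    pushCmd ;;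
    .set .cur (.reg .dst) ;;
    .set .pos (.inc (.reg .pos) 1) ;;
    .set .rem (.sub (.reg .rem) (.lit 1)))

/-- Read the records from `pos` on. -/
def parseRecs : Cmd :=
  .while (.lt (.reg .pos) (.reg .len))
    (.set .cur (.inc (.raw (.reg .pos)) 3) ;;
    .set .tgt (.inc (.raw (.inc (.reg .pos) 1)) 3) ;;
    .set .rem (.raw (.inc (.reg .pos) 2)) ;;
    .set .pos (.inc (.reg .pos) 3) ;;
    parseWord)

/-- Read the input. -/
def parseCmd : Cmd :=
  .set .num (.raw (.lit 0)) ;;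
  .set .ini (.inc (.raw (.lit 1)) 3) ;;
  .set .dbl (.add (.reg .len) (.reg .len)) ;;
  .set .pos (.inc (.reg .num) 3) ;;
  parseRecs

/-- The edges `E` have been read. -/
structure Pushed (E : List (ℕ × ℕ × ℕ)) (s : St) : Prop where
  m : s.reg .m = 2 * E.length
  lists : Lists E (s.reg .len) (s.reg .m) (s.arr .ES) (s.arr .ED) (s.arr .EL)

/-- What reading does not change. -/
structure ParseKeep (s s' : St) : Prop where
  raw : s'.raw = s.raw
  len : s'.reg .len = s.reg .len
  dbl : s'.reg .dbl = s.reg .dbl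
  num : s'.reg .num = s.reg .num
  ini : s'.reg .ini = s.reg .ini
  arr : ∀ a, a ≠ .ES → a ≠ .ED → a ≠ .EL → s'.arr a = s.arr a

theorem ParseKeep.refl (s : St) : ParseKeep s s := ⟨rfl, rfl, rfl, rfl, rfl, fun _ _ _ _ => rfl⟩

theorem ParseKeep.trans {s s' s'' : St} (h : ParseKeep s s') (h' : ParseKeep s' s'') :
    ParseKeep s s'' :=
  ⟨h'.raw.trans h.raw, h'.len.trans h.len, h'.dbl.trans h.dbl, h'.num.trans h.num,
    h'.ini.trans h.ini, fun a h1 h2 h3 => (h'.arr a h1 h2 h3).trans (h.arr a h1 h2 h3)⟩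

section
variable {b W : ℕ} {s : St} {E : List (ℕ × ℕ × ℕ)}

theorem pushCmd_spec (hp : Pushed E s) {x y a : ℕ} (hx : s.reg .cur = x) (hy : s.reg .dst = y)
    (ha : s.reg .lab = a + 1) (hxL : x < s.reg .len) (hyL : y < s.reg .len)
    (hW : 2 * s.reg .len ≤ W) :
    wp b W pushCmd (fun t s' => t ≤ 100 ∧ Pushed (E ++ [(x, y, a)]) s' ∧ ParseKeep s s' ∧
      s'.reg .dst = y ∧ s'.reg .pos = s.reg .pos ∧ s'.reg .rem = s.reg .rem ∧
      s'.reg .tgt = s.reg .tgt) s := by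
  simp [pushCmd, hx, hy, ha]
  refine ⟨by omega, by omega, ⟨?_, ?_⟩, ?_⟩
  · simp [hp.m]; ring
  · simp
    generalize hmm : s.reg .m = m
    have h := hp.lists
    rw [hmm] at h
    have hne : ∀ e < m, e ≠ m ∧ e ≠ m + 1 := fun e he => by omega
    refine ⟨?_, ?_, ?_, ?_⟩
    · intro s₁ d a₁ hmem
      rcases List.mem_append.1 hmem with hmem | hmem
      · exact h.bound _ _ _ hmem
      · simp at hmem; omega
    · intro e he
      rcases lt_or_ge e m with hem | hem
      · obtain ⟨s₁, d, a₁, h1, h2, h3⟩ := h.sound e hem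
        refine ⟨s₁, d, a₁, by simp [h1], ?_⟩
        simpa [update_apply, hne e hem] using ⟨h2, h3⟩
      · refine ⟨x, y, a, by simp, ?_⟩
        rcases (show e = m ∨ e = m + 1 by omega) with rfl | rfl
        · simp
        · simp
    · intro s₁ d a₁ hmem
      rcases List.mem_append.1 hmem with hmem | hmem
      · obtain ⟨e, he, h1⟩ := h.min _ _ _ hmem
        refine ⟨e, by omega, ?_⟩
        simpa [update_apply, hne e he] using h1
      · simp at hmem
        obtain ⟨rfl, rfl, rfl⟩ := hmem
        exact ⟨m, by omega, by simp⟩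
    · intro s₁ d a₁ hmem
      rcases List.mem_append.1 hmem with hmem | hmem
      · obtain ⟨e, he, h1⟩ := h.max _ _ _ hmem
        refine ⟨e, by omega, ?_⟩
        simpa [update_apply, hne e he] using h1
      · simp at hmem
        obtain ⟨rfl, rfl, rfl⟩ := hmem
        exact ⟨m + 1, by omega, by simp⟩
  · constructor <;> simp +contextual

/-- The memory holds `t` from the address `p` on, below the address `b`. -/
def InputAt (mem : ℕ → ℕ) (b p : ℕ) (t : List ℕ) : Prop :=
  p + t.length ≤ b ∧ ∀ i (hi : i < t.length), mem (p + i) = t[i]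

theorem InputAt.head {mem : ℕ → ℕ} {p x : ℕ} {t : List ℕ} (h : InputAt mem b p (x :: t)) :
    p < b ∧ mem p = x ∧ InputAt mem b (p + 1) t := by
  obtain ⟨h1, h2⟩ := h
  simp at h1
  refine ⟨by omega, h2 0 (by simp), by omega, fun i hi => ?_⟩
  have := h2 (i + 1) (by simpa using hi)
  rw [show p + (i + 1) = p + 1 + i by omega] at this
  simpa using this

theorem InputAt.append {mem : ℕ → ℕ} {p : ℕ} {t t' : List ℕ} (h : InputAt mem b p (t ++ t')) :
    InputAt mem b p t ∧ InputAt mem b (p + t.length) t' := by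
  obtain ⟨h1, h2⟩ := h
  simp at h1
  refine ⟨⟨by omega, fun i hi => ?_⟩, by omega, fun i hi => ?_⟩
  · have := h2 i (by simp; omega)
    rwa [List.getElem_append_left hi] at this
  · have := h2 (t.length + i) (by simp; omega)
    rw [List.getElem_append_right (by omega)] at this
    simpa [add_assoc] using this

theorem InputAt.congr {mem mem' : ℕ → ℕ} {p : ℕ} {t : List ℕ} (h : InputAt mem b p t)
    (hs : mem' = mem) : InputAt mem' b p t := hs ▸ h

theorem wordEdges_tail {p c t a : ℕ} {w : List ℕ} :
    wordEdges p c t (a :: w) = (c, (if w.length + 1 = 1 then t else p), a) ::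
      wordEdges (p + 1) (if w.length + 1 = 1 then t else p) t w := by
  cases w <;> simp [wordEdges]

theorem parseWord_spec (hb : s.reg .len = b) (hp : Pushed E s) {w : List ℕ} (hw : s.reg .rem = w.length)
    (hin : InputAt s.raw b (s.reg .pos) w) (hc : s.reg .cur < b) (ht : s.reg .tgt < b) (hW : 2 * b ≤ W) :
    wp b W parseWord (fun t s' => t ≤ 200 * w.length + 10 ∧ ParseKeep s s' ∧
      Pushed (E ++ wordEdges (s.reg .pos) (s.reg .cur) (s.reg .tgt) w) s' ∧
      s'.reg .pos = s.reg .pos + w.length) s := by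
  -- The invariant for `w'`: this suffix of the word is still to be read.
  have key := wp_while (b := b) (W := W) (c := .reg .rem) (s := s) (ι := List ℕ)
    (p := .set .lab (.inc (.raw (.reg .pos)) 1) ;;
    .ite (.eq (.reg .rem) (.lit 1)) (.set .dst (.reg .tgt)) (.set .dst (.reg .pos)) ;;
    pushCmd ;;
    .set .cur (.reg .dst) ;;
    .set .pos (.inc (.reg .pos) 1) ;;
    .set .rem (.sub (.reg .rem) (.lit 1)))
    (fun w' s' => ∃ E', Pushed E' s' ∧ ParseKeep s s' ∧ s'.reg .rem = w'.length ∧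
      InputAt s.raw b (s'.reg .pos) w' ∧ s'.reg .cur < b ∧ s'.reg .tgt = s.reg .tgt ∧
      E' ++ wordEdges (s'.reg .pos) (s'.reg .cur) (s.reg .tgt) w' =
        E ++ wordEdges (s.reg .pos) (s.reg .cur) (s.reg .tgt) w ∧
      s'.reg .pos + w'.length = s.reg .pos + w.length)
    (fun w' => 200 * w'.length + 10) ?_ ?_ (i := w)
    ⟨E, hp, ParseKeep.refl s, hw, hin, hc, rfl, rfl, rfl⟩
  · refine wp.mono key ?_
    rintro t s' ⟨htm, w', ⟨E', h1, h2, h3, h4, h5, h6, h7, h8⟩, he⟩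
    simp at he
    rw [he] at h3
    obtain rfl := List.length_eq_zero_iff.1 h3.symm
    simp [wordEdges] at h7 h8
    exact ⟨htm, h2, h7 ▸ h1, h8⟩
  · intro w' s' _; simp
  · rintro w' s' ⟨E', h1, h2, h3, h4, h5, h6, h7, h8⟩ hne
    cases w' with
    | nil => simp at h3; exact absurd h3 hne
    | cons a w' =>
      obtain ⟨g1, g2, g3⟩ := h4.head
      have hraw : s'.raw (s'.reg .pos) = a := by rw [h2.raw]; exact g2
      obtain ⟨y, hy⟩ : ∃ y, y = if w'.length + 1 = 1 then s.reg .tgt else s'.reg .pos := ⟨_, rfl⟩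
      have hyb : y < b := by rw [hy]; split <;> omega
      rw [wordEdges_tail, ← hy] at h7
      have hlen' : s'.reg .len = b := h2.len.trans hb
      have main : wp b W (pushCmd ;; .set .cur (.reg .dst) ;;
          .set .pos (.inc (.reg .pos) 1) ;; .set .rem (.sub (.reg .rem) (.lit 1)))
          (fun t s'' => t ≤ 150 ∧ ∃ E', Pushed E' s'' ∧ ParseKeep s s'' ∧ s''.reg .rem = w'.length ∧
            InputAt s.raw b (s''.reg .pos) w' ∧ s''.reg .cur < b ∧ s''.reg .tgt = s.reg .tgt ∧
            E' ++ wordEdges (s''.reg .pos) (s''.reg .cur) (s.reg .tgt) w' =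
              E ++ wordEdges (s.reg .pos) (s.reg .cur) (s.reg .tgt) w ∧
            s''.reg .pos + w'.length = s.reg .pos + w.length)
          ((s'.setR .lab (a + 1)).setR .dst y) := by
        rw [wp_seq]
        have hpush : Pushed E' ((s'.setR .lab (a + 1)).setR .dst y) := by
          constructor
          · simpa using h1.m
          · simpa using h1.lists
        refine (pushCmd_spec (a := a) hpush rfl rfl (by simp) (by simp [hlen']; omega)
          (by simp [hlen']; omega) (by simp [hlen']; omega)).mono ?_
        rintro t s₂ ⟨k1, k2, k3, k4, k5, k6, k7⟩
        simp at k2 k4 k5 k6 k7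
        simp only [wp_seq, wp_set, Ex.Ok, Ex.eval, Ex.cost, true_and, St.setR_reg, k4, k5, k6, k7,
          reduceCtorEq, if_true, if_false, h3, h6]
        refine ⟨by omega, E' ++ [(s'.reg .cur, y, a)], ⟨?_, ?_⟩, ?_, by simp, g3, hyb, ?_, ?_⟩
        rotate_left 2
        · refine h2.trans (ParseKeep.trans ?_ (k3.trans ?_))
          · constructor <;> simp
          · constructor <;> simp
        · rw [← h7]; simp
        · simp at h8; omega
        · simpa using k2.m
        · simpa using k2.lists
      simp only [wp_seq, wp_set, wp_ite, Ex.Ok, Ex.eval, Ex.cost, St.setR_reg, hraw, h3, h6,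
        reduceCtorEq, if_true, if_false, true_and, and_true, ne_eq, eqN_eq_zero, not_not,
        List.length_cons]
      refine ⟨g1, ?_, ?_⟩
      · intro hl
        rw [if_pos hl] at hy
        rw [wp_seq] at main
        rw [hy] at main
        refine main.mono ?_
        intro t s₂ hm
        simp only [wp_seq, wp_set, Ex.Ok, Ex.eval, Ex.cost, St.setR_reg, reduceCtorEq, if_true,
          if_false, true_and] at hm
        exact ⟨w', hm.2, by omega⟩
      · intro hl
        rw [if_neg hl] at hy
        rw [wp_seq] at main
        rw [hy] at main
        refine main.mono ?_
        intro t s₂ hm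
        simp only [wp_seq, wp_set, Ex.Ok, Ex.eval, Ex.cost, St.setR_reg, reduceCtorEq, if_true,
          if_false, true_and] at hm
        exact ⟨w', hm.2, by omega⟩

theorem parseRecs_spec (hb : s.reg .len = b) (hp : Pushed E s) {l : List (ℕ × ℕ × List ℕ)}
    (hin : InputAt s.raw b (s.reg .pos) (l.flatMap recNums))
    (hbl : s.reg .pos + (l.flatMap recNums).length = b)
    (hl : ∀ r ∈ l, 3 + r.1 < b ∧ 3 + r.2.1 < b) (hW : 2 * b ≤ W) :
    wp b W parseRecs (fun t s' => t ≤ 200 * (l.flatMap recNums).length + 10 ∧ ParseKeep s s' ∧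
      Pushed (E ++ recEdges (s.reg .pos) l) s') s := by
  have key := wp_while (b := b) (W := W) (c := .lt (.reg .pos) (.reg .len)) (s := s)
    (ι := List (ℕ × ℕ × List ℕ))
    (p := .set .cur (.inc (.raw (.reg .pos)) 3) ;;
    .set .tgt (.inc (.raw (.inc (.reg .pos) 1)) 3) ;;
    .set .rem (.raw (.inc (.reg .pos) 2)) ;;
    .set .pos (.inc (.reg .pos) 3) ;;
    parseWord)
    (fun l' s' => ∃ E', Pushed E' s' ∧ ParseKeep s s' ∧
      InputAt s.raw b (s'.reg .pos) (l'.flatMap recNums) ∧ (∀ r ∈ l', 3 + r.1 < b ∧ 3 + r.2.1 < b) ∧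
      E' ++ recEdges (s'.reg .pos) l' = E ++ recEdges (s.reg .pos) l ∧
      s'.reg .pos + (l'.flatMap recNums).length = b)
    (fun l' => 200 * (l'.flatMap recNums).length + 10) ?_ ?_ (i := l)
    ⟨E, hp, ParseKeep.refl s, hin, hl, rfl, hbl⟩
  · refine wp.mono key ?_
    rintro t s' ⟨htm, l', ⟨E', h1, h2, h3, h4, h5, h6⟩, he⟩
    simp [h2.len, hb] at he
    cases l' with
    | nil =>
      simp [recEdges] at h5
      exact ⟨htm, h2, h5 ▸ h1⟩
    | cons r l' => simp [recNums] at h6; omega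
  · intro w' s' _; simp
  · rintro l' s' ⟨E', h1, h2, h3, h4, h5, h6⟩ hne
    cases l' with
    | nil =>
      simp [h2.len, hb] at hne h6; omega
    | cons r l' =>
      obtain ⟨u, v, w⟩ := r
      have hr := h4 (u, v, w) (by simp)
      dsimp only at hr
      rw [List.flatMap_cons] at h3
      obtain ⟨g0, g⟩ := h3.append
      obtain ⟨a1, a2, a3⟩ := g0.head
      obtain ⟨b1, b2, b3⟩ := a3.head
      obtain ⟨c1, c2, c3⟩ := b3.head
      rw [← h2.raw] at a2 b2 c2
      have hlen' : s'.reg .len = b := h2.len.trans hb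
      simp only [wp_seq, wp_set, Ex.Ok, Ex.eval, Ex.cost, St.setR_reg,
        reduceCtorEq, if_false, true_and, St.setR_raw, a2, b2, c2]
      refine ⟨a1, b1, c1, ?_⟩
      refine (parseWord_spec (E := E') (w := w) (by simp [hlen']) ?_ (by simp) ?_ ?_ ?_ hW).mono ?_
      · constructor
        · simpa using h1.m
        · simpa using h1.lists
      · simp
        exact c3.congr h2.raw
      · simp; omega
      · simp; omega
      · rintro t s₂ ⟨k1, k2, k3, k4⟩
        simp at k3 k4
        refine ⟨l', ⟨_, k3, ?_, ?_, fun r hr => h4 r (by simp [hr]), ?_, ?_⟩, ?_⟩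
        · refine h2.trans (ParseKeep.trans ?_ k2)
          constructor <;> simp
        · rw [k4]
          have : s'.reg .pos + (recNums (u, v, w)).length = s'.reg .pos + 3 + w.length := by
            simp [recNums]; omega
          rw [← this]; exact g
        · rw [k4, ← h5]
          simp [recEdges, add_comm]
        · rw [← h6, k4, List.flatMap_cons, List.length_append]
          simp [recNums]; omega
        · rw [List.flatMap_cons, List.length_append]
          simp [recNums]; omega

theorem parseCmd_spec (hb : s.reg .len = b) (hm : s.reg .m = 0) {n i k : ℕ} {bits : List ℕ}
    {l : List (ℕ × ℕ × List ℕ)} (hbits : bits.length = n)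
    (hin : InputAt s.raw b 0 (n :: i :: k :: (bits ++ l.flatMap recNums)))
    (hbl : (n :: i :: k :: (bits ++ l.flatMap recNums)).length = b)
    (hl : ∀ r ∈ l, r.1 < n ∧ r.2.1 < n) (hW : 2 * b ≤ W) :
    wp b W parseCmd (fun t s' => t ≤ 200 * b + 100 ∧ Pushed (recEdges (3 + n) l) s' ∧
      s'.raw = s.raw ∧ s'.reg .len = b ∧ s'.reg .dbl = 2 * b ∧ s'.reg .num = n ∧
      s'.reg .ini = 3 + i ∧ ∀ a, a ≠ .ES → a ≠ .ED → a ≠ .EL → s'.arr a = s.arr a) s := by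
  obtain ⟨a1, a2, a3⟩ := hin.head
  obtain ⟨b1, b2, b3⟩ := a3.head
  obtain ⟨c1, c2, c3⟩ := b3.head
  have c4 := c3.append.2
  simp only [List.length_cons, List.length_append] at hbl
  unfold parseCmd
  simp only [wp_seq, wp_set, Ex.Ok, Ex.eval, Ex.cost, St.setR_reg, reduceCtorEq, if_false, if_true,
    true_and, St.setR_raw, a2, b2, hb]
  rw [zero_add] at b2 b1
  refine ⟨a1, b1, by omega, ?_⟩
  refine (parseRecs_spec (E := []) (l := l) (by simp [hb]) ?_ ?_ ?_ ?_ hW).mono ?_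
  · constructor
    · simp [hm]
    · simp [hm]
      constructor <;> simp
  · simp
    rw [← hbits]
    rw [show 0 + 1 + 1 + 1 + bits.length = bits.length + 3 by omega] at c4
    exact c4.congr rfl
  · simp only [St.setR_reg, reduceCtorEq, if_true, if_false]; omega
  · intro r hr
    have := hl r hr
    omega
  · rintro t s' ⟨h1, h2, h3⟩
    have e1 := h2.len; have e2 := h2.dbl; have e3 := h2.num; have e4 := h2.ini
    simp at e1 e2 e3 e4 h3
    refine ⟨by omega, ?_, h2.raw, by omega, by omega, e3, by omega, h2.arr⟩
    rwa [add_comm]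

end
end WheelerGraph

namespace WheelerGraph

open Refine Function Imp

/-! ### Best labels -/

/-- From `s` to `s'`, at most the registers in `R` and the arrays in `A` change. -/
structure Frame (R : List Reg) (A : List Arr) (s s' : St) : Prop where
  raw : s'.raw = s.raw
  reg : ∀ r, r ∉ R → s'.reg r = s.reg r
  arr : ∀ a, a ∉ A → s'.arr a = s.arr a

theorem Frame.refl (R : List Reg) (A : List Arr) (s : St) : Frame R A s s :=
  ⟨rfl, fun _ _ => rfl, fun _ _ => rfl⟩

theorem Frame.trans {R : List Reg} {A : List Arr} {s s' s'' : St} (h : Frame R A s s')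
    (h' : Frame R A s' s'') : Frame R A s s'' :=
  ⟨h'.raw.trans h.raw, fun r hr => (h'.reg r hr).trans (h.reg r hr),
    fun a ha => (h'.arr a ha).trans (h.arr a ha)⟩

/-- Compute the best labels of all nodes: the least one for the minimizing nodes, which are those below
`len`, and the greatest one for the others. The root `ini` gets `0`. -/
def labelCmd : Cmd :=
  .set .e (.lit 0) ;;
  .while (.lt (.reg .e) (.reg .m))
    (.set .x (.ld .ED (.reg .e)) ;;
    .set .k (.ld .EL (.reg .e)) ;;
    .set .y (.ld .LB (.reg .x)) ;;
    .ite (.or (.eq (.reg .y) (.lit 0))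
        (.eq (.lt (.reg .x) (.reg .len)) (.lt (.reg .k) (.reg .y))))
      (.st .LB (.reg .x) (.reg .k)) .skip ;;
    .set .e (.inc (.reg .e) 1)) ;;
  .st .LB (.reg .ini) (.lit 0)

/-- The best labels with respect to the edges below `m`. -/
structure LabelsTo (L m : ℕ) (dst el lb : ℕ → ℕ) : Prop where
  none : ∀ x, lb x = 0 → ∀ e < m, dst e ≠ x
  some : ∀ x, lb x ≠ 0 → ∃ e < m, dst e = x ∧ el e = lb x
  min : ∀ e < m, dst e < L → lb (dst e) ≤ el e
  max : ∀ e < m, L ≤ dst e → el e ≤ lb (dst e)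

section
variable {b W : ℕ} {s : St} {L m : ℕ} {dst el lb : ℕ → ℕ}

theorem LabelsTo.better (h : LabelsTo L m dst el lb) (hel : el m ≠ 0)
    (hb : lb (dst m) = 0 ∨ (dst m < L ↔ el m < lb (dst m))) :
    LabelsTo L (m + 1) dst el (update lb (dst m) (el m)) := by
  refine ⟨fun x hx e he => ?_, fun x hx => ?_, fun e he hL => ?_, fun e he hL => ?_⟩
  · rw [update_apply] at hx
    split at hx
    · omega
    · next h1 =>
      rcases lt_or_ge e m with h2 | h2
      · exact h.none x hx e h2
      · obtain rfl : e = m := by omega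
        exact Ne.symm h1
  · rw [update_apply] at hx ⊢
    split at hx
    · next h1 => rw [if_pos h1]; exact ⟨m, by omega, h1.symm, rfl⟩
    · next h1 =>
      obtain ⟨e, he, h2⟩ := h.some x hx
      rw [if_neg h1]
      exact ⟨e, by omega, h2⟩
  · rw [update_apply]
    rcases lt_or_ge e m with h2 | h2
    · split
      · next h1 =>
        have h3 := h.min e h2 hL
        rw [h1] at h3 hL
        have h4 : lb (dst m) ≠ 0 := fun h4 => h.none _ h4 e h2 h1
        have := (hb.resolve_left h4).1 hL
        omega
      · exact h.min e h2 hL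
    · obtain rfl : e = m := by omega
      simp
  · rw [update_apply]
    rcases lt_or_ge e m with h2 | h2
    · split
      · next h1 =>
        have h3 := h.max e h2 hL
        rw [h1] at h3 hL
        have h4 : lb (dst m) ≠ 0 := fun h4 => h.none _ h4 e h2 h1
        have := (hb.resolve_left h4)
        omega
      · exact h.max e h2 hL
    · obtain rfl : e = m := by omega
      simp

theorem LabelsTo.worse (h : LabelsTo L m dst el lb)
    (hb : ¬ (lb (dst m) = 0 ∨ (dst m < L ↔ el m < lb (dst m)))) :
    LabelsTo L (m + 1) dst el lb := by
  push Not at hb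
  obtain ⟨h0, hb⟩ := hb
  refine ⟨fun x hx e he => ?_, fun x hx => ?_, fun e he hL => ?_, fun e he hL => ?_⟩
  · rcases lt_or_ge e m with h2 | h2
    · exact h.none x hx e h2
    · obtain rfl : e = m := by omega
      rintro rfl; exact h0 hx
  · obtain ⟨e, he, h2⟩ := h.some x hx
    exact ⟨e, by omega, h2⟩
  · rcases lt_or_ge e m with h2 | h2
    · exact h.min e h2 hL
    · obtain rfl : e = m := by omega
      rcases hb with hb | hb <;> omega
  · rcases lt_or_ge e m with h2 | h2
    · exact h.max e h2 hL
    · obtain rfl : e = m := by omega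
      rcases hb with hb | hb <;> omega

theorem LabelsTo.labels (h : LabelsTo L m dst el lb) {r₀ : ℕ} (hr : r₀ < L) :
    Labels L m r₀ dst el (update lb r₀ 0) := by
  refine ⟨by simp, fun x hx hne => ?_, fun x hx => ?_, fun e he hL => ?_, fun e he hL => ?_⟩
  · rw [update_of_ne hne] at hx
    exact h.none x hx
  · by_cases h1 : x = r₀
    · simp [h1] at hx
    · rw [update_of_ne h1] at hx ⊢
      exact h.some x hx
  · rw [update_apply]
    split
    · exact Nat.zero_le _
    · exact h.min e he hL
  · rw [update_of_ne (by omega)]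
    exact h.max e he hL

theorem labelCmd_spec (hel : ∀ e < s.reg .m, s.arr .EL e ≠ 0) (hlb : ∀ x, s.arr .LB x = 0)
    (hini : s.reg .ini < s.reg .len) :
    wp b W labelCmd (fun t s' => t ≤ 100 * s.reg .m + 100 ∧
      Labels (s.reg .len) (s.reg .m) (s.reg .ini) (s.arr .ED) (s.arr .EL) (s'.arr .LB) ∧
      Frame [.e, .x, .k, .y] [.LB] s s') s := by
  unfold labelCmd
  simp only [wp_seq (q := Cmd.seq _ _), wp_set, Ex.Ok, Ex.eval, Ex.cost, true_and]
  rw [wp_seq]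
  have key := wp_while (b := b) (W := W) (c := .lt (.reg .e) (.reg .m)) (s := s.setR .e 0) (ι := ℕ)
    (p := .set .x (.ld .ED (.reg .e)) ;;
    .set .k (.ld .EL (.reg .e)) ;;
    .set .y (.ld .LB (.reg .x)) ;;
    .ite (.or (.eq (.reg .y) (.lit 0))
        (.eq (.lt (.reg .x) (.reg .len)) (.lt (.reg .k) (.reg .y))))
      (.st .LB (.reg .x) (.reg .k)) .skip ;;
    .set .e (.inc (.reg .e) 1))
    (fun i s' => i ≤ s.reg .m ∧ s'.reg .e = i ∧ Frame [.e, .x, .k, .y] [.LB] s s' ∧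
      LabelsTo (s.reg .len) i (s.arr .ED) (s.arr .EL) (s'.arr .LB))
    (fun i => 100 * (s.reg .m - i) + 10) ?_ ?_ (i := 0)
    ⟨Nat.zero_le _, by simp, by constructor <;> simp +contextual, by constructor <;> simp [hlb]⟩
  · refine key.mono ?_
    rintro t s' ⟨ht, i, ⟨h1, h2, h3, h4⟩, h5⟩
    have hm := h3.reg .m (by decide)
    have hi := h3.reg .ini (by decide)
    simp [hm, h2] at h5
    obtain rfl : i = s.reg .m := by omega
    simp only [wp_st, Ex.Ok, Ex.eval, Ex.cost, true_and]
    refine ⟨by omega, ?_, h3.trans ?_⟩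
    · simpa [hi] using h4.labels hini
    · constructor <;> simp +contextual
  · intro i s' _; simp
  · rintro i s' ⟨h1, h2, h3, h4⟩ hne
    have hm := h3.reg .m (by decide)
    have hlen := h3.reg .len (by decide)
    have hed := h3.arr .ED (by decide)
    have hell := h3.arr .EL (by decide)
    have hbit : ∀ a b c d : ℕ, eqN (ltN a b) (ltN c d) ≠ 0 ↔ (a < b ↔ c < d) := by
      intro a b c d
      unfold eqN ltN
      by_cases h1 : a < b <;> by_cases h2 : c < d <;> simp [h1, h2]
    simp [hm, h2] at hne
    simp only [wp_seq, wp_set, wp_st, wp_ite, wp_skip, Ex.Ok, Ex.eval, Ex.cost, St.setR_reg,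
      St.setR_arr, reduceCtorEq, if_true, if_false, true_and, h2, hed, hell, hlen]
    have hcond : orN (eqN (s'.arr .LB (s.arr .ED i)) 0)
        (eqN (ltN (s.arr .ED i) (s.reg .len)) (ltN (s.arr .EL i) (s'.arr .LB (s.arr .ED i)))) ≠ 0 ↔
        s'.arr .LB (s.arr .ED i) = 0 ∨
          (s.arr .ED i < s.reg .len ↔ s.arr .EL i < s'.arr .LB (s.arr .ED i)) := by
      rw [← hbit]
      rw [ne_eq, orN_eq_zero, eqN_eq_zero]
      tauto
    refine ⟨fun h => ?_, fun h => ?_⟩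
    · refine ⟨i + 1, ⟨hne, ?_, h3.trans ?_, ?_⟩, ?_⟩
      · simp [h2]
      · constructor <;> simp +contextual
      · simpa using h4.better (hel i hne) (hcond.1 h)
      · omega
    · refine ⟨i + 1, ⟨hne, ?_, h3.trans ?_, ?_⟩, ?_⟩
      · simp
      · constructor <;> simp +contextual
      · simpa using h4.worse (fun h' => hcond.2 h' h)
      · omega

/-! ### Lists of live edges -/

/-- Link the live edges by their sources, and count them by their targets. -/
def linkCmd : Cmd :=
  .set .e (.lit 0) ;;
  .while (.lt (.reg .e) (.reg .m))
    (.set .x (.ld .ED (.reg .e)) ;;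
    .ite (.eq (.ld .EL (.reg .e)) (.ld .LB (.reg .x)))
      (.set .y (.ld .ES (.reg .e)) ;;
      .st .NX (.reg .e) (.ld .HD (.reg .y)) ;;
      .st .HD (.reg .y) (.inc (.reg .e) 1) ;;
      .st .CN (.reg .x) (.inc (.ld .CN (.reg .x)) 1)) .skip ;;
    .set .e (.inc (.reg .e) 1))

/-- The number of live edges below `m` into `x`. -/
noncomputable def inTo (G : Gr) (m x : ℕ) : ℕ := by
  classical exact {e ∈ Finset.range m | G.live e ∧ G.dst e = x}.card

theorem inTo_succ (G : Gr) (m x : ℕ) [Decidable (G.live m ∧ G.dst m = x)] :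
    inTo G (m + 1) x = inTo G m x + if G.live m ∧ G.dst m = x then 1 else 0 := by
  classical
  unfold inTo
  rw [Finset.range_add_one, Finset.filter_insert]
  split
  · rw [Finset.card_insert_of_notMem (by simp)]
  · rfl

theorem isTop_succ {G : Gr} {y m h : ℕ} (ht : IsTop G y m h) (hm : ¬ (G.live m ∧ G.src m = y)) :
    IsTop G y (m + 1) h := by
  have : ∀ e, G.live e → G.src e = y → e ≠ m := by
    rintro e h1 h2 rfl; exact hm ⟨h1, h2⟩
  rcases ht with ⟨h0, h1⟩ | ⟨e, he, h1, h2, h3, h4⟩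
  · refine Or.inl ⟨h0, fun e he hl hs => h1 e ?_ hl hs⟩
    have := this e hl hs; omega
  · refine Or.inr ⟨e, by omega, h1, h2, h3, fun e' he' hlt hl hs => h4 e' ?_ hlt hl hs⟩
    have := this e' hl hs; omega

theorem linkCmd_spec {G : Gr} (hM : G.M = s.reg .m) (hsrc : G.src = s.arr .ES)
    (hdst : G.dst = s.arr .ED) (hlive : ∀ e, G.live e ↔ s.arr .EL e = s.arr .LB (s.arr .ED e))
    (hhd : ∀ x, s.arr .HD x = 0) (hcn : ∀ x, s.arr .CN x = 0) :
    wp b W linkCmd (fun t s' => t ≤ 200 * s.reg .m + 100 ∧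
      (∀ y, IsTop G y G.M (s'.arr .HD y)) ∧
      (∀ e < G.M, G.live e → IsTop G (G.src e) e (s'.arr .NX e)) ∧
      (∀ x, s'.arr .CN x = inTo G G.M x) ∧
      Frame [.e, .x, .y] [.NX, .HD, .CN] s s') s := by
  classical
  unfold linkCmd
  simp only [wp_seq (q := Cmd.while _ _), wp_set, Ex.Ok, Ex.eval, Ex.cost, true_and]
  have key := wp_while (b := b) (W := W) (c := .lt (.reg .e) (.reg .m)) (s := s.setR .e 0) (ι := ℕ)
    (p := .set .x (.ld .ED (.reg .e)) ;;
    .ite (.eq (.ld .EL (.reg .e)) (.ld .LB (.reg .x)))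
      (.set .y (.ld .ES (.reg .e)) ;;
      .st .NX (.reg .e) (.ld .HD (.reg .y)) ;;
      .st .HD (.reg .y) (.inc (.reg .e) 1) ;;
      .st .CN (.reg .x) (.inc (.ld .CN (.reg .x)) 1)) .skip ;;
    .set .e (.inc (.reg .e) 1))
    (fun i s' => i ≤ s.reg .m ∧ s'.reg .e = i ∧ Frame [.e, .x, .y] [.NX, .HD, .CN] s s' ∧
      (∀ y, IsTop G y i (s'.arr .HD y)) ∧
      (∀ e < i, G.live e → IsTop G (G.src e) e (s'.arr .NX e)) ∧
      (∀ x, s'.arr .CN x = inTo G i x))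
    (fun i => 200 * (s.reg .m - i) + 10) ?_ ?_ (i := 0)
    ⟨Nat.zero_le _, by simp, by constructor <;> simp +contextual,
      fun y => Or.inl ⟨hhd y, by simp⟩, by simp, by simp [hcn, inTo]⟩
  · refine key.mono ?_
    rintro t s' ⟨ht, i, ⟨h1, h2, h3, h4, h5, h6⟩, he⟩
    have hm := h3.reg .m (by decide)
    simp [hm, h2] at he
    obtain rfl : i = s.reg .m := by omega
    rw [hM]
    exact ⟨by omega, h4, h5, h6, h3⟩
  · intro i s' _; simp
  · rintro i s' ⟨h1, h2, h3, h4, h5, h6⟩ hne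
    have hm := h3.reg .m (by decide)
    have hed := h3.arr .ED (by decide)
    have hel := h3.arr .EL (by decide)
    have hes := h3.arr .ES (by decide)
    have hlb := h3.arr .LB (by decide)
    simp [hm, h2] at hne
    simp only [wp_seq, wp_set, wp_st, wp_ite, wp_skip, Ex.Ok, Ex.eval, Ex.cost, St.setR_reg,
      St.setR_arr, reduceCtorEq, if_true, if_false, true_and, h2, hed, hel, hes, hlb, eqN_eq_zero,
      ne_eq, not_not, ← hlive, St.setA_arr, St.setA_reg]
    refine ⟨fun h => ?_, fun h => ?_⟩
    · refine ⟨i + 1, ⟨hne, ?_, h3.trans ?_, ?_, ?_, ?_⟩, ?_⟩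
      · simp
      · constructor <;> simp +contextual
      · intro y
        simp only [← hsrc, update_apply]
        split
        · next hy => exact Or.inr ⟨i, by omega, rfl, h, hy.symm, fun e' _ _ => by omega⟩
        · next hy => exact isTop_succ (h4 y) fun h' => hy h'.2.symm
      · intro e he hl
        simp only [← hsrc, update_apply]
        split
        · next hy => subst hy; exact h4 _
        · next hy => exact h5 e (by omega) hl
      · intro x
        rw [inTo_succ]
        simp only [← hdst, update_apply]
        by_cases hx : x = G.dst i
        · simp [hx, h, h6]
        · simp [hx, Ne.symm hx, h6]
      · omega
    · refine ⟨i + 1, ⟨hne, ?_, h3.trans ?_, ?_, ?_, ?_⟩, ?_⟩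
      · simp
      · constructor <;> simp +contextual
      · intro y
        exact isTop_succ (h4 y) fun h' => h h'.1
      · intro e he hl
        have : e ≠ i := by rintro rfl; exact h hl
        exact h5 e (by omega) hl
      · intro x
        rw [inTo_succ]
        simp [h, h6]
      · omega

end
end WheelerGraph

namespace WheelerGraph

open Refine Function Imp

/-! ### Sorting with a tournament tree -/

/-- Set the winner at the inner node `i` of the tournament. The tournament is a heap-indexed tree with
`dbl` leaves: the inner nodes are `1, …, dbl - 1`, the children of `i` are `2 * i` and `2 * i + 1`,
and the leaf of the node `x` is `dbl + x`; this works for any number of leaves. -/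
def winCmd : Cmd :=
  .set .y (.ld .TR (.add (.reg .i) (.reg .i))) ;;
  .set .z (.ld .TR (.inc (.add (.reg .i) (.reg .i)) 1)) ;;
  .ite (.lt (.ld .KY (.reg .y)) (.ld .KY (.reg .z))) (.st .TR (.reg .i) (.reg .z))
    (.st .TR (.reg .i) (.reg .y))

/-- Set the keys and the leaves of the tournament. -/
def leafCmd : Cmd :=
  .set .i (.lit 0) ;;
  .while (.lt (.reg .i) (.reg .dbl))
    (.st .KY (.reg .i) (.inc (.ld .LB (.reg .i)) 1) ;;
    .st .TR (.add (.reg .dbl) (.reg .i)) (.reg .i) ;;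
    .set .i (.inc (.reg .i) 1))

/-- Play all matches of the tournament. -/
def playCmd : Cmd :=
  .set .i (.sub (.reg .dbl) (.lit 1)) ;;
  .while (.reg .i) (winCmd ;; .set .i (.sub (.reg .i) (.lit 1)))

/-- Play the matches above the node `i` of the tournament again. -/
def replayCmd : Cmd :=
  .while (.lt (.lit 1) (.reg .i)) (.set .i (.half (.reg .i)) ;; winCmd)

/-- List the nodes by increasing label: the current winner comes last, and leaves. -/
def extractCmd : Cmd :=
  .set .k (.reg .dbl) ;;
  .while (.reg .k)
    (.set .k (.sub (.reg .k) (.lit 1)) ;;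
    .set .x (.ld .TR (.lit 1)) ;;
    .st .EM (.reg .k) (.reg .x) ;;
    .st .PS (.reg .x) (.reg .k) ;;
    .st .KY (.reg .x) (.lit 0) ;;
    .set .i (.add (.reg .dbl) (.reg .x)) ;;
    replayCmd)

/-- Sort the nodes by label. -/
def sortCmd : Cmd := leafCmd ;; playCmd ;; extractCmd

/-- The match at the inner node `j` has been decided correctly. -/
def Won (KY TR : ℕ → ℕ) (j : ℕ) : Prop :=
  TR j = if KY (TR (2 * j)) < KY (TR (2 * j + 1)) then TR (2 * j + 1) else TR (2 * j)

theorem Won.congr {KY TR TR' : ℕ → ℕ} {j : ℕ} (h : Won KY TR j) (h1 : TR' j = TR j)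
    (h2 : TR' (2 * j) = TR (2 * j)) (h3 : TR' (2 * j + 1) = TR (2 * j + 1)) : Won KY TR' j := by
  unfold Won
  rw [h1, h2, h3]
  exact h

theorem Won.key {KY TR : ℕ → ℕ} {j : ℕ} (h : Won KY TR j) :
    KY (TR (2 * j)) ≤ KY (TR j) ∧ KY (TR (2 * j + 1)) ≤ KY (TR j) := by
  unfold Won at h
  split at h <;> rw [h] <;> omega

theorem Won.eq {KY TR : ℕ → ℕ} {j : ℕ} (h : Won KY TR j) :
    TR j = TR (2 * j) ∨ TR j = TR (2 * j + 1) := by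
  unfold Won at h
  split at h
  · exact Or.inr h
  · exact Or.inl h

/-- The node `j` of the tournament is `i` or above it. -/
def Above (j i : ℕ) : Prop := ∃ k, i / 2 ^ k = j

theorem Above.eq_or {j i : ℕ} (h : Above j i) : j = i ∨ Above j (i / 2) := by
  obtain ⟨k, hk⟩ := h
  cases k with
  | zero => simp at hk; exact Or.inl hk.symm
  | succ k => exact Or.inr ⟨k, by rw [← hk, Nat.div_div_eq_div_mul, pow_succ']⟩

theorem Above.parent {j i : ℕ} (h : Above j i) : Above (j / 2) i := by
  obtain ⟨k, hk⟩ := h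
  exact ⟨k + 1, by rw [← hk, Nat.div_div_eq_div_mul, pow_succ]⟩

section
variable {N : ℕ} {KY TR : ℕ → ℕ}

/-- The winner of a match takes part in it. -/
theorem above_of_tr (hleaf : ∀ x < N, TR (N + x) = x) (hw : ∀ j, 1 ≤ j → j < N → Won KY TR j)
    {j : ℕ} (h1 : 1 ≤ j) (h2 : j < 2 * N) : TR j < N ∧ Above j (N + TR j) := by
  induction hn : 2 * N - j using Nat.strong_induction_on generalizing j with
  | _ m ih =>
    rcases lt_or_ge j N with hj | hj
    · have e1 : 2 * j / 2 = j := by omega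
      have e2 : (2 * j + 1) / 2 = j := by omega
      rcases (hw j h1 hj).eq with h | h
      · have := ih _ (by omega) (j := 2 * j) (by omega) (by omega) rfl
        rw [← h] at this
        have h3 := this.2.parent
        rw [e1] at h3
        exact ⟨this.1, h3⟩
      · have := ih _ (by omega) (j := 2 * j + 1) (by omega) (by omega) rfl
        rw [← h] at this
        have h3 := this.2.parent
        rw [e2] at h3
        exact ⟨this.1, h3⟩
    · have := hleaf (j - N) (by omega)
      rw [show N + (j - N) = j by omega] at this
      rw [this]
      exact ⟨by omega, 0, by simp; omega⟩

/-- The key of the overall winner is maximal. -/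
theorem key_le_top (hleaf : ∀ x < N, TR (N + x) = x) (hw : ∀ j, 1 ≤ j → j < N → Won KY TR j)
    {x : ℕ} (hx : x < N) : KY x ≤ KY (TR 1) := by
  have : ∀ j, 1 ≤ j → j < 2 * N → KY (TR j) ≤ KY (TR 1) := by
    intro j
    induction j using Nat.strong_induction_on with
    | _ j ih =>
      intro h1 h2
      rcases Nat.eq_or_lt_of_le h1 with rfl | h1
      · exact le_rfl
      · have h3 := ih (j / 2) (by omega) (by omega) (by omega)
        have h4 := (hw (j / 2) (by omega) (by omega)).key
        rcases Nat.even_or_odd' j with ⟨c, rfl | rfl⟩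
        · rw [show 2 * c / 2 = c by omega] at *; omega
        · rw [show (2 * c + 1) / 2 = c by omega] at *; omega
  have h := this (N + x) (by omega) (by omega)
  rwa [hleaf x hx] at h

end

section
variable {b W : ℕ} {s : St} {N : ℕ}

theorem winCmd_spec {i : ℕ} (hi : s.reg .i = i) (h0 : 1 ≤ i) (hW : 2 * i ≤ W) :
    wp b W winCmd (fun t s' => t ≤ 80 ∧ Won (s.arr .KY) (s'.arr .TR) i ∧
      (∀ j, j ≠ i → s'.arr .TR j = s.arr .TR j) ∧ Frame [.y, .z] [.TR] s s') s := by
  unfold winCmd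
  have e1 : 2 * i ≠ i := by omega
  have e2 : 2 * i + 1 ≠ i := by omega
  have e3 : i + i = 2 * i := by omega
  simp only [wp_seq, wp_set, wp_st, wp_ite, Ex.Ok, Ex.eval, Ex.cost, St.setR_reg,
    St.setR_arr, reduceCtorEq, if_true, if_false, true_and, hi, ne_eq, ltN_eq_zero, not_le,
    and_true, e3]
  refine ⟨hW, hW, fun h => ⟨by omega, ?_, fun j hj => by simp [hj], ?_⟩, fun h => ⟨by omega, ?_,
    fun j hj => by simp [hj], ?_⟩⟩
  · simp [Won, e1, e2, h]
  · constructor <;> simp +contextual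
  · simp [Won, e1, e2, not_lt.2 h]
  · constructor <;> simp +contextual

theorem leafCmd_spec (hN : s.reg .dbl = N) (hW : 2 * N ≤ W) :
    wp b W leafCmd (fun t s' => t ≤ 100 * N + 100 ∧ (∀ x < N, s'.arr .TR (N + x) = x) ∧
      (∀ x < N, s'.arr .KY x = s.arr .LB x + 1) ∧ Frame [.i] [.KY, .TR] s s') s := by
  unfold leafCmd
  simp only [wp_seq (q := Cmd.while _ _), wp_set, Ex.Ok, Ex.eval, Ex.cost, true_and]
  have key := wp_while (b := b) (W := W) (c := .lt (.reg .i) (.reg .dbl)) (s := s.setR .i 0) (ι := ℕ)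
    (p := .st .KY (.reg .i) (.inc (.ld .LB (.reg .i)) 1) ;;
    .st .TR (.add (.reg .dbl) (.reg .i)) (.reg .i) ;;
    .set .i (.inc (.reg .i) 1))
    (fun i s' => i ≤ N ∧ s'.reg .i = i ∧ (∀ x < i, s'.arr .TR (N + x) = x) ∧
      (∀ x < i, s'.arr .KY x = s.arr .LB x + 1) ∧ Frame [.i] [.KY, .TR] s s')
    (fun i => 100 * (N - i) + 10) ?_ ?_ (i := 0)
    ⟨Nat.zero_le _, by simp, by simp, by simp, by constructor <;> simp +contextual⟩
  · refine key.mono ?_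
    rintro t s' ⟨ht, i, ⟨h1, h2, h3, h4, h5⟩, he⟩
    have hd := h5.reg .dbl (by decide)
    simp [hd, h2, hN] at he
    obtain rfl : i = N := by omega
    exact ⟨by omega, h3, h4, h5⟩
  · intro i s' _; simp
  · rintro i s' ⟨h1, h2, h3, h4, h5⟩ hne
    have hd := (h5.reg .dbl (by decide)).trans hN
    have hlb := h5.arr .LB (by decide)
    simp [hd, h2] at hne
    simp only [wp_seq, wp_set, wp_st, Ex.Ok, Ex.eval, Ex.cost, true_and, hd, h2, hlb,
      St.setA_reg]
    refine ⟨by omega, i + 1, ⟨hne, by simp, fun x hx => ?_, fun x hx => ?_, h5.trans ?_⟩, by omega⟩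
    · rcases lt_or_ge x i with h | h
      · have : x ≠ i := by omega
        simp [this, h3 x h]
      · obtain rfl : x = i := by omega
        simp
    · rcases lt_or_ge x i with h | h
      · have : x ≠ i := by omega
        simp [this, h4 x h]
      · obtain rfl : x = i := by omega
        simp
    · constructor <;> simp +contextual

theorem playCmd_spec (hN : s.reg .dbl = N) (hW : 2 * N ≤ W) :
    wp b W playCmd (fun t s' => t ≤ 100 * N + 100 ∧
      (∀ j, 1 ≤ j → j < N → Won (s.arr .KY) (s'.arr .TR) j) ∧
      (∀ j, N ≤ j → s'.arr .TR j = s.arr .TR j) ∧ Frame [.i, .y, .z] [.TR] s s') s := by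
  unfold playCmd
  simp only [wp_seq (q := Cmd.while _ _), wp_set, Ex.Ok, Ex.eval, Ex.cost, true_and]
  have key := wp_while (b := b) (W := W) (c := .reg .i) (s := s.setR .i (s.reg .dbl - 1)) (ι := ℕ)
    (p := winCmd ;; .set .i (.sub (.reg .i) (.lit 1)))
    (fun i s' => i ≤ N - 1 ∧ s'.reg .i = i ∧
      (∀ j, i < j → j < N → Won (s.arr .KY) (s'.arr .TR) j) ∧
      (∀ j, N ≤ j → s'.arr .TR j = s.arr .TR j) ∧ Frame [.i, .y, .z] [.TR] s s')
    (fun i => 100 * i + 10) ?_ ?_ (i := N - 1)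
    ⟨le_rfl, by simp [hN], fun j _ _ => by omega, fun _ _ => rfl,
      by constructor <;> simp +contextual⟩
  · refine key.mono ?_
    rintro t s' ⟨ht, i, ⟨h1, h2, h3, h4, h5⟩, he⟩
    simp [h2] at he
    subst he
    exact ⟨by omega, fun j hj => h3 j hj, h4, h5⟩
  · intro i s' _; simp
  · rintro i s' ⟨h1, h2, h3, h4, h5⟩ hne
    simp [h2] at hne
    rw [wp_seq]
    refine (winCmd_spec h2 (by omega) (by omega)).mono ?_
    rintro t s₂ ⟨k1, k2, k3, k4⟩
    have hky := h5.arr .KY (by decide)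
    have hi2 := k4.reg .i (by decide)
    simp only [wp_set, Ex.Ok, Ex.eval, Ex.cost, true_and, hi2, h2]
    refine ⟨i - 1, ⟨by omega, by simp, fun j hj hjN => ?_, fun j hj => ?_, h5.trans (Frame.trans (s' := s₂) ?_ ?_)⟩,
      by omega⟩
    · rcases Nat.eq_or_lt_of_le (show i ≤ j by omega) with rfl | h
      · simpa [hky] using k2
      · exact (h3 j h hjN).congr (k3 _ (by omega)) (k3 _ (by omega)) (k3 _ (by omega))
    · simp only [St.setR_arr]
      rw [k3 _ (by omega), h4 j hj]
    · exact ⟨k4.raw, fun r hr => k4.reg r (by simp at hr ⊢; tauto), k4.arr⟩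
    · constructor <;> simp +contextual

/-- Only the matches above `i` may have been decided wrongly; they are played again. -/
theorem replayCmd_spec {i : ℕ} (hi : s.reg .i = i) (h1 : 1 ≤ i) (h2 : i < 2 * N) (hW : 2 * N ≤ W)
    (hw : ∀ j, 1 ≤ j → j < N → Won (s.arr .KY) (s.arr .TR) j ∨ Above j (i / 2)) :
    wp b W replayCmd (fun t s' => t ≤ 100 * Nat.log 2 (2 * N) + 100 ∧
      (∀ j, 1 ≤ j → j < N → Won (s.arr .KY) (s'.arr .TR) j) ∧
      (∀ j, N ≤ j → s'.arr .TR j = s.arr .TR j) ∧ Frame [.i, .y, .z] [.TR] s s') s := by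
  unfold replayCmd
  have key := wp_while (b := b) (W := W) (c := .lt (.lit 1) (.reg .i)) (s := s) (ι := ℕ)
    (p := .set .i (.half (.reg .i)) ;; winCmd)
    (fun i s' => 1 ≤ i ∧ i < 2 * N ∧ s'.reg .i = i ∧
      (∀ j, 1 ≤ j → j < N → Won (s.arr .KY) (s'.arr .TR) j ∨ Above j (i / 2)) ∧
      (∀ j, N ≤ j → s'.arr .TR j = s.arr .TR j) ∧ Frame [.i, .y, .z] [.TR] s s')
    (fun i => 100 * Nat.log 2 i + 10) ?_ ?_ (i := i)
    ⟨h1, h2, hi, hw, fun _ _ => rfl, Frame.refl _ _ _⟩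
  · refine key.mono ?_
    rintro t s' ⟨ht, i', ⟨g1, g2, g3, g4, g5, g6⟩, he⟩
    simp [g3] at he
    obtain rfl : i' = 1 := by omega
    refine ⟨?_, fun j hj hjN => ?_, g5, g6⟩
    · have : Nat.log 2 i ≤ Nat.log 2 (2 * N) := Nat.log_mono_right (by omega)
      omega
    · refine (g4 j hj hjN).resolve_right ?_
      rintro ⟨k, hk⟩
      simp at hk
      omega
  · intro i s' _; simp
  · rintro i s' ⟨g1, g2, g3, g4, g5, g6⟩ hne
    simp [g3] at hne
    simp only [wp_seq, wp_set, Ex.Ok, Ex.eval, Ex.cost, true_and, g3]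
    refine (winCmd_spec (i := i / 2) (by simp) (by omega) (by omega)).mono ?_
    rintro t s₂ ⟨k1, k2, k3, k4⟩
    simp only [St.setR_arr] at k2 k3
    have hky := g6.arr .KY (by decide)
    have hi2 := k4.reg .i (by decide)
    simp at hi2
    refine ⟨i / 2, ⟨by omega, by omega, hi2, fun j hj hjN => ?_, fun j hj => ?_, g6.trans (Frame.trans (s' := s'.setR .i (i / 2)) ?_ ?_)⟩, ?_⟩
    · by_cases hji : j = i / 2
      · subst hji
        left; rwa [← hky]
      · by_cases ha : Above j (i / 2 / 2)
        · exact Or.inr ha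
        · left
          have h3 := (g4 j hj hjN).resolve_right fun h => by
            rcases h.eq_or with h | h
            · exact hji h
            · exact ha h
          have h4 : j ≠ i / 2 / 2 := fun h => ha ⟨0, by simp [h]⟩
          exact h3.congr (k3 _ (by omega)) (k3 _ (by omega)) (k3 _ (by omega))
    · rw [k3 _ (by omega), g5 j hj]
    · constructor <;> simp +contextual
    · exact ⟨k4.raw, fun r hr => k4.reg r (by simp at hr ⊢; tauto), k4.arr⟩
    · rw [Nat.log_of_one_lt_of_le (b := 2) (n := i) (by omega) (by omega)]
      omega

/-- The state of the sorting when `k` nodes are left; the others have key `0` and are listed. -/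
structure Extract (N k : ℕ) (LB : ℕ → ℕ) (s : St) : Prop where
  leaf : ∀ x < N, s.arr .TR (N + x) = x
  won : ∀ j, 1 ≤ j → j < N → Won (s.arr .KY) (s.arr .TR) j
  key : ∀ y < N, s.arr .KY y = 0 ∨ s.arr .KY y = LB y + 1
  card : {y ∈ Finset.range N | s.arr .KY y ≠ 0}.card = k
  em : ∀ p, k ≤ p → p < N →
    s.arr .EM p < N ∧ s.arr .PS (s.arr .EM p) = p ∧ s.arr .KY (s.arr .EM p) = 0
  ps : ∀ y < N, s.arr .KY y = 0 → k ≤ s.arr .PS y ∧ s.arr .PS y < N ∧ s.arr .EM (s.arr .PS y) = y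
  sorted : ∀ p p', k ≤ p → p < p' → p' < N → LB (s.arr .EM p) ≤ LB (s.arr .EM p')
  rest : ∀ y < N, s.arr .KY y ≠ 0 → ∀ p, k ≤ p → p < N → LB y ≤ LB (s.arr .EM p)

/-- Setting the key of the winner to `0` removes it: only the matches above its leaf change. -/
theorem extractCmd_spec {LB : ℕ → ℕ} (hN : s.reg .dbl = N) (hN1 : 1 ≤ N) (hW : 2 * N ≤ W)
    (hs : Extract N N LB s) :
    wp b W extractCmd (fun t s' => t ≤ N * (100 * Nat.log 2 (2 * N) + 300) + 100 ∧
      Extract N 0 LB s' ∧ Frame [.k, .x, .i, .y, .z] [.KY, .TR, .EM, .PS] s s') s := by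
  unfold extractCmd
  simp only [wp_seq (q := Cmd.while _ _), wp_set, Ex.Ok, Ex.eval, Ex.cost, true_and]
  have key := wp_while (b := b) (W := W) (c := .reg .k) (s := s.setR .k (s.reg .dbl)) (ι := ℕ)
    (p := .set .k (.sub (.reg .k) (.lit 1)) ;;
    .set .x (.ld .TR (.lit 1)) ;;
    .st .EM (.reg .k) (.reg .x) ;;
    .st .PS (.reg .x) (.reg .k) ;;
    .st .KY (.reg .x) (.lit 0) ;;
    .set .i (.add (.reg .dbl) (.reg .x)) ;;
    replayCmd)
    (fun k s' => k ≤ N ∧ s'.reg .k = k ∧ Extract N k LB s' ∧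
      Frame [.k, .x, .i, .y, .z] [.KY, .TR, .EM, .PS] s s')
    (fun k => k * (100 * Nat.log 2 (2 * N) + 300) + 10) ?_ ?_ (i := N)
    ⟨le_rfl, by simp [hN], ?_, by constructor <;> simp +contextual⟩
  · refine key.mono ?_
    rintro t s' ⟨ht, k, ⟨h1, h2, h3, h4⟩, he⟩
    simp [h2] at he
    subst he
    exact ⟨by omega, h3, h4⟩
  · intro i s' _; simp
  · rintro k s' ⟨h1, h2, h3, h4⟩ hne
    simp [h2] at hne
    obtain ⟨k, rfl⟩ := Nat.exists_eq_succ_of_ne_zero hne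
    obtain ⟨x, hx⟩ : ∃ x, x = s'.arr .TR 1 := ⟨_, rfl⟩
    have hd := (h4.reg .dbl (by decide)).trans hN
    have hxN : x < N := by
      rw [hx]; exact (above_of_tr h3.leaf h3.won le_rfl (by omega)).1
    have hmax : ∀ y < N, s'.arr .KY y ≤ s'.arr .KY x := by
      intro y hy
      rw [hx]
      exact key_le_top h3.leaf h3.won hy
    have hx0 : s'.arr .KY x ≠ 0 := by
      have : 0 < {y ∈ Finset.range N | s'.arr .KY y ≠ 0}.card := by rw [h3.card]; omega
      obtain ⟨y, hy⟩ := Finset.card_pos.1 this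
      simp only [Finset.mem_filter, Finset.mem_range] at hy
      have := hmax y hy.1
      omega
    have hxk := (h3.key x hxN).resolve_left hx0
    simp only [wp_seq, wp_set, wp_st, Ex.Ok, Ex.eval, Ex.cost, true_and, h2, ← hx, hd,
      St.setA_reg, St.setR_reg, St.setR_arr, reduceCtorEq, if_true, if_false, Nat.succ_eq_add_one,
      Nat.add_sub_cancel]
    refine ⟨by omega, ?_⟩
    have ha : ∀ j, 1 ≤ j → j < 2 * N → s'.arr .TR j = x → Above j (N + x) := by
      intro j hj hj' h
      have := (above_of_tr h3.leaf h3.won hj hj').2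
      rwa [h] at this
    refine (replayCmd_spec (i := N + x) (N := N) (by simp) (by omega) (by omega) hW ?_).mono ?_
    · intro j hj hjN
      by_cases hab : Above j (N + x)
      · exact Or.inr (hab.eq_or.resolve_left (by omega))
      · left
        have g1 : s'.arr .TR (2 * j) ≠ x := fun h => hab (by
          have := (ha (2 * j) (by omega) (by omega) h).parent
          rwa [show 2 * j / 2 = j by omega] at this)
        have g2 : s'.arr .TR (2 * j + 1) ≠ x := fun h => hab (by
          have := (ha (2 * j + 1) (by omega) (by omega) h).parent
          rwa [show (2 * j + 1) / 2 = j by omega] at this)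
        have := h3.won j hj hjN
        unfold Won at this ⊢
        simpa [update_apply, g1, g2] using this
    · rintro t s₂ ⟨k1, k2, k3, k4⟩
      have e1 := k4.arr .KY (by decide)
      have e2 := k4.arr .EM (by decide)
      have e3 := k4.arr .PS (by decide)
      have e4 := k4.reg .k (by decide)
      simp at e1 e2 e3 e4
      refine ⟨k, ⟨by omega, e4, ?_, h4.trans (Frame.trans (s' := (((((((s'.setR .k k).setR .x x).setA
        .EM k x).setA .PS x k).setA .KY x 0).setR .i (N + x))) ) ?_ ?_)⟩, ?_⟩
      · refine ⟨fun y hy => ?_, ?_, fun y hy => ?_, ?_, ?_, ?_, ?_, ?_⟩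
        · rw [k3 _ (by omega)]
          simpa using h3.leaf y hy
        · have : s₂.arr .KY = update (s'.arr .KY) x 0 := e1
          rw [this]
          simpa using k2
        · rw [e1, update_apply]
          split
          · exact Or.inl rfl
          · exact h3.key y hy
        · rw [e1]
          have := h3.card
          rw [← Finset.card_erase_add_one (a := x) (by simp [hxN, hx0])] at this
          rw [← Nat.succ_injective this]
          congr 1
          ext y
          simp only [Finset.mem_filter, Finset.mem_range, Finset.mem_erase, update_apply]
          split
          · next h => simp [h]
          · next h => simp [h]
        · intro p hp hpN
          rw [e1, e2, e3]
          rcases Nat.eq_or_lt_of_le hp with rfl | hp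
          · simp [hxN]
          · obtain ⟨g1, g2, g3⟩ := h3.em p hp hpN
            have g4 : s'.arr .EM p ≠ x := fun h => hx0 (h ▸ g3)
            rw [update_of_ne (by omega), update_of_ne g4, update_of_ne g4]
            exact ⟨g1, g2, g3⟩
        · intro y hy
          rw [e1, e2, e3]
          by_cases hyx : y = x
          · subst hyx; simp; omega
          · rw [update_of_ne hyx, update_of_ne hyx]
            intro h
            obtain ⟨g1, g2, g3⟩ := h3.ps y hy h
            rw [update_of_ne (by omega)]
            exact ⟨by omega, g2, g3⟩
        · intro p p' hp hpp hpN
          rw [e2, update_of_ne (a := p') (by omega)]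
          rcases Nat.eq_or_lt_of_le hp with rfl | hp
          · rw [update_self]
            exact h3.rest x hxN hx0 p' (by omega) hpN
          · rw [update_of_ne (by omega)]
            exact h3.sorted p p' hp hpp hpN
        · intro y hy
          rw [e1, e2]
          by_cases hyx : y = x
          · subst hyx; simp
          · rw [update_of_ne hyx]
            intro h p hp hpN
            rcases Nat.eq_or_lt_of_le hp with rfl | hp
            · rw [update_self]
              have := hmax y hy
              have := (h3.key y hy).resolve_left h
              omega
            · rw [update_of_ne (by omega)]
              exact h3.rest y hy h p hp hpN
      · constructor <;> simp +contextual
      · refine ⟨k4.raw, fun r hr => k4.reg r ?_, fun a ha => k4.arr a ?_⟩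
        · simp at hr ⊢; tauto
        · simp at ha ⊢; tauto
      · rw [Nat.add_mul]
        omega
  · exact ⟨hs.leaf, hs.won, hs.key, hs.card, hs.em, hs.ps, hs.sorted, hs.rest⟩

theorem sortCmd_spec (hN : s.reg .dbl = N) (hN1 : 1 ≤ N) (hW : 2 * N ≤ W) :
    wp b W sortCmd (fun t s' => t ≤ N * (100 * Nat.log 2 (2 * N) + 600) + 300 ∧
      (∀ p < N, s'.arr .EM p < N ∧ s'.arr .PS (s'.arr .EM p) = p) ∧
      (∀ x < N, s'.arr .PS x < N ∧ s'.arr .EM (s'.arr .PS x) = x) ∧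
      (∀ p p', p < p' → p' < N → s.arr .LB (s'.arr .EM p) ≤ s.arr .LB (s'.arr .EM p')) ∧
      Frame [.k, .x, .i, .y, .z] [.KY, .TR, .EM, .PS] s s') s := by
  unfold sortCmd
  rw [wp_seq]
  refine (leafCmd_spec hN hW).mono ?_
  rintro t s₁ ⟨a1, a2, a3, a4⟩
  have hd₁ := (a4.reg .dbl (by decide)).trans hN
  rw [wp_seq]
  refine (playCmd_spec hd₁ hW).mono ?_
  rintro t' s₂ ⟨b1, b2, b3, b4⟩
  have hd₂ := (b4.reg .dbl (by decide)).trans hd₁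
  have hky := b4.arr .KY (by decide)
  refine (extractCmd_spec (LB := s.arr .LB) hd₂ hN1 hW ?_).mono ?_
  · refine ⟨fun x hx => ?_, fun j hj hjN => ?_, fun y hy => ?_, ?_, ?_, fun y hy => ?_, ?_, ?_⟩
    · rw [b3 _ (by omega), a2 x hx]
    · rw [hky]; exact b2 j hj hjN
    · rw [hky, a3 y hy]; exact Or.inr rfl
    · rw [Finset.filter_true_of_mem, Finset.card_range]
      intro y hy
      rw [hky, a3 y (Finset.mem_range.1 hy)]; omega
    · intro p h1 h2; omega
    · rw [hky, a3 y hy]; omega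
    · intro p p' h1 h2 h3; omega
    · intro y _ _ p h1 h2; omega
  · rintro t'' s₃ ⟨c1, c2, c3⟩
    have h0 : ∀ y < N, s₃.arr .KY y = 0 := by
      intro y hy
      by_contra h
      have := c2.card
      rw [Finset.card_eq_zero] at this
      have hmem : y ∈ ({y ∈ Finset.range N | s₃.arr .KY y ≠ 0} : Finset ℕ) := by simp [hy, h]
      rw [this] at hmem
      simp at hmem
    refine ⟨?_, fun p hp => ?_, fun x hx => ?_, fun p p' h1 h2 => ?_, Frame.trans (s' := s₁) ?_ (Frame.trans (s' := s₂) ?_ c3)⟩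
    · have : N * (100 * Nat.log 2 (2 * N) + 600) = N * (100 * Nat.log 2 (2 * N) + 300) + 300 * N := by
        ring
      omega
    · have := c2.em p (Nat.zero_le _) hp
      exact ⟨this.1, this.2.1⟩
    · have := c2.ps x hx (h0 x hx)
      exact ⟨this.2.1, this.2.2⟩
    · exact c2.sorted p p' (Nat.zero_le _) h1 h2
    · refine ⟨a4.raw, fun r hr => a4.reg r ?_, fun a ha => a4.arr a ?_⟩
      · simp at hr ⊢; tauto
      · simp at ha ⊢; tauto
    · refine ⟨b4.raw, fun r hr => b4.reg r ?_, fun a ha => b4.arr a ?_⟩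
      · simp at hr ⊢; tauto
      · simp at ha ⊢; tauto

end
end WheelerGraph

namespace WheelerGraph

open Refine Function Imp

/-! ### The first partition -/

/-- Put nodes with equal labels into one fine block, and all nodes into one coarse block. -/
def blocksCmd : Cmd :=
  .set .nf (.lit 0) ;;
  .set .i (.lit 0) ;;
  .while (.lt (.reg .i) (.reg .dbl))
    (.set .x (.ld .EM (.reg .i)) ;;
    .set .y (.ld .LB (.reg .x)) ;;
    .ite (.and (.reg .i) (.eq (.reg .y) (.reg .z))) .skip
      (.st .BL (.reg .nf) (.reg .i) ;; .set .nf (.inc (.reg .nf) 1)) ;;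
    .set .g (.sub (.reg .nf) (.lit 1)) ;;
    .st .BK (.reg .x) (.reg .g) ;;
    .st .BR (.reg .g) (.inc (.reg .i) 1) ;;
    .set .z (.reg .y) ;;
    .set .i (.inc (.reg .i) 1)) ;;
  .st .CR (.lit 0) (.reg .dbl) ;;
  .set .nc (.lit 1) ;;
  .set .sp (.lit 1)

/-- The fine blocks of the first `i` nodes of the sorted list `EM`: maximal runs of equal labels. -/
structure Blocks (i : ℕ) (EM LB : ℕ → ℕ) (s : St) : Prop where
  bk : ∀ p < i, s.arr .BK (EM p) < s.reg .nf ∧ s.arr .BL (s.arr .BK (EM p)) ≤ p ∧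
    p < s.arr .BR (s.arr .BK (EM p))
  lab : ∀ p < i, ∀ q < i, s.arr .BK (EM p) = s.arr .BK (EM q) ↔ LB (EM p) = LB (EM q)
  fine : ∀ f < s.reg .nf, s.arr .BL f < s.arr .BR f ∧ s.arr .BR f ≤ i
  ord : ∀ f g, f < g → g < s.reg .nf → s.arr .BR f ≤ s.arr .BL g
  last : 0 < i → s.reg .z = LB (EM (i - 1)) ∧ s.arr .BK (EM (i - 1)) + 1 = s.reg .nf

section
variable {b W : ℕ} {s : St} {N : ℕ}

theorem blocksCmd_spec {EM PS LB : ℕ → ℕ} (hN : s.reg .dbl = N) (hEM : s.arr .EM = EM)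
    (hLB : s.arr .LB = LB) (hem : ∀ p < N, EM p < N ∧ PS (EM p) = p)
    (hsort : ∀ p p', p < p' → p' < N → LB (EM p) ≤ LB (EM p')) :
    wp b W blocksCmd (fun t s' => t ≤ 200 * N + 100 ∧ Blocks N EM LB s' ∧
      s'.arr .CR 0 = N ∧ s'.reg .nc = 1 ∧ s'.reg .sp = 1 ∧
      Frame [.i, .x, .y, .z, .nf, .g, .nc, .sp] [.BL, .BK, .BR, .CR] s s') s := by
  unfold blocksCmd
  simp only [wp_seq (q := Cmd.seq _ _), wp_set, Ex.Ok, Ex.eval, Ex.cost, true_and]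
  have key := wp_while (b := b) (W := W) (c := .lt (.reg .i) (.reg .dbl))
    (s := (s.setR .nf 0).setR .i 0) (ι := ℕ)
    (p := .set .x (.ld .EM (.reg .i)) ;;
    .set .y (.ld .LB (.reg .x)) ;;
    .ite (.and (.reg .i) (.eq (.reg .y) (.reg .z))) .skip
      (.st .BL (.reg .nf) (.reg .i) ;; .set .nf (.inc (.reg .nf) 1)) ;;
    .set .g (.sub (.reg .nf) (.lit 1)) ;;
    .st .BK (.reg .x) (.reg .g) ;;
    .st .BR (.reg .g) (.inc (.reg .i) 1) ;;
    .set .z (.reg .y) ;;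
    .set .i (.inc (.reg .i) 1))
    (fun i s' => i ≤ N ∧ s'.reg .i = i ∧ Blocks i EM LB s' ∧
      Frame [.i, .x, .y, .z, .nf, .g, .nc, .sp] [.BL, .BK, .BR, .CR] s s')
    (fun i => 200 * (N - i) + 10) ?_ ?_ (i := 0)
    ⟨Nat.zero_le _, by simp, by constructor <;> simp, by constructor <;> simp +contextual⟩
  · refine key.mono ?_
    rintro t s' ⟨ht, i, ⟨h1, h2, h3, h4⟩, he⟩
    have hd := (h4.reg .dbl (by decide)).trans hN
    simp [hd, h2] at he
    obtain rfl : i = N := by omega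
    simp [hd]
    refine ⟨by omega, ?_, h4.trans ?_⟩
    · obtain ⟨g1, g2, g3, g4, g5⟩ := h3
      constructor <;> simpa
    · constructor <;> simp +contextual
  · intro i s' _; simp
  · rintro i s' ⟨h1, h2, h3, h4⟩ hne
    have hd := (h4.reg .dbl (by decide)).trans hN
    have hem' := (h4.arr .EM (by decide)).trans hEM
    have hlb' := (h4.arr .LB (by decide)).trans hLB
    simp [hd, h2] at hne
    have hinj : ∀ p < i, EM p ≠ EM i := by
      intro p hp he
      have h5 := (hem p (by omega)).2
      rw [he, (hem i hne).2] at h5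
      omega
    obtain ⟨nf, hnf'⟩ : ∃ nf, nf = s'.reg .nf := ⟨_, rfl⟩
    simp only [wp_seq, wp_set, wp_st, wp_ite, wp_skip, Ex.Ok, Ex.eval, Ex.cost, true_and, h2, hem',
      hlb', St.setA_reg, St.setR_reg, St.setR_arr, reduceCtorEq, if_true, if_false,
      ← hnf', Nat.add_sub_cancel, ne_eq, andN_eq_zero, eqN_eq_zero, not_or, not_not]
    refine ⟨fun hc => ?_, fun hc => ?_⟩
    · obtain ⟨g1, g2⟩ := h3.last (by omega)
      have hk := (h3.bk (i - 1) (by omega)).2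
      refine ⟨i + 1, ⟨hne, by simp, ?_, h4.trans ?_⟩, by omega⟩
      · have hn : s'.arr .BK (EM (i - 1)) = nf - 1 := by omega
        rw [hn] at hk
        have hz : LB (EM i) = LB (EM (i - 1)) := hc.2.trans g1
        refine ⟨fun p hp => ?_, fun p hp q hq => ?_, fun f hf => ?_, fun f g hfg hg => ?_, fun _ => ?_⟩
        · simp [update_apply, ← hnf']
          rcases Nat.lt_or_ge p i with hpi | hpi
          · simp only [hinj p hpi, if_false]
            obtain ⟨k1, k2, k3⟩ := h3.bk p hpi
            refine ⟨by omega, k2, ?_⟩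
            split <;> omega
          · obtain rfl : p = i := by omega
            simp
            omega
        · simp [update_apply]
          rcases Nat.lt_or_ge p i with hpi | hpi <;> rcases Nat.lt_or_ge q i with hqi | hqi
          · simp only [hinj p hpi, hinj q hqi, if_false]
            exact h3.lab p hpi q hqi
          · obtain rfl : q = i := by omega
            simp only [hinj p hpi, if_false, if_true]
            rw [hz, ← hn]
            exact h3.lab p hpi (q - 1) (by omega)
          · obtain rfl : p = i := by omega
            simp only [hinj q hqi, if_false, if_true]
            rw [hz, ← hn]
            exact h3.lab (p - 1) (by omega) q hqi
          · obtain rfl : p = i := by omega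
            obtain rfl : q = p := by omega
            simp
        · simp [← hnf'] at hf
          have := h3.fine f (by omega)
          simp [update_apply]
          split <;> omega
        · simp [← hnf'] at hg
          have := h3.ord f g hfg (by omega)
          simp [show f ≠ nf - 1 by omega, this]
        · simp [← hnf']; omega
      · constructor <;> simp +contextual
    · refine ⟨i + 1, ⟨hne, by simp, ?_, h4.trans ?_⟩, by omega⟩
      · have hz : ∀ p < i, LB (EM p) ≠ LB (EM i) := by
          intro p hp
          obtain ⟨g1, g2⟩ := h3.last (by omega)
          have h5 := hsort (i - 1) i (by omega) hne
          have h6 : LB (EM p) ≤ LB (EM (i - 1)) := by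
            rcases Nat.eq_or_lt_of_le (show p ≤ i - 1 by omega) with h | h
            · rw [h]
            · exact hsort p (i - 1) h (by omega)
          have h7 := hc.resolve_left (by omega)
          rw [g1] at h7
          omega
        refine ⟨fun p hp => ?_, fun p hp q hq => ?_, fun f hf => ?_, fun f g hfg hg => ?_, fun _ => ?_⟩
        · simp [update_apply]
          rcases Nat.lt_or_ge p i with hpi | hpi
          · simp only [hinj p hpi, if_false]
            obtain ⟨k1, k2, k3⟩ := h3.bk p hpi
            have k4 : s'.arr .BK (EM p) ≠ nf := by omega
            simp only [not_false_eq_true, k4, forall_const, if_false]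
            exact ⟨by omega, k2, k3⟩
          · obtain rfl : p = i := by omega
            simp
        · simp [update_apply]
          rcases Nat.lt_or_ge p i with hpi | hpi <;> rcases Nat.lt_or_ge q i with hqi | hqi
          · simp only [hinj p hpi, hinj q hqi, if_false]
            exact h3.lab p hpi q hqi
          · obtain rfl : q = i := by omega
            simp only [hinj p hpi, if_false, if_true]
            have := (h3.bk p hpi).1
            simp [hz p hpi]; omega
          · obtain rfl : p = i := by omega
            simp only [hinj q hqi, if_false, if_true]
            have := (h3.bk q hqi).1
            simp [(hz q hqi).symm]; omega
          · obtain rfl : p = i := by omega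
            obtain rfl : q = p := by omega
            simp
        · simp at hf
          rcases Nat.lt_or_ge f nf with hfn | hfn
          · have := h3.fine f (by omega)
            simp [show f ≠ nf by omega]; omega
          · obtain rfl : f = nf := by omega
            simp
        · simp at hg
          rcases Nat.lt_or_ge g nf with hgn | hgn
          · have := h3.ord f g hfg (by omega)
            simp [show g ≠ nf by omega, show f ≠ nf by omega, this]
          · obtain rfl : g = nf := by omega
            have := h3.fine f (by omega)
            simp [show f ≠ g by omega, this]
        · simp
      · constructor <;> simp +contextual

/-- The invariant of the refinement holds for the first partition. -/
theorem Blocks.rinv {G : Gr} {Bef : ℕ → ℕ → Prop} (hG : G.WF)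
    (h : Blocks G.N (s.arr .EM) G.lab s) (h0 : 1 ≤ G.N)
    (hem : ∀ p < G.N, s.arr .EM p < G.N ∧ s.arr .PS (s.arr .EM p) = p)
    (hps : ∀ x < G.N, s.arr .PS x < G.N ∧ s.arr .EM (s.arr .PS x) = x)
    (hsort : ∀ p p', p < p' → p' < G.N → G.lab (s.arr .EM p) ≤ G.lab (s.arr .EM p'))
    (hcn : ∀ x, s.arr .CN x = inTo G G.M x) (hcr : s.arr .CR 0 = G.N) (hnc : s.reg .nc = 1)
    (hsp : s.reg .sp = 1)
    (hz : ∀ a, a = .BC ∨ a = .CL ∨ a = .PC ∨ a = .TS ∨ a = .ST → ∀ i, s.arr a i = 0) :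
    RInv G Bef (toPt s) := by
  classical
  have hBC := hz .BC (by simp)
  have hCL := hz .CL (by simp)
  have hPC := hz .PC (by simp)
  have hTS := hz .TS (by simp)
  have hST := hz .ST (by simp)
  have hco : ∀ x, (toPt s).co x = 0 := fun x => hBC _
  have hbk : ∀ x < G.N, s.arr .BK x < s.reg .nf ∧ s.arr .BL (s.arr .BK x) ≤ s.arr .PS x ∧
      s.arr .PS x < s.arr .BR (s.arr .BK x) := by
    intro x hx
    have := h.bk _ (hps x hx).1
    rwa [(hps x hx).2] at this
  have hlab : ∀ x < G.N, ∀ y < G.N, s.arr .BK x = s.arr .BK y ↔ G.lab x = G.lab y := by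
    intro x hx y hy
    have := h.lab _ (hps x hx).1 _ (hps y hy).1
    rwa [(hps x hx).2, (hps y hy).2] at this
  have hin : ∀ x, inTo G G.M x =
      {e ∈ Finset.range G.M | G.live e ∧ G.dst e = x ∧ (toPt s).co (G.src e) = (toPt s).PC x}.card := by
    intro x
    unfold inTo
    congr 1
    ext e
    simp [hco, show (toPt s).PC x = 0 from hPC x]
  refine ⟨⟨hem, hps, fun x hx => (hbk x hx).1, fun x hx => (hbk x hx).2, ?_, fun f _ => ?_,
    fun f hf => (h.fine f hf).1.le, fun f hf _ => ?_, fun c hc c' hc' hne => ?_, fun c hc => ?_⟩,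
    ?_, ?_, ?_, ?_, ?_, ?_, ?_, ?_, ?_, ?_, ?_, ?_⟩
  · intro f hf g hg p h1 h2 h3 h4
    change s.arr .BL f ≤ p at h1
    change p < s.arr .BR f at h2
    change s.arr .BL g ≤ p at h3
    change p < s.arr .BR g at h4
    rcases lt_trichotomy f g with hlt | heq | hlt
    · have := h.ord f g hlt hg; omega
    · exact heq
    · have := h.ord g f hlt hf; omega
  · show s.arr .BC f < s.reg .nc
    rw [hBC, hnc]; omega
  · show s.arr .CL (s.arr .BC f) ≤ s.arr .BL f ∧ s.arr .BR f ≤ s.arr .CR (s.arr .BC f)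
    rw [hBC, hCL, hcr]
    exact ⟨Nat.zero_le _, (h.fine f hf).2⟩
  · have e1 : c < s.reg .nc := hc
    have e2 : c' < s.reg .nc := hc'
    omega
  · have e1 : c < s.reg .nc := hc
    obtain rfl : c = 0 := by omega
    show s.arr .CL 0 < s.arr .CR 0 ∧ s.arr .CR 0 ≤ G.N
    rw [hCL, hcr]; omega
  · intro x hx y hy hlt
    left
    change s.arr .BL (s.arr .BK x) < s.arr .BL (s.arr .BK y) at hlt
    obtain ⟨a1, a2, a3⟩ := hbk x hx
    obtain ⟨b1, b2, b3⟩ := hbk y hy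
    have hne : s.arr .BK x ≠ s.arr .BK y := fun he => by rw [he] at hlt; omega
    have hps' : s.arr .PS x < s.arr .PS y := by
      rcases lt_or_gt_of_ne hne with h1 | h1
      · have := h.ord _ _ h1 b1; omega
      · have := h.ord _ _ h1 a1; omega
    have hle := hsort _ _ hps' (hps y hy).1
    rw [(hps x hx).2, (hps y hy).2] at hle
    exact lt_of_le_of_ne hle fun he => hne ((hlab x hx y hy).2 he)
  · intro x hx y hy he
    exact ⟨(hlab x hx y hy).1 he, (hPC x).trans (hPC y).symm⟩
  · intro x _
    show s.arr .PC x < s.reg .nc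
    rw [hPC, hnc]; omega
  · intro x _ _; exact hPC x
  · intro x _
    rw [show (toPt s).CN x = s.arr .CN x from rfl, hcn, hin x]
  · intro x hx hx0
    show 0 < s.arr .CN x
    rw [hcn]
    obtain ⟨e, he, h1, h2⟩ := hG.ex_live x hx hx0
    exact Finset.card_pos.2 ⟨e, by simp [he, h1, h2]⟩
  · intro e _ _ _
    exact (hCL _).trans_le (Nat.zero_le _)
  · intro e _ _ _
    exact (hCL _).trans_le (Nat.zero_le _)
  · intro x _ y _ _ _ hlt
    have e1 : (toPt s).CL ((toPt s).co x) = 0 := hCL _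
    have e2 : (toPt s).CL ((toPt s).co y) = 0 := hCL _
    omega
  · intro x _ y _ _ _
    exact ⟨0, by show 0 < s.reg .sp; omega, (hST 0).trans (hco x).symm⟩
  · intro i _
    show s.arr .ST i < s.reg .nc
    rw [hST, hnc]; omega
  · intro f
    show s.arr .TS f < s.reg .nc
    rw [hTS, hnc]; omega

end
end WheelerGraph

namespace WheelerGraph

open Refine Function Imp

/-! ### The output -/

/-- List the states in the order of their minimizing copies, and compare the maximizing copy of each
state with the minimizing copy of the next one. The list overwrites the input from address `0` on,
which is not needed any more and is long enough. -/
def outCmd : Cmd :=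
  .set .res (.lit 1) ;;
  .set .cnt (.lit 0) ;;
  .set .i (.lit 0) ;;
  .set .outp (.lit 0) ;;
  .while (.lt (.reg .i) (.reg .dbl))
    (.set .x (.ld .EM (.reg .i)) ;;
    .ite (.and (.lt (.lit 2) (.reg .x)) (.lt (.reg .x) (.inc (.reg .num) 3)))
      (.ite (.reg .cnt)
        (.ite (.lt (.ld .BL (.ld .BK (.reg .x)))
            (.ld .BL (.ld .BK (.add (.reg .lst) (.reg .len)))))
          (.set .res (.lit 0)) .skip) .skip ;;
      .sraw (.reg .cnt) (.sub (.reg .x) (.lit 3)) ;;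
      .set .cnt (.inc (.reg .cnt) 1) ;;
      .set .lst (.reg .x)) .skip ;;
    .set .i (.inc (.reg .i) 1))

/-- The nodes of states among the first `i` nodes in the list `EM`. -/
def outList (EM : ℕ → ℕ) (n i : ℕ) : List ℕ :=
  ((List.range i).map EM).filter fun x => 2 < x ∧ x < n + 3

section
variable {EM PS : ℕ → ℕ} {n N : ℕ}

theorem outList_succ (i : ℕ) : outList EM n (i + 1) =
    outList EM n i ++ if 2 < EM i ∧ EM i < n + 3 then [EM i] else [] := by
  simp [outList, List.range_succ, List.filter_append, List.filter_cons]

theorem mem_outList {i x : ℕ} (h : x ∈ outList EM n i) : 2 < x ∧ x < n + 3 := by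
  simp [outList] at h
  exact h.2

theorem nodup_outList (hem : ∀ p < N, PS (EM p) = p) {i : ℕ} (hi : i ≤ N) :
    (outList EM n i).Nodup := by
  refine List.Nodup.filter _ (List.Nodup.map_on ?_ List.nodup_range)
  intro p hp q hq h
  simp at hp hq
  rw [← hem p (by omega), ← hem q (by omega), h]

theorem length_outList_le (hem : ∀ p < N, PS (EM p) = p) {i : ℕ} (hi : i ≤ N) :
    (outList EM n i).length ≤ n := by
  rw [← List.toFinset_card_of_nodup (nodup_outList hem hi)]
  refine (Finset.card_le_card (t := Finset.Ico 3 (n + 3)) fun x hx => ?_).trans (by simp)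
  have := mem_outList (List.mem_toFinset.1 hx)
  simp; omega

theorem length_outList (hem : ∀ p < N, PS (EM p) = p) (hps : ∀ x < N, PS x < N ∧ EM (PS x) = x)
    (hn : n + 3 ≤ N) : (outList EM n N).length = n := by
  refine le_antisymm (length_outList_le hem le_rfl) ?_
  rw [← List.toFinset_card_of_nodup (nodup_outList hem le_rfl)]
  refine le_trans (by simp) (Finset.card_le_card (s := Finset.Ico 3 (n + 3)) fun x hx => ?_)
  simp at hx
  obtain ⟨h1, h2⟩ := hps x (by omega)
  simp [outList]
  exact ⟨⟨PS x, h1, h2⟩, by omega⟩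

theorem pairwise_outList {r : ℕ → ℕ → Prop} (h : ∀ p q, p < q → q < N → r (EM p) (EM q)) :
    (outList EM n N).Pairwise r := by
  refine List.Pairwise.filter _ (List.pairwise_map.2 ?_)
  rw [List.pairwise_iff_getElem]
  intro i j hi hj hij
  simp at hi hj ⊢
  exact h i j hij hj

end

section
variable {b W : ℕ} {s : St}

/-- The list and the outcome of the comparisons of its consecutive members. -/
theorem outCmd_spec {EM PS R : ℕ → ℕ} {n N : ℕ} (hN : s.reg .dbl = N) (hn : s.reg .num = n)
    (hEM : s.arr .EM = EM) (hR : ∀ x, s.arr .BL (s.arr .BK x) = R x)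
    (hem : ∀ p < N, PS (EM p) = p) (hb : n + 3 ≤ b) (hlen : s.reg .len = b) (hW : 2 * b ≤ W) :
    wp b W outCmd (fun t s' => t ≤ 200 * N + 100 ∧ s'.reg .outp = 0 ∧
      (∀ j (hj : j < (outList EM n N).length), s'.raw j = (outList EM n N)[j] - 3) ∧
      (s'.reg .res = 1 ∧ (outList EM n N).IsChain (fun x y => R (x + b) ≤ R y) ∨
        s'.reg .res = 0 ∧ ¬ (outList EM n N).IsChain fun x y => R (x + b) ≤ R y)) s := by
  unfold outCmd
  simp only [wp_seq (q := Cmd.seq _ _), wp_seq (q := Cmd.while _ _), wp_set, Ex.Ok, Ex.eval, Ex.cost,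
    true_and]
  have key := wp_while (b := b) (W := W) (c := .lt (.reg .i) (.reg .dbl))
    (s := (((s.setR .res 1).setR .cnt 0).setR .i 0).setR .outp 0) (ι := ℕ)
    (p := .set .x (.ld .EM (.reg .i)) ;;
    .ite (.and (.lt (.lit 2) (.reg .x)) (.lt (.reg .x) (.inc (.reg .num) 3)))
      (.ite (.reg .cnt)
        (.ite (.lt (.ld .BL (.ld .BK (.reg .x)))
            (.ld .BL (.ld .BK (.add (.reg .lst) (.reg .len)))))
          (.set .res (.lit 0)) .skip) .skip ;;
      .sraw (.reg .cnt) (.sub (.reg .x) (.lit 3)) ;;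
      .set .cnt (.inc (.reg .cnt) 1) ;;
      .set .lst (.reg .x)) .skip ;;
    .set .i (.inc (.reg .i) 1))
    (fun i s' => i ≤ N ∧ s'.reg .i = i ∧ s'.reg .outp = 0 ∧ s'.reg .dbl = N ∧ s'.reg .num = n ∧
      s'.reg .len = b ∧ s'.arr = s.arr ∧ s'.reg .cnt = (outList EM n i).length ∧
      (∀ j (hj : j < (outList EM n i).length), s'.raw j = (outList EM n i)[j] - 3) ∧
      (∀ x ∈ (outList EM n i).getLast?, s'.reg .lst = x) ∧
      (s'.reg .res = 1 ∧ (outList EM n i).IsChain (fun x y => R (x + b) ≤ R y) ∨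
        s'.reg .res = 0 ∧ ¬ (outList EM n i).IsChain fun x y => R (x + b) ≤ R y))
    (fun i => 200 * (N - i) + 10) ?_ ?_ (i := 0)
    ⟨Nat.zero_le _, by simp, by simp, by simp [hN], by simp [hn], by simp [hlen], by simp,
      by simp [outList], by simp [outList], by simp [outList], by simp [outList]⟩
  · refine key.mono ?_
    rintro t s' ⟨ht, i, ⟨h1, h2, h3, h4, h5, h6, h7, h8, h9, h10, h11⟩, he⟩
    simp [h4, h2] at he
    obtain rfl : i = N := by omega
    exact ⟨by omega, h3, h9, h11⟩
  · intro i s' _; simp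
  · rintro i s' ⟨h1, h2, h3, h4, h5, h6, h7, h8, h9, h10, h11⟩ hne
    simp [h4, h2] at hne
    have hlast : (outList EM n i).length ≠ 0 → s'.reg .lst < n + 3 ∧
        (outList EM n i).getLast? = some (s'.reg .lst) := by
      intro h
      have hne : outList EM n i ≠ [] := fun h' => h (by simp [h'])
      have := h10 _ (List.getLast?_eq_some_getLast hne)
      rw [this, List.getLast?_eq_some_getLast hne]
      exact ⟨(mem_outList (List.getLast_mem hne)).2, rfl⟩
    have hcnt : 2 < EM i ∧ EM i < n + 3 → (outList EM n i).length < n := by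
      intro h
      have h' := length_outList_le (n := n) hem (show i + 1 ≤ N by omega)
      rw [outList_succ, if_pos h] at h'
      simp at h'; omega
    simp only [wp_seq, wp_set, wp_sraw, wp_ite, wp_skip, Ex.Ok, Ex.eval, Ex.cost, true_and, h2, h7,
      hEM, hR, St.setR_reg, St.setR_arr, reduceCtorEq, if_true, if_false, h8, h6, h5,
      ne_eq, andN_eq_zero, ltN_eq_zero, not_or, not_le, and_true]
    have hpush : 2 < EM i ∧ EM i < n + 3 → ∀ j (hj : j < (outList EM n i).length + 1),
        update s'.raw (outList EM n i).length (EM i - 3) j = (outList EM n i ++ [EM i])[j]'(by simpa using hj) - 3 := by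
      intro _ j hj
      rcases Nat.lt_or_ge j (outList EM n i).length with h | h
      · rw [update_of_ne (by omega), h9 j h, List.getElem_append_left h]
      · obtain rfl : j = (outList EM n i).length := by omega
        simp
    refine ⟨fun hc => ⟨fun h0 => ⟨?_, fun hlt => ?_, fun hge => ?_⟩, fun h0 => ?_⟩, fun hc => ?_⟩
    · have := (hlast h0).1; omega
    · refine ⟨by have := hcnt hc; omega, i + 1, ?_, by omega⟩
      rw [outList_succ, if_pos hc]
      refine ⟨hne, by simp [h2], by simp [h3], by simp [h4], by simp [h5], by simp [h6], by simp [h7],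
        by simp [h8], ?_, by simp, ?_⟩
      · simpa using hpush hc
      · right
        refine ⟨by simp, fun hch => ?_⟩
        have := (List.isChain_append.1 hch).2.2 _ (hlast h0).2 (EM i) (by simp)
        omega
    · refine ⟨by have := hcnt hc; omega, i + 1, ?_, by omega⟩
      rw [outList_succ, if_pos hc]
      refine ⟨hne, by simp [h2], by simp [h3], by simp [h4], by simp [h5], by simp [h6], by simp [h7],
        by simp [h8], ?_, by simp, ?_⟩
      · simpa using hpush hc
      · have hiff : (outList EM n i ++ [EM i]).IsChain (fun x y => R (x + b) ≤ R y) ↔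
            (outList EM n i).IsChain fun x y => R (x + b) ≤ R y := by
          rw [List.isChain_append]
          refine ⟨fun h => h.1, fun h => ⟨h, by simp, ?_⟩⟩
          rw [(hlast h0).2]
          simpa using hge
        rw [hiff]
        simpa using h11
    · refine ⟨by have := hcnt hc; omega, i + 1, ?_, by omega⟩
      rw [outList_succ, if_pos hc]
      have hnil : outList EM n i = [] := List.length_eq_zero_iff.1 h0
      refine ⟨hne, by simp [h2], by simp [h3], by simp [h4], by simp [h5], by simp [h6], by simp [h7],
        by simp [h8], ?_, by simp, ?_⟩
      · simpa using hpush hc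
      · rw [hnil] at h11 ⊢
        simpa using h11
    · refine ⟨i + 1, ?_, by omega⟩
      rw [outList_succ, if_neg (by omega), List.append_nil]
      exact ⟨hne, rfl, h3, h4, rfl, h9, h10, h11⟩

end
end WheelerGraph

namespace WheelerGraph

open Refine Function Imp

/-! ### The whole algorithm -/

/-- The algorithm, given the length of the input. -/
def wheelerCmd : Cmd :=
  parseCmd ;; labelCmd ;; linkCmd ;; sortCmd ;; blocksCmd ;; refineCmd ;; outCmd

theorem sum_outdeg_le {G : Gr} (hG : G.WF) :
    ∑ y ∈ Finset.range G.N, outdeg G y ≤ G.M := by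
  classical
  have h1 : ∀ y, outdeg G y = {e ∈ {e ∈ Finset.range G.M | G.live e} | G.src e = y}.card := by
    intro y
    unfold outdeg
    rw [Finset.filter_filter]
  simp only [h1]
  rw [← Finset.card_eq_sum_card_fiberwise]
  · exact (Finset.card_filter_le _ _).trans (by simp)
  · intro e he
    simp only [Finset.coe_filter, Finset.mem_range, Set.mem_ofPred_eq] at he
    simpa using hG.src_lt e he.1 he.2

/-- The initial potential bounds the total cost of the refinement. -/
theorem pot_le {G : Gr} {d : Pt} (hG : G.WF) (hd : d.Struc G.N) :
    d.pot G ≤ (G.N + G.M) * Nat.log 2 G.N := by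
  have h1 : d.pot G ≤ ∑ y ∈ Finset.range G.N, (1 + outdeg G y) * Nat.log 2 G.N := by
    apply Finset.sum_le_sum
    intro y hy
    apply Nat.mul_le_mul_left
    apply Nat.log_mono_right
    have := hd.cne _ (hd.co_lt (Finset.mem_range.1 hy))
    omega
  refine h1.trans ?_
  rw [← Finset.sum_mul, Finset.sum_add_distrib]
  apply Nat.mul_le_mul_right
  have := sum_outdeg_le hG
  simpa using this

section
variable {α : Type*} [LinearOrder α] {Q : Type*} {A : GNFA α Q} {n σ : ℕ} {ν : Q ≃ Fin n}
  {κ : α ≃o Fin σ} {l : List (Q × Q × List α)}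

theorem length_encode : (A.encode ν κ l).length =
    3 + n + ((records ν κ l).flatMap recNums).length := by
  rw [encode_eq]
  simp only [List.length_cons, List.length_append, List.length_map, List.length_finRange]
  omega

/-- The state in which the algorithm starts: nothing but the input and its length is given. -/
structure Start (input : List ℕ) (s : St) : Prop where
  raw : ∀ i < input.length, s.raw i = input.getD i 0
  len : s.reg .len = input.length
  reg : ∀ r, r ≠ .len → s.reg r = 0
  arr : ∀ a i, s.arr a i = 0

theorem wheelerCmd_spec {b : ℕ} {s : St} (hA : A.IsGDFA)
    (hmem : ∀ x, x ∈ l ↔ x ∈ A.edges) (hs : Start (A.encode ν κ l) s)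
    (hb : (A.encode ν κ l).length = b) :
    wp b (4 * b) wheelerCmd (fun t s' => t ≤ 20000 * (b * (Nat.log 2 (4 * b) + 1)) + 2000 ∧
      s'.reg .outp = 0 ∧ (¬ A.IsWheeler → s'.reg .res = 0) ∧
      (A.IsWheeler → s'.reg .res = 1 ∧ ∃ q : Fin n ≃ Q, (∀ i j, A.le (q i) (q j) ↔ i ≤ j) ∧
        ∀ i : Fin n, s'.raw i = ν (q i))) s := by
  have hlenb : s.reg .len = b := hs.len.trans hb
  have hbn : 3 + n + ((records ν κ l).flatMap recNums).length = b := length_encode.symm.trans hb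
  have hin : InputAt s.raw b 0 (A.encode ν κ l) := by
    refine ⟨by omega, fun i hi => ?_⟩
    rw [zero_add, hs.raw i hi, List.getD_eq_getElem _ _ hi]
  rw [encode_eq] at hin hb
  have hstart := (ν A.start).2
  have hrec := records_bound (ν := ν) (κ := κ) (l := l)
  unfold wheelerCmd
  rw [wp_seq]
  refine (parseCmd_spec hlenb (hs.reg _ (by decide)) (by simp) hin hb
    (fun r hr => ⟨(hrec r hr).1, (hrec r hr).2.1⟩) (by omega)).mono ?_
  rintro t₁ s₁ ⟨at1, ap, -, alen, adbl, anum, aini, aarr⟩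
  obtain ⟨E, hE⟩ : ∃ E, E = recEdges (3 + n) (records ν κ l) := ⟨_, rfl⟩
  rw [← hE] at ap
  have hElen : E.length ≤ b := by
    rw [hE, length_recEdges]
    have : ((records ν κ l).map fun r => r.2.2.length).sum ≤
        ((records ν κ l).map fun r => 3 + r.2.2.length).sum :=
      List.sum_le_sum fun r _ => by omega
    rw [← length_flatMap_recNums] at this
    omega
  have hlists := ap.lists
  obtain ⟨M, hM⟩ : ∃ M, M = s₁.reg .m := ⟨_, rfl⟩
  have hMb : M ≤ 2 * b := by rw [hM, ap.m]; omega
  rw [alen, ← hM] at hlists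
  have az : ∀ a, a ≠ .ES → a ≠ .ED → a ≠ .EL → ∀ i, s₁.arr a i = 0 := by
    intro a h1 h2 h3 i
    rw [aarr a h1 h2 h3]; exact hs.arr a i
  -- labels
  rw [wp_seq]
  refine (labelCmd_spec ?_ (az .LB (by decide) (by decide) (by decide)) (by omega)).mono ?_
  · intro e he
    obtain ⟨_, _, a, -, h, -⟩ := hlists.sound e (by omega)
    rw [h]; omega
  rintro t₂ s₂ ⟨bt, blab, bf⟩
  rw [alen, aini, ← hM] at blab
  have bm := bf.reg .m (by decide)
  have bes := bf.arr .ES (by decide)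
  have bed := bf.arr .ED (by decide)
  have bel := bf.arr .EL (by decide)
  obtain ⟨G, hGdef⟩ : ∃ G, G = twoCopies b M (s₁.arr .ES) (s₁.arr .ED) (s₁.arr .EL) (s₂.arr .LB) :=
    ⟨_, rfl⟩
  have hG : G.WF := by rw [hGdef]; exact twoCopies_wf hlists blab
  have hGN : G.N = 2 * b := by rw [hGdef]; rfl
  have hGM : G.M = M := by rw [hGdef]; rfl
  have hGL : G.L = b := by rw [hGdef]; rfl
  have hGlab : G.lab = s₂.arr .LB := by rw [hGdef]; rfl
  have hGsrc : G.src = s₁.arr .ES := by rw [hGdef]; rfl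
  have hGdst : G.dst = s₁.arr .ED := by rw [hGdef]; rfl
  have hsrc := fun s d a h => exists_jr_source (ν := ν) (κ := κ) (s := s) (d := d) (a := a) hA hmem h
  rw [← hE] at hsrc
  obtain ⟨Bef, hBef⟩ : ∃ Bef, Bef = Before E (3 + (ν A.start : ℕ)) b := ⟨_, rfl⟩
  have hB : G.Closed Bef := by
    rw [hGdef, hBef]; exact twoCopies_closed hlists blab hsrc
  -- lists of live edges
  rw [wp_seq]
  refine (linkCmd_spec (G := G) (by rw [hGM, bm, hM]) (by rw [hGsrc, bes]) (by rw [hGdst, bed]) ?_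
    ?_ ?_).mono ?_
  · intro e
    rw [hGdef, bel, bed]; rfl
  · intro x
    rw [bf.arr .HD (by decide)]; exact az _ (by decide) (by decide) (by decide) _
  · intro x
    rw [bf.arr .CN (by decide)]; exact az _ (by decide) (by decide) (by decide) _
  rintro t₃ s₃ ⟨ct, chd, cnx, ccn, cf⟩
  -- sorting
  have cdbl : s₃.reg .dbl = 2 * b := by
    rw [cf.reg .dbl (by decide), bf.reg .dbl (by decide), adbl]
  have clb : s₃.arr .LB = s₂.arr .LB := cf.arr .LB (by decide)
  rw [wp_seq]
  refine (sortCmd_spec cdbl (by omega) (by omega)).mono ?_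
  rintro t₄ s₄ ⟨dt, dem, dps, dsort, df⟩
  rw [clb] at dsort
  have ddbl : s₄.reg .dbl = 2 * b := (df.reg .dbl (by decide)).trans cdbl
  have dlb : s₄.arr .LB = s₂.arr .LB := (df.arr .LB (by decide)).trans clb
  -- the first partition
  rw [wp_seq]
  refine (blocksCmd_spec ddbl rfl dlb dem dsort).mono ?_
  rintro t₅ s₅ ⟨et, ebl, ecr, enc, esp, ef⟩
  have e4 : ∀ a, a ≠ .ES → a ≠ .ED → a ≠ .EL → a ≠ .LB → a ≠ .NX → a ≠ .HD → a ≠ .CN → a ≠ .KY →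
      a ≠ .TR → a ≠ .EM → a ≠ .PS → a ≠ .BL → a ≠ .BK → a ≠ .BR → a ≠ .CR → ∀ i, s₅.arr a i = 0 := by
    intro a h1 h2 h3 h4 h5 h6 h7 h8 h9 h10 h11 h12 h13 h14 h15 i
    rw [ef.arr a (by simp [*]), df.arr a (by simp [*]), cf.arr a (by simp [*]),
      bf.arr a (by simp [*])]
    exact az a h1 h2 h3 i
  have eem : s₅.arr .EM = s₄.arr .EM := ef.arr .EM (by decide)
  have eps : s₅.arr .PS = s₄.arr .PS := ef.arr .PS (by decide)
  have ecn : s₅.arr .CN = s₃.arr .CN := (ef.arr .CN (by decide)).trans (df.arr .CN (by decide))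
  have hR₅ : RInv G Bef (toPt s₅) := by
    refine Blocks.rinv hG ?_ (by omega) ?_ ?_ ?_ ?_ ?_ enc esp ?_
    · rwa [hGN, hGlab, eem]
    · rwa [hGN, eem, eps]
    · rwa [hGN, eem, eps]
    · rwa [hGN, hGlab, eem]
    · rwa [ecn]
    · rwa [hGN]
    · rintro a ha
      apply e4 <;> rintro rfl <;> simp at ha
  have hlink : Linked G s₅ := by
    refine ⟨?_, fun e _ _ => ?_, fun y _ => ?_, fun e he hl => ?_⟩
    · rw [ef.reg .len (by decide), df.reg .len (by decide), cf.reg .len (by decide),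
        bf.reg .len (by decide), alen, hGL]
    · rw [ef.arr .ED (by decide), df.arr .ED (by decide), cf.arr .ED (by decide),
        bf.arr .ED (by decide), hGdst]
    · rw [ef.arr .HD (by decide), df.arr .HD (by decide)]; exact chd y
    · rw [ef.arr .NX (by decide), df.arr .NX (by decide)]; exact cnx e he hl
  -- the refinement
  rw [wp_seq]
  refine (refineCmd_spec hG hB hlink hR₅ (e4 .KK (by decide) (by decide) (by decide) (by decide)
    (by decide) (by decide) (by decide) (by decide) (by decide) (by decide) (by decide) (by decide)
    (by decide) (by decide) (by decide))).mono ?_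
  rintro t₆ s₆ ⟨ft, fk, hR₆, fsp⟩
  have hpot := pot_le hG hR₅.toStruc
  rw [esp] at ft
  have flen : s₆.reg .len = b := by rw [fk.len, hlink.len, hGL]
  have fdbl : s₆.reg .dbl = 2 * b := by rw [fk.dbl, ef.reg .dbl (by decide), ddbl]
  have fnum : s₆.reg .num = n := by
    rw [fk.num, ef.reg .num (by decide), df.reg .num (by decide), cf.reg .num (by decide),
      bf.reg .num (by decide), anum]
  obtain ⟨R, hRdef⟩ : ∃ R, R = fun x => s₆.arr .BL (s₆.arr .BK x) := ⟨_, rfl⟩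
  obtain ⟨EM, hEM⟩ : ∃ EM, EM = s₆.arr .EM := ⟨_, rfl⟩
  obtain ⟨PS, hPS⟩ : ∃ PS, PS = s₆.arr .PS := ⟨_, rfl⟩
  have hst := hR₆.toStruc
  have hem : ∀ p < 2 * b, EM p < 2 * b ∧ PS (EM p) = p := by
    rw [hEM, hPS, ← hGN]; exact hst.em
  have hps : ∀ x < 2 * b, PS x < 2 * b ∧ EM (PS x) = x := by
    rw [hEM, hPS, ← hGN]; exact hst.ps
  have hranks : Ranks b M (s₁.arr .ES) (s₁.arr .ED) (s₁.arr .EL) (s₂.arr .LB) R := by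
    rw [hRdef]
    rw [hGdef] at hR₆
    exact RInv.ranks hlists blab hR₆ fsp
  have hbef : ∀ x < b, ∀ y < b, R x < R (y + b) → Before E (3 + (ν A.start : ℕ)) b x (y + b) := by
    intro x hx y hy hlt
    rw [hRdef] at hlt
    rw [← hBef]
    exact hR₆.bef_fine hG hB (by omega) (by omega) (by omega) (by omega) hlt
  refine (outCmd_spec (n := n) (R := R) fdbl fnum hEM.symm (fun x => by rw [hRdef])
    (fun p hp => (hem p hp).2) (by omega) flen (by omega)).mono ?_
  rintro t₇ s₇ ⟨gt, gout, graw, gres⟩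
  -- the list of states
  have hlen := length_outList (n := n) (fun p hp => (hem p hp).2) hps (by omega)
  have hnd := nodup_outList (n := n) (fun p hp => (hem p hp).2) (le_refl (2 * b))
  have hsorted : (outList EM n (2 * b)).Pairwise fun x y => R x ≤ R y := by
    refine pairwise_outList fun p q hpq hq => ?_
    obtain ⟨h1, h2⟩ := hem p (by omega)
    obtain ⟨h3, h4⟩ := hem q hq
    have m1 := hst.mem (EM p) (by omega)
    have m2 := hst.mem (EM q) (by omega)
    rw [hPS] at h2
    rw [show (toPt s₆).PS (EM p) = p from h2] at m1
    rw [hPS] at h4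
    rw [show (toPt s₆).PS (EM q) = q from h4] at m2
    by_contra hlt
    have := hst.br_le (x := EM q) (y := EM p) (by omega) (by omega) (by
      rw [hRdef] at hlt; exact not_le.1 hlt)
    omega
  obtain ⟨out, hout⟩ : ∃ out, out = outList EM n (2 * b) := ⟨_, rfl⟩
  have hbd : ∀ x ∈ out, 2 < x ∧ x < n + 3 := fun x hx => mem_outList (hout ▸ hx)
  rw [← hout] at hlen hnd hsorted gres
  simp only [← hout] at graw
  have hget : ∀ i : Fin n, (i : ℕ) < out.length := fun i => by rw [hlen]; exact i.2
  have hgb : ∀ i : Fin n, 2 < out[(i : ℕ)]'(hget i) ∧ out[(i : ℕ)]'(hget i) < n + 3 :=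
    fun i => hbd _ (List.getElem_mem _)
  obtain ⟨f, hf⟩ : ∃ f : Fin n → Fin n, ∀ i, 3 + (f i : ℕ) = out[(i : ℕ)]'(hget i) :=
    ⟨fun i => ⟨out[(i : ℕ)]'(hget i) - 3, by have := hgb i; omega⟩, fun i => by
      have := hgb i
      show 3 + (out[(i : ℕ)]'(hget i) - 3) = _
      omega⟩
  have hinj : Injective f := by
    intro i j hij
    have h1 := hf i
    rw [hij, hf j] at h1
    exact Fin.ext ((hnd.getElem_inj_iff (hi := hget j) (hj := hget i)).1 h1).symm
  obtain ⟨q, hq⟩ : ∃ q : Fin n ≃ Q, ∀ i, ν (q i) = f i :=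
    ⟨(Equiv.ofBijective f (Finite.injective_iff_bijective.1 hinj)).trans ν.symm, fun i => by simp⟩
  have hq' : ∀ i : Fin n, 3 + (ν (q i) : ℕ) = out[(i : ℕ)]'(hget i) := fun i => by rw [hq, hf]
  have hchain : out.IsChain (fun x y => R (x + b) ≤ R y) ↔ ∀ i (hi : i + 1 < n),
      R (3 + ν (q ⟨i, by omega⟩) + b) ≤ R (3 + ν (q ⟨i + 1, hi⟩)) := by
    rw [List.isChain_iff_getElem]
    simp only [hq', hlen]
  have hdec := decide_wheeler (ν := ν) (κ := κ) (R := R) hA hmem (hE ▸ hlists) blab hranks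
    (hE ▸ hbef) (hE ▸ hsrc) (by omega) q (by
      intro i hi
      rw [hq', hq']
      exact List.pairwise_iff_getElem.1 hsorted _ _ _ _ (by simp))
  rw [← hchain] at hdec
  refine ⟨?_, gout, fun hW => ?_, fun hW => ?_⟩
  · rw [hGN, hGM] at hpot
    have hlog : Nat.log 2 (2 * b) ≤ Nat.log 2 (4 * b) := Nat.log_mono_right (by omega)
    have h1 : (2 * b + M) * Nat.log 2 (2 * b) ≤ 4 * (b * Nat.log 2 (4 * b)) := by
      rw [← mul_assoc]
      exact Nat.mul_le_mul (by omega) hlog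
    have h2 : 2 * b * (100 * Nat.log 2 (2 * (2 * b)) + 600) =
        200 * (b * Nat.log 2 (4 * b)) + 1200 * b := by
      rw [show 2 * (2 * b) = 4 * b by ring]; ring
    rw [h2] at dt
    rw [← hM] at bt
    rw [bm, ← hM] at ct
    rw [Nat.mul_add, mul_one]
    omega
  · rcases gres with ⟨-, h⟩ | ⟨h, -⟩
    · exact absurd (hdec.1 h).1 hW
    · exact h
  · have hc := hdec.2 hW
    rcases gres with ⟨h, -⟩ | ⟨-, h⟩
    · refine ⟨h, q, (hdec.1 hc).2, fun i => ?_⟩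
      rw [graw i (hget i), ← hq' i]
      omega
    · exact absurd hc (by rw [hchain] at h ⊢; exact h)

end
end WheelerGraph

namespace WheelerGraph

open Refine Function Imp WordRAM

/-! ### The program for the word RAM -/

/-- Advance the address in `baseReg` by the length of the record that starts there. -/
def skipRecord : Program :=
  .seq (.assign baseReg (.bin .add (.reg baseReg)
      (.bin .add (.load (.bin .add (.reg baseReg) (.lit 2))) (.lit 3))))
    (.assign 65 (.bin .sub (.reg 65) (.lit 1)))

/-- Compute the length of the input, which it does not tell, by going from record to record. -/
def findLength : Program :=
  .seq (.assign baseReg (.bin .add (.load (.lit 0)) (.lit 3)))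
    (.seq (.assign 65 (.load (.lit 2)))
      (.seq (.while (.reg 65) skipRecord) (.assign Reg.len.ctorIdx (.reg baseReg))))

section
variable {w b : ℕ}

theorem run_assign {r v : ℕ} {x : Expr} {c : Config} (h : x.eval w c = v) :
    Run w (.assign r x) c (x.cost + 1) ⟨update c.reg r v, c.mem⟩ :=
  h ▸ .assign r x c

theorem run_skipRecords {l : List (ℕ × ℕ × List ℕ)} {c : Config} (hw : b + 3 < 2 ^ w)
    (hin : InputAt c.mem b (c.reg baseReg) (l.flatMap recNums)) (hl : c.reg 65 = l.length) :
    ∃ t c', Run w (.while (.reg 65) skipRecord) c t c' ∧ t ≤ 20 * l.length + 2 ∧ c'.mem = c.mem ∧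
      c'.reg baseReg = c.reg baseReg + (l.flatMap recNums).length ∧
      ∀ r, r ≠ baseReg → r ≠ 65 → c'.reg r = c.reg r := by
  induction l generalizing c with
  | nil =>
    exact ⟨_, c, .while_false hl, by simp [Expr.cost], rfl, by simp, fun _ _ _ => rfl⟩
  | cons r l ih =>
    obtain ⟨u, v, x⟩ := r
    rw [List.flatMap_cons] at hin
    obtain ⟨h0, h⟩ := hin.append
    obtain ⟨-, -, a3⟩ := h0.head
    obtain ⟨-, -, b3⟩ := a3.head
    obtain ⟨c1, c2, c3⟩ := b3.head
    have hx : c.reg baseReg + 1 + 1 + 1 + x.length ≤ b := c3.1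
    have hlen : (recNums (u, v, x)).length = x.length + 3 := by simp [recNums]
    have m1 : 1 % 2 ^ w = 1 := Nat.mod_eq_of_lt (by omega)
    have m2 : 2 % 2 ^ w = 2 := Nat.mod_eq_of_lt (by omega)
    have m3 : 3 % 2 ^ w = 3 := Nat.mod_eq_of_lt (by omega)
    have m4 : (c.reg baseReg + 2) % 2 ^ w = c.reg baseReg + 1 + 1 := Nat.mod_eq_of_lt (by omega)
    have m5 : (x.length + 3) % 2 ^ w = x.length + 3 := Nat.mod_eq_of_lt (by omega)
    have m6 : (c.reg baseReg + (x.length + 3)) % 2 ^ w = c.reg baseReg + (x.length + 3) :=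
      Nat.mod_eq_of_lt (by omega)
    obtain ⟨t, c', h1, h2, h3, h4, h5⟩ := ih (c := ⟨update (update c.reg baseReg
      (c.reg baseReg + (x.length + 3))) 65 l.length, c.mem⟩) (by simpa [baseReg, hlen] using h)
      (by simp)
    refine ⟨_, c', .while_true (by simp [Expr.eval, hl]) (.seq (run_assign
      (v := c.reg baseReg + (x.length + 3)) ?_) (run_assign ?_)) h1, ?_, h3, ?_,
      fun r hr hr' => ?_⟩
    · simp only [Expr.eval, BinOp.eval, m2, m4, c2, m3, m5, m6]
    · simp [Expr.eval, BinOp.eval, m1, hl]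
    · simp only [Expr.cost, List.length_cons]; omega
    · rw [h4]; simp [hlen]; omega
    · rw [h5 r hr hr']; simp [hr, hr']

theorem run_findLength {n i : ℕ} {bits : List ℕ} {l : List (ℕ × ℕ × List ℕ)} {c : Config}
    (hbits : bits.length = n) (hw : b + 3 < 2 ^ w)
    (hin : InputAt c.mem b 0 (n :: i :: l.length :: (bits ++ l.flatMap recNums)))
    (hb : (n :: i :: l.length :: (bits ++ l.flatMap recNums)).length = b) :
    ∃ t c', Run w findLength c t c' ∧ t ≤ 20 * l.length + 20 ∧ c'.mem = c.mem ∧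
      c'.reg baseReg = b ∧ c'.reg Reg.len.ctorIdx = b ∧
      ∀ r, r ≠ baseReg → r ≠ 65 → r ≠ Reg.len.ctorIdx → c'.reg r = c.reg r := by
  obtain ⟨-, a2, a3⟩ := hin.head
  obtain ⟨-, -, b3⟩ := a3.head
  obtain ⟨-, c2, c3⟩ := b3.head
  have c4 := c3.append.2
  simp only [List.length_cons, List.length_append] at hb
  have hlen' : Reg.len.ctorIdx = 2 := rfl
  have m0 : 0 % 2 ^ w = 0 := Nat.zero_mod _
  have m2 : 2 % 2 ^ w = 0 + 1 + 1 := Nat.mod_eq_of_lt (by omega)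
  have m3 : 3 % 2 ^ w = 3 := Nat.mod_eq_of_lt (by omega)
  have m4 : (n + 3) % 2 ^ w = n + 3 := Nat.mod_eq_of_lt (by omega)
  obtain ⟨t, c', h1, h2, h3, h4, h5⟩ := run_skipRecords (w := w) (l := l) (b := b)
    (c := ⟨update (update c.reg baseReg (n + 3)) 65 l.length, c.mem⟩) hw (by
      simp only [baseReg]
      rw [update_of_ne (by omega), update_self]
      rwa [show 0 + 1 + 1 + 1 + bits.length = n + 3 by omega] at c4) (by simp)
  have hbase : c'.reg baseReg = b := by
    rw [h4]
    simp only [baseReg, update_of_ne (show (64 : ℕ) ≠ 65 by decide), update_self]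
    omega
  refine ⟨_, _, .seq (run_assign (v := n + 3) ?_) (.seq (run_assign
    (v := l.length) ?_) (.seq h1 (.assign _ _ _))), ?_, h3, ?_, ?_, fun r hr hr' hr'' => ?_⟩
  · simp only [Expr.eval, BinOp.eval, m0, a2, m3, m4]
  · simp only [Expr.eval, m2, c2]
  · simp only [Expr.cost]; omega
  · simpa [Expr.eval, hlen'] using hbase
  · simpa [Expr.eval] using hbase
  · simp only [update_of_ne hr'']
    rw [h5 r hr hr']
    simp [hr, hr']

end

section
variable {α : Type*} [LinearOrder α] {Q : Type*} {A : GNFA α Q} {n σ : ℕ} {ν : Q ≃ Fin n}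
  {κ : α ≃o Fin σ} {l : List (Q × Q × List α)}

theorem encode_le : ∀ x ∈ A.encode ν κ l, x ≤ (A.encode ν κ l).length + σ := by
  intro x hx
  have hlen := length_encode (A := A) (ν := ν) (κ := κ) (l := l)
  rw [encode_eq] at hx
  have hstart := (ν A.start).2
  have hrec := records_bound (ν := ν) (κ := κ) (l := l)
  have hmem : ∀ r ∈ records ν κ l, (recNums r).length ≤ ((records ν κ l).flatMap recNums).length := by
    intro r hr
    rw [List.length_flatMap]
    exact List.single_le_sum (by simp) _ (List.mem_map.2 ⟨r, hr, rfl⟩)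
  simp only [List.mem_cons, List.mem_append, List.mem_map, List.mem_flatMap] at hx
  rcases hx with rfl | rfl | rfl | ⟨i, -, rfl⟩ | ⟨r, hr, hx⟩
  · omega
  · omega
  · have : (records ν κ l).length ≤ ((records ν κ l).flatMap recNums).length := by
      rw [length_flatMap_recNums]
      generalize records ν κ l = L
      induction L with
      | nil => simp
      | cons r L ih => rw [List.map_cons, List.sum_cons, List.length_cons]; omega
    omega
  · split <;> omega
  · obtain ⟨h1, h2, h3⟩ := hrec r hr
    have h4 := hmem r hr
    simp only [recNums, List.length_cons, List.mem_cons] at hx h4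
    rcases hx with rfl | rfl | rfl | hx
    · omega
    · omega
    · omega
    · have := h3 x hx; omega

theorem length_encode_le (hA : A.IsGDFA) (hl : l.Nodup) (hmem : ∀ x, x ∈ l ↔ x ∈ A.edges) :
    (A.encode ν κ l).length ≤ 5 * A.totalLabelLength + 4 := by
  have h1 := states_le ν hl hmem
  have h2 := length_records_le (ν := ν) (κ := κ) hA hl hmem
  have h3 := sum_records (ν := ν) (κ := κ) hl hmem
  rw [length_encode, length_flatMap_recNums]
  have h4 : ((records ν κ l).map fun r => 3 + r.2.2.length).sum =
      3 * (records ν κ l).length + ((records ν κ l).map fun r => r.2.2.length).sum := by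
    generalize records ν κ l = L
    induction L with
    | nil => rfl
    | cons r L ih => simp only [List.map_cons, List.sum_cons, List.length_cons, ih]; ring
  have h5 : (records ν κ l).length = l.length := by simp [records]
  omega

theorem natLog_le {e : ℕ} (he : 2 ≤ e) : (e : ℝ) * Nat.log 2 e ≤ 3 / 2 * (e * Real.log e) ∧
    (e : ℝ) ≤ 3 / 2 * (e * Real.log e) := by
  have he' : (2 : ℝ) ≤ e := by exact_mod_cast he
  have hl2 := Real.log_two_gt_d9
  have hle : Real.log 2 ≤ Real.log e := Real.log_le_log (by norm_num) he'
  have h3 : (Nat.log 2 e : ℝ) * Real.log 2 ≤ Real.log e := by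
    rw [← Real.log_pow]
    apply Real.log_le_log (by positivity)
    exact_mod_cast Nat.pow_log_le_self 2 (by omega)
  have h4 : (Nat.log 2 e : ℝ) ≤ 3 / 2 * Real.log e := by nlinarith
  constructor <;> nlinarith

/-- The numerical bound behind the running time. -/
theorem time_le {e b m : ℕ} (hb : b ≤ 5 * e + 4) (hm : m ≤ e) :
    ((20 * m + 20 + (20000 * (b * (Nat.log 2 (4 * b) + 1)) + 2000) : ℕ) : ℝ) ≤
      2000000 * (e * Real.log e + 1) := by
  rcases Nat.lt_or_ge e 2 with he | he
  · have h0 : (0 : ℝ) ≤ e * Real.log e := by positivity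
    have hlog : Nat.log 2 (4 * b) ≤ 5 := by
      calc Nat.log 2 (4 * b) ≤ Nat.log 2 36 := Nat.log_mono_right (by omega)
        _ = 5 := by norm_num
    have h1 : b * (Nat.log 2 (4 * b) + 1) ≤ 9 * 6 := Nat.mul_le_mul (by omega) (by omega)
    have h2 : 20 * m + 20 + (20000 * (b * (Nat.log 2 (4 * b) + 1)) + 2000) ≤ 2000000 := by omega
    have h3 : ((20 * m + 20 + (20000 * (b * (Nat.log 2 (4 * b) + 1)) + 2000) : ℕ) : ℝ) ≤ 2000000 := by
      exact_mod_cast h2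
    linarith
  · have hlog : Nat.log 2 (4 * b) ≤ Nat.log 2 e + 5 := by
      calc Nat.log 2 (4 * b) ≤ Nat.log 2 (e * 2 ^ 5) := Nat.log_mono_right (by omega)
        _ = Nat.log 2 e + 5 := by
          rw [show e * 2 ^ 5 = e * 2 * 2 * 2 * 2 * 2 by ring]
          repeat rw [Nat.log_mul_base (by omega) (by omega)]
    have h1 : b * (Nat.log 2 (4 * b) + 1) ≤ 7 * e * (Nat.log 2 e + 6) :=
      Nat.mul_le_mul (by omega) (by omega)
    have h2 : 20 * m + 20 + (20000 * (b * (Nat.log 2 (4 * b) + 1)) + 2000) ≤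
        140000 * (e * Nat.log 2 e) + 840020 * e + 2020 := by
      have : 7 * e * (Nat.log 2 e + 6) = 7 * (e * Nat.log 2 e) + 42 * e := by ring
      omega
    have h3 : ((20 * m + 20 + (20000 * (b * (Nat.log 2 (4 * b) + 1)) + 2000) : ℕ) : ℝ) ≤
        140000 * (e * Nat.log 2 e) + 840020 * e + 2020 := by exact_mod_cast h2
    obtain ⟨h4, h5⟩ := natLog_le he
    refine h3.trans ?_
    clear h1 h2 h3 hlog
    have h0 : (0 : ℝ) ≤ e := e.cast_nonneg
    linarith

/-- No overflow occurs on words whose length is at least a large multiple of the logarithm of the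
input size. -/
theorem words_suffice {σ e b w : ℕ} (hb : b ≤ 5 * e + 4) (hw : (σ + e + 2) ^ 40 ≤ 2 ^ w) :
    b + 64 * ((4 * b + σ) + (20000 * (b * (Nat.log 2 (4 * b) + 1)) + 2000) + 1) < 2 ^ w := by
  refine lt_of_lt_of_le ?_ hw
  generalize hK : σ + e + 2 = K
  have hlog : Nat.log 2 (4 * b) ≤ 4 * b := Nat.log_le_self _ _
  have h1 : b * (Nat.log 2 (4 * b) + 1) ≤ 5 * K * (21 * K) := Nat.mul_le_mul (by omega) (by omega)
  have h2 : 5 * K * (21 * K) = 105 * (K * K) := by ring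
  have h3 : K ≤ K * K := Nat.le_mul_of_pos_left _ (by omega)
  have h4 : b + 64 * ((4 * b + σ) + (20000 * (b * (Nat.log 2 (4 * b) + 1)) + 2000) + 1) <
      2 ^ 38 * (K * K) := by omega
  calc _ < 2 ^ 38 * (K * K) := h4
    _ ≤ K ^ 38 * (K * K) := Nat.mul_le_mul_right _ (Nat.pow_le_pow_left (by omega) _)
    _ = K ^ 40 := by ring

/-- The program decides the Wheeler property and lists the states within the time bound. -/
theorem run_wheeler (hA : A.IsGDFA) (hl : l.Nodup) (hmem : ∀ x, x ∈ l ↔ x ∈ A.edges) {w : ℕ}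
    (hw : (σ + A.totalLabelLength + 2) ^ 40 ≤ 2 ^ w) :
    ∃ (t : ℕ) (s : Config), Run w (.seq findLength wheelerCmd.compile) (initial (A.encode ν κ l)) t s ∧
      (t : ℝ) ≤ 2000000 * (A.totalLabelLength * Real.log A.totalLabelLength + 1) ∧
      (¬ A.IsWheeler → s.reg 0 = 0) ∧
      (A.IsWheeler → s.reg 0 = 1 ∧ ∃ q : Fin n ≃ Q, (∀ i j, A.le (q i) (q j) ↔ i ≤ j) ∧
        ∀ i : Fin n, s.mem (s.reg 1 + i) = ν (q i)) := by
  obtain ⟨b, hb⟩ : ∃ b, b = (A.encode ν κ l).length := ⟨_, rfl⟩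
  have hble := length_encode_le (ν := ν) (κ := κ) hA hl hmem
  rw [← hb] at hble
  have hwords := words_suffice hble hw
  have hin : InputAt (initial (A.encode ν κ l)).mem b 0 (A.encode ν κ l) := by
    refine ⟨by omega, fun i hi => ?_⟩
    show (A.encode ν κ l).getD (0 + i) 0 = _
    rw [zero_add, List.getD_eq_getElem _ _ hi]
  have hb' := hb
  rw [encode_eq] at hb'
  rw [encode_eq (ν := ν) (κ := κ) (l := l) (A := A)] at hin
  rw [← encode_eq] at hin
  obtain ⟨t₁, c₁, r₁, ht₁, hmem₁, hbase, hlen, hreg⟩ :=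
    run_findLength (w := w) (b := b) (c := initial (A.encode ν κ l)) (n := n)
      (i := (ν A.start : ℕ)) (by simp) (by omega) (by rw [← encode_eq]; exact hin) hb'.symm
  set T := 20000 * (b * (Nat.log 2 (4 * b) + 1)) + 2000 with hT
  have hσ := encode_le (A := A) (ν := ν) (κ := κ) (l := l)
  rw [← hb] at hσ
  have hzero : ∀ r : Reg, r ≠ .len → c₁.reg r.ctorIdx = 0 := by
    intro r hr
    rw [hreg _ (by cases r <;> decide) (by cases r <;> decide)
      (by revert hr; cases r <;> decide)]
    rfl
  have harr : ∀ (a : Arr) i, c₁.mem (b + a.ctorIdx + 32 * i) = 0 := by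
    intro a i
    rw [hmem₁]
    exact List.getD_eq_default _ _ (by omega)
  have hraw : ∀ i < b, c₁.mem i = (A.encode ν κ l).getD i 0 := fun i _ => by rw [hmem₁]; rfl
  -- The configuration after the length has been found, seen as a state of the imperative language.
  let s₀ : St := ⟨fun r => c₁.reg r.ctorIdx, c₁.mem, fun a i => c₁.mem (b + a.ctorIdx + 32 * i)⟩
  have hs : Start (A.encode ν κ l) s₀ :=
    ⟨fun i hi => hraw i (by omega), hlen.trans hb, hzero, harr⟩
  have hrep : Rep b s₀ c₁ := ⟨hbase, fun _ => rfl, fun _ _ => rfl, fun _ _ => rfl⟩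
  have hbdd : Bdd b (4 * b + σ) s₀ := by
    refine ⟨fun r => ?_, fun i hi => ?_, fun a i => ?_⟩
    · by_cases h : r = .len
      · subst h
        exact hlen.le.trans (by omega)
      · exact (hzero r h).le.trans (by omega)
    · show c₁.mem i ≤ _
      rw [hraw i hi, List.getD_eq_getElem _ _ (by omega)]
      exact (hσ _ (List.getElem_mem _)).trans (by omega)
    · exact (harr a i).le.trans (by omega)
  obtain ⟨t, s', hev, ht, houtp, hno, hyes⟩ := wheelerCmd_spec hA hmem hs hb.symm
  obtain ⟨t₂, c₂, r₂, ht₂, hrep₂, -⟩ := hev.simulate (w := w) hrep hbdd (by omega) (by omega)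
  have hm := length_records_le (ν := ν) (κ := κ) hA hl hmem
  have hn : n ≤ b := by
    have := length_encode (A := A) (ν := ν) (κ := κ) (l := l)
    omega
  have hres : c₂.reg 0 = s'.reg .res := hrep₂.reg .res
  have hout : c₂.reg 1 = 0 := (hrep₂.reg .outp).trans houtp
  refine ⟨_, c₂, .seq r₁ r₂, le_trans (Nat.cast_le.2 ?_) (time_le hble hm), ?_, ?_⟩
  · omega
  · rw [hres]; exact hno
  · intro hW
    obtain ⟨h1, q, hq, hq'⟩ := hyes hW
    refine ⟨hres.trans h1, q, hq, fun i => ?_⟩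
    rw [hout, zero_add, hrep₂.raw _ (by omega)]
    exact hq' i

end
end WheelerGraph

theorem mainTheorem5 :
    ∃ (P : WordRAM.Program) (c : ℕ) (C : ℝ),
      ∀ (α : Type*) [LinearOrder α] (Q : Type*) (A : GNFA α Q), A.IsGDFA →
      ∀ (n σ : ℕ) (ν : Q ≃ Fin n) (κ : α ≃o Fin σ) (l : List (Q × Q × List α)),
        l.Nodup → (∀ x, x ∈ l ↔ x ∈ A.edges) →
      ∀ w : ℕ, (σ + A.totalLabelLength + 2) ^ c ≤ 2 ^ w →
      ∃ (t : ℕ) (s : WordRAM.Config),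
        WordRAM.Run w P (WordRAM.initial (A.encode ν κ l)) t s ∧
        (t : ℝ) ≤ C * (A.totalLabelLength * Real.log A.totalLabelLength + 1) ∧
        (¬ A.IsWheeler → s.reg 0 = 0) ∧
        (A.IsWheeler → s.reg 0 = 1 ∧
          ∃ q : Fin n ≃ Q, (∀ i j, A.le (q i) (q j) ↔ i ≤ j) ∧
            ∀ i : Fin n, s.mem (s.reg 1 + i) = ν (q i)) :=
  ⟨_, 40, 2000000, fun _ _ _ _ hA _ _ _ _ _ hl hmem _ hw =>
    WheelerGraph.run_wheeler hA hl hmem hw⟩
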